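/- Let $(M^4,g)$ be a smooth Riemannian $4$-manifold (without boundary), let $(N^2,h)$ be a smooth oriented Riemannian surface, and let $F:M^4\to N^2$ be a harmonic morphism, i.e. a smooth map such that for every open $V\subset N$ and every harmonic function $f:V\to\mathbb R$ the function $f\circ F:F^{-1}(V)\to\mathbb R$ is harmonic. Let $j$ be the complex structure on $N$ compatible with the metric and the orientation (rotation by $+\pi/2$), and call $m\in M$ regular if $dF_m$ is surjective. For every regular point $m$ and each orientation of $T_mM$ there is exactly one complex structure $J$ on $T_mM$ that preserves $g$, induces the given orientation, and makes $dF_m:(T_mM,J)\to(T_{F(m)}N,j)$ complex-linear. On an open set $U\subset M$ with a chosen orientation ($U=M$ if $M$ is oriented), let $J_+$ (resp. $J_-$) denote, at the regular points of $F$ in $U$, the structure so obtained for the chosen (resp. opposite) orientation. Then $J_+$ and $J_-$ are differentiable at these points, and for every compact $K\subset M$ there is a constant $A$, independent of $U$ and of its orientation, such that $$\|\nabla_TJ_+\|\,\|\nabla_TJ_-\|\le A$$ for every regular point $m$ of $F$ in $K\cap U$ and every $T\in T_mM$ with $dF_m(T)=0$ and $\|T\|=1$. Here $\nabla$ is the connection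 on endomorphisms of $TM$ induced by the Levi-Civita connection of $g$, and $\|L\|^2=\sum_{i,j}\langle Le_i,e_j\rangle^2$ for any orthonormal basis $(e_i)$ of $T_mM$. -/

import Mathlib

open Bundle Manifold Set
open scoped ContDiff Topology RealInnerProductSpace

set_option linter.unusedSectionVars false

noncomputable section

namespace HarmonicMorphism

section LeviCivita

variable {E : Type*} [NormedAddCommGroup E] [NormedSpace ℝ E] [FiniteDimensional ℝ E]
  {H : Type*} [TopologicalSpace H] (I : ModelWithCorners ℝ E H)
  {M : Type*} [TopologicalSpace M] [ChartedSpace H M] [IsManifold I 2 M]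
  [RiemannianBundle (fun x : M => TangentSpace I x)]

/-- A smooth Riemannian metric is in particular `C^1`. -/
instance (priority := 2000) riemannian_one_of_infty {E : Type*} [NormedAddCommGroup E]
    [NormedSpace ℝ E] {H : Type*} [TopologicalSpace H] (I : ModelWithCorners ℝ E H)
    {M : Type*} [TopologicalSpace M] [ChartedSpace H M] [IsManifold I 1 M]
    [RiemannianBundle (fun x : M => TangentSpace I x)]
    [h : IsContMDiffRiemannianBundle I ∞ E (fun x : M => TangentSpace I x)] :
    IsContMDiffRiemannianBundle I 1 E (fun x : M => TangentSpace I x) :=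
  h.of_le (by exact_mod_cast le_top)

/-- The right-hand side of the Koszul formula for `⟪∇_X Y, Z⟫` at `x`. -/
def koszul (Y X Z : Π x : M, TangentSpace I x) (x : M) : ℝ :=
  (d% (fun y => ⟪Y y, Z y⟫) x (X x) + d% (fun y => ⟪X y, Z y⟫) x (Y x)
    - d% (fun y => ⟪X y, Y y⟫) x (Z x)
    + ⟪VectorField.mlieBracket I X Y x, Z x⟫ - ⟪VectorField.mlieBracket I X Z x, Y x⟫
    - ⟪VectorField.mlieBracket I Y Z x, X x⟫) / 2

variable [IsContMDiffRiemannianBundle I 1 E (fun x : M => TangentSpace I x)]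

theorem mdiffAt_inner {X Y : Π x : M, TangentSpace I x} {x : M}
    (hX : MDiffAt (T% X) x) (hY : MDiffAt (T% Y) x) : MDiffAt (fun y => ⟪X y, Y y⟫) x :=
  MDifferentiableAt.inner_bundle (E := fun x : M => TangentSpace I x) hX hY

theorem koszul_tensorial_left {Y Z : Π x : M, TangentSpace I x} {x : M}
    (hY : MDiffAt (T% Y) x) (hZ : MDiffAt (T% Z) x) :
    TensorialAt I E (fun X => koszul I Y X Z x) x where
  smul {f X} hf hX := by
    simp only [koszul, Pi.smul_apply', inner_smul_left, inner_smul_right, map_smul, smul_eq_mul,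
      VectorField.mlieBracket_smul_left hf hX, inner_add_left, RCLike.conj_to_real,
      mvfderiv_fun_mul hf (mdiffAt_inner I hX hZ), mvfderiv_fun_mul hf (mdiffAt_inner I hX hY),
      add_apply, smul_apply]
    have h1 : ⟪X x, Z x⟫ = ⟪Z x, X x⟫ := real_inner_comm _ _
    ring
  add {X X'} hX hX' := by
    simp only [koszul, Pi.add_apply, inner_add_left, inner_add_right, map_add,
      VectorField.mlieBracket_add_left hX hX',
      mvfderiv_fun_add (mdiffAt_inner I hX hZ) (mdiffAt_inner I hX' hZ),
      mvfderiv_fun_add (mdiffAt_inner I hX hY) (mdiffAt_inner I hX' hY), add_apply]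
    ring

theorem koszul_tensorial_right {Y X : Π x : M, TangentSpace I x} {x : M}
    (hY : MDiffAt (T% Y) x) (hX : MDiffAt (T% X) x) :
    TensorialAt I E (fun Z => koszul I Y X Z x) x where
  smul {f Z} hf hZ := by
    simp only [koszul, Pi.smul_apply', inner_smul_left, inner_smul_right, map_smul, smul_eq_mul,
      VectorField.mlieBracket_smul_right hf hZ, inner_add_left, RCLike.conj_to_real,
      mvfderiv_fun_mul hf (mdiffAt_inner I hY hZ), mvfderiv_fun_mul hf (mdiffAt_inner I hX hZ),
      add_apply, smul_apply]
    have h1 : ⟪X x, Z x⟫ = ⟪Z x, X x⟫ := real_inner_comm _ _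
    have h2 : ⟪Y x, Z x⟫ = ⟪Z x, Y x⟫ := real_inner_comm _ _
    rw [h1, h2]
    ring
  add {Z Z'} hZ hZ' := by
    simp only [koszul, Pi.add_apply, inner_add_left, inner_add_right, map_add,
      VectorField.mlieBracket_add_right hZ hZ',
      mvfderiv_fun_add (mdiffAt_inner I hY hZ) (mdiffAt_inner I hY hZ'),
      mvfderiv_fun_add (mdiffAt_inner I hX hZ) (mdiffAt_inner I hX hZ'), add_apply]
    ring

/-- `(X, Z) ↦ ⟪∇_X Y, Z⟫` at a point where `Y` is differentiable. -/
def koszulForm {Y : Π x : M, TangentSpace I x} {x : M} (hY : MDiffAt (T% Y) x) :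
    TangentSpace I x →L[ℝ] TangentSpace I x →L[ℝ] ℝ :=
  TensorialAt.mkHom₂ (fun X Z => koszul I Y X Z x) x
    (fun _ hZ => koszul_tensorial_left I hY hZ) (fun _ hX => koszul_tensorial_right I hY hX)

theorem koszulForm_apply {X Y Z : Π x : M, TangentSpace I x} {x : M} (hY : MDiffAt (T% Y) x)
    (hX : MDiffAt (T% X) x) (hZ : MDiffAt (T% Z) x) :
    koszulForm I hY (X x) (Z x) = koszul I Y X Z x :=
  TensorialAt.mkHom₂_apply _ _ hX hZ

instance finiteDimensional_tangentSpace (x : M) : FiniteDimensional ℝ (TangentSpace I x) :=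
  inferInstanceAs (FiniteDimensional ℝ E)

instance completeSpace_tangentSpace (x : M) : CompleteSpace (TangentSpace I x) :=
  FiniteDimensional.complete ℝ _

/-- The vector dual to a covector. -/
def sharp {x : M} (ℓ : TangentSpace I x →L[ℝ] ℝ) : TangentSpace I x :=
  (InnerProductSpace.toDual ℝ (TangentSpace I x)).symm ℓ

theorem inner_sharp {x : M} (ℓ : TangentSpace I x →L[ℝ] ℝ) (v : TangentSpace I x) :
    ⟪sharp I ℓ, v⟫ = ℓ v := InnerProductSpace.toDual_symm_apply

open Classical in
/-- The Levi-Civita connection as a bare operator. -/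
def leviCivitaFun (Y : Π x : M, TangentSpace I x) (x : M) :
    TangentSpace I x →L[ℝ] TangentSpace I x :=
  if hY : MDiffAt (T% Y) x then
    LinearMap.toContinuousLinearMap
      { toFun := fun v => sharp I (koszulForm I hY v)
        map_add' := fun v w => by simp [sharp]
        map_smul' := fun c v => by simp [sharp] }
  else 0

theorem inner_leviCivitaFun {X Y Z : Π x : M, TangentSpace I x} {x : M} (hY : MDiffAt (T% Y) x)
    (hX : MDiffAt (T% X) x) (hZ : MDiffAt (T% Z) x) :
    ⟪leviCivitaFun I Y x (X x), Z x⟫ = koszul I Y X Z x := by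
  rw [← koszulForm_apply I hY hX hZ]
  rw [leviCivitaFun, dif_pos hY]
  exact inner_sharp I _ _

theorem leviCivitaFun_eq_iff {Y : Π x : M, TangentSpace I x} {x : M} (hY : MDiffAt (T% Y) x)
    (L : TangentSpace I x →L[ℝ] TangentSpace I x)
    (h : ∀ X Z : Π x : M, TangentSpace I x, MDiffAt (T% X) x → MDiffAt (T% Z) x →
      koszul I Y X Z x = ⟪L (X x), Z x⟫) : leviCivitaFun I Y x = L := by
  ext v
  refine ext_inner_right ℝ fun w => ?_
  have hX := FiberBundle.mdifferentiableAt_extend (I := I) (F := E) v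
  have hZ := FiberBundle.mdifferentiableAt_extend (I := I) (F := E) w
  have h1 := inner_leviCivitaFun I hY hX hZ
  rw [h _ _ hX hZ] at h1
  simpa using h1

/-- The Levi-Civita connection of the Riemannian metric on `M`. -/
def leviCivita : CovariantDerivative I E (fun x : M => TangentSpace I x) where
  toFun := leviCivitaFun I
  isCovariantDerivativeOnUniv :=
    { add := by
        intro Y Y' x hY hY' _
        refine leviCivitaFun_eq_iff I (mdifferentiableAt_add_section hY hY') _ fun X Z hX hZ => ?_
        rw [add_apply, inner_add_left, inner_leviCivitaFun I hY hX hZ,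
          inner_leviCivitaFun I hY' hX hZ]
        simp only [koszul, Pi.add_apply, inner_add_left, inner_add_right, map_add,
          VectorField.mlieBracket_add_left hY hY', VectorField.mlieBracket_add_right hY hY',
          mvfderiv_fun_add (mdiffAt_inner I hY hZ) (mdiffAt_inner I hY' hZ),
          mvfderiv_fun_add (mdiffAt_inner I hX hY) (mdiffAt_inner I hX hY'), add_apply]
        ring
      leibniz := by
        intro Y f x hY hf _
        refine leviCivitaFun_eq_iff I (hf.smul_section hY) _ fun X Z hX hZ => ?_
        rw [add_apply, smul_apply, inner_add_left, inner_smul_left,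
          inner_leviCivitaFun I hY hX hZ]
        simp only [koszul, Pi.smul_apply', inner_smul_left, inner_smul_right, map_smul,
          smul_eq_mul, VectorField.mlieBracket_smul_left hf hY,
          VectorField.mlieBracket_smul_right hf hY, inner_add_left, RCLike.conj_to_real,
          mvfderiv_fun_mul hf (mdiffAt_inner I hY hZ),
          mvfderiv_fun_mul hf (mdiffAt_inner I hX hY), add_apply, smul_apply,
          ContinuousLinearMap.smulRight_apply]
        have h1 : ⟪X x, Y x⟫ = ⟪Y x, X x⟫ := real_inner_comm _ _
        rw [h1]
        ring }

theorem inner_leviCivita {X Y Z : Π x : M, TangentSpace I x} {x : M} (hY : MDiffAt (T% Y) x)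
    (hX : MDiffAt (T% X) x) (hZ : MDiffAt (T% Z) x) :
    ⟪leviCivita I Y x (X x), Z x⟫ = koszul I Y X Z x :=
  inner_leviCivitaFun I hY hX hZ

/-- The Levi-Civita connection is compatible with the metric. -/
theorem leviCivita_isMetricCompatible : 
    CovariantDerivative.IsMetricCompatible (V := fun x : M => TangentSpace I x) (leviCivita I) := by
  rw [CovariantDerivative.isMetricCompatible_iff]
  intro x X Y Z hX hY hZ
  beta_reduce
  rw [real_inner_comm (leviCivita I Z x (X x)), inner_leviCivita I hY hX hZ, inner_leviCivita I hZ hX hY]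
  simp only [koszul, real_inner_comm (Y _) (Z _)]
  have h : VectorField.mlieBracket I Z Y x = - VectorField.mlieBracket I Y Z x :=
    VectorField.mlieBracket_swap_apply
  rw [h, inner_neg_left]
  ring

/-- The Levi-Civita connection is torsion-free. -/
theorem leviCivita_torsion : (leviCivita I (M := M)).torsion = 0 := by
  rw [CovariantDerivative.torsion_eq_zero_iff]
  intro X Y x hX hY
  refine ext_inner_right ℝ fun w => ?_
  obtain ⟨Z, hZ, rfl⟩ : ∃ Z : Π x : M, TangentSpace I x, MDiffAt (T% Z) x ∧ Z x = w :=
    ⟨_, FiberBundle.mdifferentiableAt_extend (I := I) (F := E) w, by simp⟩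
  rw [inner_sub_left, inner_leviCivita I hY hX hZ, inner_leviCivita I hX hY hZ]
  have h : VectorField.mlieBracket I Y X x = - VectorField.mlieBracket I X Y x :=
    VectorField.mlieBracket_swap_apply
  simp only [koszul, real_inner_comm (X _) (Y _)]
  rw [h, inner_neg_left]
  ring

/-- The gradient of a function. -/
def grad (f : M → ℝ) (x : M) : TangentSpace I x := sharp I (d% f x)

/-- The Laplace-Beltrami operator, `Δ f = div (grad f) = trace (v ↦ ∇_v grad f)`. -/
def laplacian (f : M → ℝ) (x : M) : ℝ :=
  LinearMap.trace ℝ (TangentSpace I x) (leviCivita I (grad I f) x).toLinearMap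

/-- `f` is harmonic on the (open) set `V`. -/
def IsHarmonicOn (f : M → ℝ) (V : Set M) : Prop :=
  ContMDiffOn I 𝓘(ℝ) 2 f V ∧ ∀ x ∈ V, laplacian I f x = 0

/-- Differentiability at `x` of a field of endomorphisms of the tangent spaces. -/
def EndMDiffAt (J : Π y : M, TangentSpace I y →L[ℝ] TangentSpace I y) (x : M) : Prop :=
  MDifferentiableAt I (I.prod 𝓘(ℝ, E →L[ℝ] E))
    (fun y => TotalSpace.mk' (E →L[ℝ] E)
      (E := fun y : M => TangentSpace I y →L[ℝ] TangentSpace I y) y (J y)) x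

theorem EndMDiffAt.apply {J : Π y : M, TangentSpace I y →L[ℝ] TangentSpace I y} {x : M}
    (hJ : EndMDiffAt I J x) {Y : Π y : M, TangentSpace I y} (hY : MDiffAt (T% Y) x) :
    MDiffAt (T% (fun y => J y (Y y))) x :=
  MDifferentiableAt.clm_bundle_apply (F₁ := E) (F₂ := E) hJ hY

theorem covDerivEnd_tensorial {J : Π y : M, TangentSpace I y →L[ℝ] TangentSpace I y} {x : M}
    (hJ : EndMDiffAt I J x) :
    TensorialAt I E (fun Y : Π y : M, TangentSpace I y =>
      leviCivita I (fun y => J y (Y y)) x - J x ∘L leviCivita I Y x) x where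
  smul {f Y} hf hY := by
    have h : (fun y => J y ((f • Y) y)) = f • fun y => J y (Y y) := by ext y; simp
    rw [h, (leviCivita I).isCovariantDerivativeOn.leibniz (hJ.apply I hY) hf,
      (leviCivita I).isCovariantDerivativeOn.leibniz hY hf]
    ext v
    simp [smul_sub]
  add {Y Y'} hY hY' := by
    have h : (fun y => J y ((Y + Y') y)) = (fun y => J y (Y y)) + fun y => J y (Y' y) := by
      ext y; simp
    rw [h, (leviCivita I).isCovariantDerivativeOn.add (hJ.apply I hY) (hJ.apply I hY'),
      (leviCivita I).isCovariantDerivativeOn.add hY hY']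
    ext v
    simp
    abel

open Classical in
/-- The covariant derivative `∇_T J` at `x` of a field `J` of endomorphisms of the tangent spaces,
for the connection induced by the Levi-Civita connection:
`(∇_T J) Y = ∇_T (J Y) - J (∇_T Y)`. (By convention, zero where `J` is not differentiable.) -/
def covDerivEnd (J : Π y : M, TangentSpace I y →L[ℝ] TangentSpace I y) (x : M)
    (T : TangentSpace I x) : TangentSpace I x →L[ℝ] TangentSpace I x :=
  if hJ : EndMDiffAt I J x then
    (TensorialAt.mkHom (fun Y : Π y : M, TangentSpace I y =>
      leviCivita I (fun y => J y (Y y)) x - J x ∘L leviCivita I Y x) x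
      (covDerivEnd_tensorial I hJ)).flip T
  else 0

theorem covDerivEnd_apply {J : Π y : M, TangentSpace I y →L[ℝ] TangentSpace I y} {x : M}
    (hJ : EndMDiffAt I J x) (T : TangentSpace I x) {Y : Π y : M, TangentSpace I y}
    (hY : MDiffAt (T% Y) x) :
    covDerivEnd I J x T (Y x) = leviCivita I (fun y => J y (Y y)) x T - J x (leviCivita I Y x T) := by
  rw [covDerivEnd, dif_pos hJ, ContinuousLinearMap.flip_apply,
    TensorialAt.mkHom_apply (covDerivEnd_tensorial I hJ) hY]
  rfl


end LeviCivita

/-- The Euclidean (Hilbert-Schmidt) norm `(∑ i j, ⟪L e_i, e_j⟫ ^ 2) ^ (1/2)`. -/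
def hsNorm {V : Type*} [NormedAddCommGroup V] [InnerProductSpace ℝ V] [FiniteDimensional ℝ V]
    (L : V →L[ℝ] V) : ℝ :=
  Real.sqrt (∑ i, ‖L (stdOrthonormalBasis ℝ V i)‖ ^ 2)

section Orientation

variable {E : Type*} [NormedAddCommGroup E] [NormedSpace ℝ E]
  {H : Type*} [TopologicalSpace H] (I : ModelWithCorners ℝ E H)
  {M : Type*} [TopologicalSpace M] [ChartedSpace H M] [IsManifold I 1 M]

/-- The pointwise orientation `o` is continuous on the open set `U`: every point of `U` has a
neighbourhood on which `o` is the orientation of a continuous frame. -/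
def IsOrientationOn {n : ℕ} (o : Π x : M, Orientation ℝ (TangentSpace I x) (Fin n))
    (U : Set M) : Prop :=
  ∀ x ∈ U, ∃ W : Set M, IsOpen W ∧ x ∈ W ∧
    ∃ b : Π y : M, Module.Basis (Fin n) ℝ (TangentSpace I y),
      (∀ i, ContinuousOn (fun y => (⟨y, b y i⟩ : TangentBundle I M)) W) ∧
      ∀ y ∈ W, (b y).orientation = o y

end Orientation

/-- The orientation of a real vector space of dimension `4` induced by the complex structure `J`
(the one for which the bases `(u, J u, v, J v)` are positive) is `o`. -/
def InducesOrientation {V : Type*} [AddCommGroup V] [Module ℝ V]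
    (o : Orientation ℝ V (Fin 4)) (J : V → V) : Prop :=
  ∀ b : Module.Basis (Fin 4) ℝ V, b 1 = J (b 0) → b 3 = J (b 2) → b.orientation = o

section Morphism

variable {EM : Type*} [NormedAddCommGroup EM] [NormedSpace ℝ EM] [FiniteDimensional ℝ EM]
  {HM : Type*} [TopologicalSpace HM] (IM : ModelWithCorners ℝ EM HM)
  {M : Type*} [TopologicalSpace M] [ChartedSpace HM M] [IsManifold IM ∞ M]
  [RiemannianBundle (fun x : M => TangentSpace IM x)]
  [IsContMDiffRiemannianBundle IM ∞ EM (fun x : M => TangentSpace IM x)]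
  {EN : Type*} [NormedAddCommGroup EN] [NormedSpace ℝ EN] [FiniteDimensional ℝ EN]
  {HN : Type*} [TopologicalSpace HN] (IN : ModelWithCorners ℝ EN HN)
  {N : Type*} [TopologicalSpace N] [ChartedSpace HN N] [IsManifold IN ∞ N]
  [RiemannianBundle (fun x : N => TangentSpace IN x)]
  [IsContMDiffRiemannianBundle IN ∞ EN (fun x : N => TangentSpace IN x)]

/-- A harmonic morphism: a smooth map which pulls back local harmonic functions to local harmonic
functions. -/
def IsHarmonicMorphism (F : M → N) : Prop :=
  ContMDiff IM IN ∞ F ∧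
    ∀ V : Set N, IsOpen V → ∀ f : N → ℝ, IsHarmonicOn IN f V → IsHarmonicOn IM (f ∘ F) (F ⁻¹' V)

/-- Regular points of `F`. -/
def IsRegularPoint (F : M → N) (m : M) : Prop := Function.Surjective (mfderiv IM IN F m)

end Morphism

instance fact_finrank_tangentSpace_two {N : Type*} [TopologicalSpace N]
    [ChartedSpace (EuclideanSpace ℝ (Fin 2)) N] (y : N) :
    Fact (Module.finrank ℝ (TangentSpace (𝓡 2) y) = 2) :=
  ⟨finrank_euclideanSpace_fin (𝕜 := ℝ) (n := 2)⟩

section Adapted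

variable {M : Type*} [TopologicalSpace M] [ChartedSpace (EuclideanSpace ℝ (Fin 4)) M]
  [RiemannianBundle (fun x : M => TangentSpace (𝓡 4) x)]
  {N : Type*} [TopologicalSpace N] [ChartedSpace (EuclideanSpace ℝ (Fin 2)) N]
  [RiemannianBundle (fun x : N => TangentSpace (𝓡 2) x)]

/-- The complex structure on `T_y N` compatible with the metric and the orientation: rotation by
`+π/2`. -/
def surfaceJ (oN : Π y : N, Orientation ℝ (TangentSpace (𝓡 2) y) (Fin 2)) (y : N) :
    TangentSpace (𝓡 2) y → TangentSpace (𝓡 2) y :=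
  (oN y).rightAngleRotation

/-- `J` is a complex structure on `T_m M` which preserves the metric, induces the orientation `o`,
and for which `dF` is complex-linear. -/
structure IsAdapted (oN : Π y : N, Orientation ℝ (TangentSpace (𝓡 2) y) (Fin 2)) (F : M → N)
    (m : M) (o : Orientation ℝ (TangentSpace (𝓡 4) m) (Fin 4))
    (J : TangentSpace (𝓡 4) m →L[ℝ] TangentSpace (𝓡 4) m) : Prop where
  sq : ∀ v, J (J v) = -v
  isometry : ∀ u v, ⟪J u, J v⟫ = ⟪u, v⟫
  orientation : InducesOrientation o J
  complexLinear : ∀ v, mfderiv (𝓡 4) (𝓡 2) F m (J v) = surfaceJ oN (F m) (mfderiv (𝓡 4) (𝓡 2) F m v)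

end Adapted

end HarmonicMorphism
end


open HarmonicMorphism

/-!
Near a regular point the harmonic morphism `F` is described by the pull-back `a + i c` of a
holomorphic coordinate `u + i v` of the surface. Such coordinates are found by solving the Beltrami
equation (`exists_beltrami`) with a Neumann series in the algebra of Fourier transforms of functions
in a weighted `L¹` space, where the Beurling transform does not increase the norm; this gives
`exists_holomorphicCoordinate`. Then `u`, `v`, `u v` and `u ^ 2 - v ^ 2` are harmonic, so their
pull-backs are harmonic too, and the product rule for the Laplacian shows that `grad a` and `grad c`
are orthogonal of equal length `l` (`IsHarmonicMorphism.conformal`). An adapted complex structure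
`J` is an orthogonal one with `J (grad a) = grad c`; it rotates the vertical plane by `±π/2`, the
sign being fixed by the orientation. In a local orthonormal frame that starts with the two
normalized gradients it has constant coefficients, whence existence, uniqueness and
differentiability.

The endomorphism `∇_T J` is skew and anticommutes with `J`, so that it is determined by its value
`∇_T (grad c) - J (∇_T (grad a))` on `grad a`. With the Hessians `A` of `a` and `B` of `c`, put
`S = A + i B`. For a vertical unit vector `T` the norms of `∇_T J₊` and `∇_T J₋` are, up to the
factor `2 / l`, the moduli of `S(T, T) + i S(T, J₊ T)` and `S(T, T) - i S(T, J₊ T)`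
(`norm_sq_mul_hsNorm_covDerivEnd_sq`). Their product is `S(T, T) ^ 2 + S(T, J₊ T) ^ 2`,
  which is half
of the complex bilinear square `⟨S, S⟩ = |A| ^ 2 - |B| ^ 2 + 2 i ⟨A, B⟩`: the horizontal and mixed
parts of `S` are isotropic because `S(grad c, ·) = i S(grad a, ·)`, and the vertical part of `S` is
trace-free because `S` and its horizontal part are (`mul_eq_of_isotropic`).

It remains to see that `⟨S, S⟩` is `O(l ^ 2)`, locally uniformly and independently of the chosen
coordinate. By the Bochner formula, `|A| ^ 2` is `Δ |grad a| ^ 2 / 2` up to a curvature term of size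
`O(l ^ 2)` (`exists_bochner_bound`). The functions `|grad a| ^ 2` and `|grad c| ^ 2` coincide, so
`|A| ^ 2 - |B| ^ 2 = O(l ^ 2)`, and likewise for `a + c` and `a - c`, which bounds `⟨A, B⟩`
(`exists_hessian_bound`). The curvature bound is continuous, hence uniform on compact sets.
-/

set_option linter.unusedSectionVars false

noncomputable section

namespace HarmonicMorphism

/-! ### Derivatives of functions along vector fields, orthonormal frames -/

section Calculus

variable {E : Type*} [NormedAddCommGroup E] [NormedSpace ℝ E] [FiniteDimensional ℝ E]
  {H : Type*} [TopologicalSpace H] (I : ModelWithCorners ℝ E H) [I.Boundaryless]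
  {M : Type*} [TopologicalSpace M] [ChartedSpace H M] [IsManifold I ∞ M]

theorem two_le_infty : (2 : ℕ∞ω) ≤ ∞ := by
  have h : ∀ n : ℕ, (n : ℕ∞ω) ≤ ∞ := fun n => by exact_mod_cast le_top
  exact h 2

theorem three_le_infty : (3 : ℕ∞ω) ≤ ∞ := by
  have h : ∀ n : ℕ, (n : ℕ∞ω) ≤ ∞ := fun n => by exact_mod_cast le_top
  exact h 3

theorem mvfderiv_comp_chart {x y : M} (hy : y ∈ (extChartAt I x).source) {f : M → ℝ}
    (hf : MDiffAt f y)
    (v : TangentSpace I y) :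
    d% f y v = fderiv ℝ (f ∘ (extChartAt I x).symm) (extChartAt I x y) (mfderiv I 𝓘(ℝ, E)
      (extChartAt I x) y v) := by
  set φ := extChartAt I x
  have h0 : φ.symm (φ y) = y := φ.left_inv hy
  have h1 : MDifferentiableAt 𝓘(ℝ, E) I φ.symm (φ y) := by
    have := (contMDiffOn_extChartAt_symm (I := I) (n := ∞) x).contMDiffAt
      (extChartAt_target_mem_nhds' (φ.map_source hy))
    exact this.mdifferentiableAt (by simp)
  have h2 : MDifferentiableAt I 𝓘(ℝ, E) φ y := mdifferentiableAt_extChartAt (by simpa [φ] using hy)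
  have hf' : MDiffAt f (φ.symm (φ y)) := by rwa [h0]
  have h3 : MDifferentiableAt 𝓘(ℝ, E) 𝓘(ℝ, ℝ) (f ∘ φ.symm) (φ y) := hf'.comp _ h1
  have h4 : mfderiv I 𝓘(ℝ, ℝ) ((f ∘ φ.symm) ∘ φ) y = (mfderiv 𝓘(ℝ, E) 𝓘(ℝ, ℝ) (f ∘ φ.symm)
    (φ y)).comp (mfderiv I 𝓘(ℝ, E) φ y) := mfderiv_comp y h3 h2
  have h5 : ((f ∘ φ.symm) ∘ φ) =ᶠ[𝓝 y] f := by
    filter_upwards [extChartAt_source_mem_nhds' hy] with z hz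
    simp [φ.left_inv hz]
  rw [h5.mfderiv_eq, mfderiv_eq_fderiv] at h4
  have := congrArg (fun L => L v) h4
  exact this

open VectorField in
/-- The coordinate expression of a vector field `X` in the chart at `x`. -/
def chartField (x : M) (X : Π y : M, TangentSpace I y) : E → E :=
  mpullbackWithin 𝓘(ℝ, E) I (extChartAt I x).symm X (range I)

theorem chartField_apply {x y : M} (hy : y ∈ (extChartAt I x).source)
    (X : Π y : M, TangentSpace I y) :
    chartField I x X (extChartAt I x y) = mfderiv I 𝓘(ℝ, E) (extChartAt I x) y (X y) := by
  set φ := extChartAt I x with hφ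
  obtain ⟨z, hz, rfl⟩ : ∃ z ∈ φ.target, y = φ.symm z := ⟨φ y, φ.map_source hy, (φ.left_inv hy).symm⟩
  rw [φ.right_inv hz]
  have h1 := mfderiv_extChartAt_comp_mfderivWithin_extChartAt_symm (I := I) hz
  have h2 := isInvertible_mfderivWithin_extChartAt_symm (I := I) hz
  change ((mfderivWithin 𝓘(ℝ, E) I φ.symm (range I) z).inverse) (X (φ.symm z)) = _
  have h3 : (mfderivWithin 𝓘(ℝ, E) I φ.symm (range I) z) ((mfderivWithin 𝓘(ℝ, E) I φ.symm
    (range I) z).inverse (X (φ.symm z))) = X (φ.symm z) := by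
    rw [ContinuousLinearMap.IsInvertible.self_apply_inverse h2]
  have h4 := congrArg (fun L => L ((mfderivWithin 𝓘(ℝ, E) I φ.symm (range I) z).inverse (X
    (φ.symm z)))) h1
  simp only [ContinuousLinearMap.comp_apply] at h4
  rw [← hφ, h3] at h4
  exact h4.symm

theorem differentiableAt_chartField {x : M} {X : Π y : M, TangentSpace I y} (hX : MDiffAt
    (T% X) x) :
    DifferentiableAt ℝ (chartField I x X) (extChartAt I x x) := by
  have := MDifferentiableWithinAt.differentiableWithinAt_mpullbackWithin_vectorField
    (s := univ) hX.mdifferentiableWithinAt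
  have h : DifferentiableWithinAt ℝ (chartField I x X)
    ((extChartAt I x).symm ⁻¹' univ ∩ range I) (extChartAt I x x) := this
  rwa [I.range_eq_univ, preimage_univ, univ_inter, differentiableWithinAt_univ] at h

theorem eventually_mdifferentiableAt {f : M → ℝ} {x : M} (hf : CMDiffAt 2 f x) :
    ∀ᶠ y in 𝓝 x, MDiffAt f y :=
  ((contMDiffAt_iff_contMDiffAt_nhds (by simp)).1 hf).mono fun _ h => h.mdifferentiableAt (by simp)

/-- The Lie bracket acts on functions as the commutator of derivations. -/
theorem mvfderiv_mlieBracket {f : M → ℝ} {X Y : Π x : M, TangentSpace I x} {x : M}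
    (hf : CMDiffAt 2 f x) (hX : MDiffAt (T% X) x) (hY : MDiffAt (T% Y) x) :
    d% f x (VectorField.mlieBracket I X Y x) =
      d% (fun y => d% f y (Y y)) x (X x) - d% (fun y => d% f y (X y)) x (Y x) := by
  set φ := extChartAt I x with hφ
  have hx : x ∈ φ.source := mem_extChartAt_source x
  have hf' : ContDiffAt ℝ 2 (f ∘ φ.symm) (φ x) := by
    have := (contMDiffAt_iff.1 hf).2
    rw [I.range_eq_univ, contDiffWithinAt_univ] at this
    exact this
  have key : ∀ (Z W : Π x : M, TangentSpace I x), MDiffAt (T% Z) x →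
      d% (fun y => d% f y (Z y)) x (W x) =
        fderiv ℝ (fun z => fderiv ℝ (f ∘ φ.symm) z (chartField I x Z z)) (φ x) (chartField I x W
          (φ x)) := by
    intro Z W hZ
    have h1 : (fun y => d% f y (Z y)) =ᶠ[𝓝 x] (fun z => fderiv ℝ (f ∘ φ.symm) z
      (chartField I x Z z)) ∘ φ := by
      filter_upwards [extChartAt_source_mem_nhds (I := I) x,
        eventually_mdifferentiableAt I hf] with y hy hfy
      rw [mvfderiv_comp_chart I hy hfy, Function.comp_apply, chartField_apply I hy]
    have h2 : DifferentiableAt ℝ (fun z => fderiv ℝ (f ∘ φ.symm) z (chartField I x Z z)) (φ x) :=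
      ((hf'.fderiv_right (m := 1) (by norm_num)).differentiableAt (by simp)).clm_apply
        (differentiableAt_chartField I hZ)
    have h3 : MDifferentiableAt I 𝓘(ℝ, E) φ x := mdifferentiableAt_extChartAt (by simp)
    rw [mvfderiv, h1.mfderiv_eq, mfderiv_comp x h2.mdifferentiableAt h3, mfderiv_eq_fderiv,
      chartField_apply I hx W]
    rfl
  rw [key Y X hY, key X Y hX, ← VectorField.fderiv_apply_lieBracket hf' (by simp)
    (differentiableAt_chartField I hY) (differentiableAt_chartField I hX),
    mvfderiv_comp_chart I hx (hf.mdifferentiableAt (by simp)), ← hφ]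
  congr 1
  let B : E := VectorField.lieBracketWithin ℝ (chartField I x X) (chartField I x Y)
    (φ.symm ⁻¹' univ ∩ range I) (φ x)
  have h : VectorField.mlieBracket I X Y x = (mfderiv I 𝓘(ℝ, E) φ x).inverse B := by
    rw [← VectorField.mlieBracketWithin_univ, VectorField.mlieBracketWithin_apply]
    rfl
  have hB : B = VectorField.lieBracket ℝ (chartField I x X) (chartField I x Y) (φ x) := by
    simp only [B]
    rw [I.range_eq_univ, preimage_univ, univ_inter, VectorField.lieBracketWithin_univ]
  rw [h, ← hB]
  exact ContinuousLinearMap.IsInvertible.self_apply_inverse (isInvertible_mfderiv_extChartAt hx) B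

theorem contMDiffAt_mvfderiv_apply {F : Type*} [NormedAddCommGroup F] [NormedSpace ℝ F]
    {n m : ℕ∞ω} {f : M → F} {X : Π x : M, TangentSpace I x} {x : M}
    (hf : CMDiffAt m f x) (hX : CMDiffAt n (T% X) x) (hn : n + 1 ≤ m) :
    CMDiffAt n (fun y => d% f y (X y)) x := by
  have h1 := hf.mfderiv_const (I' := 𝓘(ℝ, F)) hn
  have h2 : ContMDiffAt I (𝓘(ℝ, F).prod 𝓘(ℝ, F)) n
      (fun y => (⟨f y, mfderiv I 𝓘(ℝ, F) f y (X y)⟩ : TangentBundle 𝓘(ℝ, F) F)) x :=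
    ContMDiffAt.clm_apply_of_inCoordinates (b₁ := id) (b₂ := f)
      (ϕ := fun y => mfderiv I 𝓘(ℝ, F) f y) (v := X) h1 hX (hf.of_le (le_trans le_self_add hn))
  exact (contMDiff_snd_tangentBundle_modelSpace F 𝓘(ℝ, F)).contMDiffAt.comp x h2

variable [RiemannianBundle (fun x : M => TangentSpace I x)]

/-- `e` is a `C^n` orthonormal frame of the tangent bundle over the open set `W`. -/
structure IsOrthonormalFrameOn (n : ℕ∞ω) {ι : Type*} [Fintype ι]
    (e : ι → Π x : M, TangentSpace I x) (W : Set M) : Prop where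
  isOpen : IsOpen W
  contMDiffAt : ∀ i, ∀ x ∈ W, CMDiffAt n (T% (e i)) x
  orthonormal : ∀ x ∈ W, Orthonormal ℝ (fun i => e i x)
  card : Fintype.card ι = Module.finrank ℝ E

variable [IsContMDiffRiemannianBundle I ∞ E (fun x : M => TangentSpace I x)]

theorem contMDiffAt_inner {n : ℕ∞ω} (hn : n ≤ ∞) {X Y : Π x : M, TangentSpace I x} {x : M}
    (hX : CMDiffAt n (T% X) x) (hY : CMDiffAt n (T% Y) x) : CMDiffAt n (fun y => ⟪X y, Y y⟫) x := by
  have : IsContMDiffRiemannianBundle I n E (fun x : M => TangentSpace I x) :=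
    IsContMDiffRiemannianBundle.of_le (n := ∞) hn
  exact ContMDiffAt.inner_bundle (E := fun x : M => TangentSpace I x) hX hY

theorem contMDiffAt_norm {n : ℕ∞ω} (hn : n ≤ ∞) {X : Π x : M, TangentSpace I x} {x : M}
    (hX : CMDiffAt n (T% X) x) (h0 : X x ≠ 0) : CMDiffAt n (fun y => ‖X y‖) x := by
  simp_rw [norm_eq_sqrt_real_inner]
  refine (Real.contDiffAt_sqrt (n := n) ?_).contMDiffAt.comp x (contMDiffAt_inner I hn hX hX)
  simpa using h0

theorem contMDiffAt_gramSchmidtNormed {n : ℕ∞ω} (hn : n ≤ ∞) {d : ℕ}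
    {s : Fin d → Π x : M, TangentSpace I x} {x : M} (hs : ∀ i, CMDiffAt n (T% (s i)) x)
    (hli : LinearIndependent ℝ (fun i => s i x)) (i : Fin d) :
    CMDiffAt n (T% (fun x => InnerProductSpace.gramSchmidtNormed ℝ (fun i => s i x) i)) x := by
  have hg : ∀ i, CMDiffAt n
      (T% (fun x => InnerProductSpace.gramSchmidt ℝ (fun i => s i x) i)) x := by
    intro i
    induction i using WellFoundedLT.induction with
    | ind i ih =>
    simp_rw [InnerProductSpace.gramSchmidt_def ℝ _ i]
    refine ContMDiffAt.sub_section (hs i) (ContMDiffAt.sum_section fun j hj => ?_)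
    simp_rw [Submodule.starProjection_singleton]
    have h2 := ih j (Finset.mem_Iio.1 hj)
    refine ContMDiffAt.smul_section (ContMDiffAt.div₀ (contMDiffAt_inner I hn h2 (hs i)) ?_ ?_) h2
    · simp_rw [RCLike.ofReal_real_eq_id, id, ← real_inner_self_eq_norm_sq]
      exact contMDiffAt_inner I hn h2 h2
    · have := InnerProductSpace.gramSchmidt_ne_zero (𝕜 := ℝ) j hli
      simpa using this
  have h3 := InnerProductSpace.gramSchmidt_ne_zero (𝕜 := ℝ) i hli
  exact ContMDiffAt.smul_section ((contMDiffAt_norm I hn (hg i) h3).inv₀ (norm_ne_zero_iff.2 h3))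
    (hg i)

theorem exists_orthonormalFrame (p : M) : ∃ (W : Set M)
    (e : Fin (Module.finrank ℝ E) → Π x : M, TangentSpace I x), p ∈ W ∧
      IsOrthonormalFrameOn I ∞ e W := by
  let t := trivializationAt E (TangentSpace I) p
  let b := Module.finBasis ℝ E
  have hs : IsLocalFrameOn I E ∞ (t.localFrame b) t.baseSet :=
    t.isLocalFrameOn_localFrame_baseSet I ∞ b
  exact ⟨t.baseSet, fun i x => InnerProductSpace.gramSchmidtNormed ℝ (fun i =>
    t.localFrame b i x) i,
    FiberBundle.mem_baseSet_trivializationAt' p, t.open_baseSet,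
    fun i x hx => contMDiffAt_gramSchmidtNormed I le_rfl
      (fun i => hs.contMDiffAt t.open_baseSet hx i) (hs.linearIndependent hx) i,
    fun x hx => InnerProductSpace.gramSchmidtNormed_orthonormal (hs.linearIndependent hx), by simp⟩

end Calculus

/-! ### The Levi-Civita connection and the Laplacian -/

section Riemannian

variable {E : Type*} [NormedAddCommGroup E] [NormedSpace ℝ E] [FiniteDimensional ℝ E]
  {H : Type*} [TopologicalSpace H] (I : ModelWithCorners ℝ E H) [I.Boundaryless]
  {M : Type*} [TopologicalSpace M] [ChartedSpace H M] [IsManifold I ∞ M]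
  [RiemannianBundle (fun x : M => TangentSpace I x)]
  [IsContMDiffRiemannianBundle I ∞ E (fun x : M => TangentSpace I x)]

namespace IsOrthonormalFrameOn

variable {I} {ι : Type*} [Fintype ι] {e : ι → Π x : M, TangentSpace I x} {W : Set M}
  {k : ℕ∞ω}

/-- The orthonormal basis of `T_x M` given by an orthonormal frame. -/
def basisAt (he : IsOrthonormalFrameOn I k e W) {x : M} (hx : x ∈ W) :
    OrthonormalBasis ι ℝ (TangentSpace I x) :=
  OrthonormalBasis.mk (he.orthonormal x hx)
    ((he.orthonormal x hx).linearIndependent.span_eq_top_of_card_eq_finrank' he.card).ge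

theorem basisAt_apply (he : IsOrthonormalFrameOn I k e W) {x : M} (hx : x ∈ W) (i : ι) :
    he.basisAt hx i = e i x := by simp [basisAt]

theorem sum_inner_smul (he : IsOrthonormalFrameOn I k e W) {x : M} (hx : x ∈ W)
    (v : TangentSpace I x) : ∑ i, ⟪e i x, v⟫ • e i x = v := by
  simpa [basisAt_apply] using (he.basisAt hx).sum_repr' v

theorem sum_inner_mul_inner (he : IsOrthonormalFrameOn I k e W) {x : M} (hx : x ∈ W)
    (v w : TangentSpace I x) : ∑ i, ⟪v, e i x⟫ * ⟪e i x, w⟫ = ⟪v, w⟫ := by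
  simpa [basisAt_apply] using (he.basisAt hx).sum_inner_mul_inner v w

theorem contMDiffAt_of_inner (he : IsOrthonormalFrameOn I k e W) {x : M} (hx : x ∈ W) {n : ℕ∞ω}
    (hn : n ≤ k) {Y : Π x : M, TangentSpace I x} (hY : ∀ i, CMDiffAt n (fun y => ⟪e i y, Y y⟫) x) :
    CMDiffAt n (T% Y) x := by
  have h : CMDiffAt n (T% (fun y => ∑ i, ⟪e i y, Y y⟫ • e i y)) x :=
    ContMDiffAt.sum_section fun i _ =>
      ContMDiffAt.smul_section (hY i) ((he.contMDiffAt i x hx).of_le hn)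
  refine h.congr_of_eventuallyEq ?_
  filter_upwards [he.isOpen.mem_nhds hx] with y hy
  rw [he.sum_inner_smul hy]

end IsOrthonormalFrameOn

theorem eventually_mdifferentiableAt_section {n : ℕ} {X : Π x : M, TangentSpace I x} {x : M}
    (hX : CMDiffAt (n + 1 : ℕ) (T% X) x) : ∀ᶠ y in 𝓝 x, MDiffAt (T% X) y :=
  ((contMDiffAt_iff_contMDiffAt_nhds (by simp)).1 hX).mono fun _ h =>
    h.mdifferentiableAt (by simp)

theorem contMDiffAt_koszul {n : ℕ} {X Y Z : Π x : M, TangentSpace I x} {x : M}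
    (hX : CMDiffAt (n + 1 : ℕ) (T% X) x) (hY : CMDiffAt (n + 1 : ℕ) (T% Y) x)
    (hZ : CMDiffAt (n + 1 : ℕ) (T% Z) x) : CMDiffAt n (koszul I Y X Z) x := by
  have h1 : ((n + 1 : ℕ) : ℕ∞ω) ≤ ∞ := by exact_mod_cast le_top
  have h2 : (n : ℕ∞ω) ≤ (n + 1 : ℕ) := by exact_mod_cast Nat.le_succ n
  have h3 : (n : ℕ∞ω) ≤ ∞ := h2.trans h1
  have h4 : (n : ℕ∞ω) + 1 ≤ (n + 1 : ℕ) := by push_cast; rfl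
  have br : ∀ {X Y : Π x : M, TangentSpace I x}, CMDiffAt (n + 1 : ℕ) (T% X) x →
      CMDiffAt (n + 1 : ℕ) (T% Y) x → CMDiffAt n (T% (VectorField.mlieBracket I X Y)) x := by
    intro X Y hX hY
    have : IsManifold I (((n + 1 : ℕ) : ℕ∞) + 1) M := IsManifold.of_le (n := ∞)
      (by exact_mod_cast le_top)
    have : IsManifold I (minSmoothness ℝ 2) M := by
      rw [minSmoothness_of_isRCLikeNormedField]; infer_instance
    exact ContMDiffAt.mlieBracket_vectorField (m := (n : ℕ∞)) (n := ((n+1 : ℕ) : ℕ∞))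
      (by exact_mod_cast hX)
      (by exact_mod_cast hY) (by simp)
  have dd : ∀ {X Y Z : Π x : M, TangentSpace I x}, CMDiffAt (n + 1 : ℕ) (T% X) x →
      CMDiffAt (n + 1 : ℕ) (T% Y) x → CMDiffAt (n + 1 : ℕ) (T% Z) x →
      CMDiffAt n (fun y => d% (fun y => ⟪Y y, Z y⟫) y (X y)) x := fun hX hY hZ =>
    contMDiffAt_mvfderiv_apply I (contMDiffAt_inner I h1 hY hZ) (hX.of_le h2) h4
  have ii : ∀ {X Y : Π x : M, TangentSpace I x}, CMDiffAt n (T% X) x →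
      CMDiffAt (n + 1 : ℕ) (T% Y) x → CMDiffAt n (fun y => ⟪X y, Y y⟫) x := fun hX hY =>
    contMDiffAt_inner I h3 hX (hY.of_le h2)
  unfold koszul
  have := ((((((dd hX hY hZ).add (dd hY hX hZ)).sub (dd hZ hX hY)).add (ii (br hX hY) hZ)).sub
    (ii (br hX hZ) hY)).sub (ii (br hY hZ) hX)).div_const 2
  exact this

theorem contMDiffAt_leviCivita {n : ℕ} {X Y : Π x : M, TangentSpace I x} {x : M}
    (hX : CMDiffAt (n + 1 : ℕ) (T% X) x) (hY : CMDiffAt (n + 1 : ℕ) (T% Y) x) :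
    CMDiffAt n (T% (fun y => leviCivita I Y y (X y))) x := by
  obtain ⟨W, e, hx, he⟩ := exists_orthonormalFrame I x
  refine he.contMDiffAt_of_inner hx (by exact_mod_cast le_top) fun i => ?_
  have he1 : CMDiffAt (n + 1 : ℕ) (T% (e i)) x :=
    (he.contMDiffAt i x hx).of_le (by exact_mod_cast le_top)
  refine (contMDiffAt_koszul I hX hY he1).congr_of_eventuallyEq ?_
  filter_upwards [eventually_mdifferentiableAt_section I hX,
    eventually_mdifferentiableAt_section I hY,
    eventually_mdifferentiableAt_section I he1] with y h1 h2 h3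
  rw [real_inner_comm, inner_leviCivita I h2 h1 h3]

/-- The Levi-Civita connection is compatible with the metric. -/
theorem mvfderiv_inner {X Y : Π x : M, TangentSpace I x} {x : M}
    (hX : MDiffAt (T% X) x) (hY : MDiffAt (T% Y) x) (v : TangentSpace I x) :
    d% (fun y => ⟪X y, Y y⟫) x v = ⟪leviCivita I X x v, Y x⟫ + ⟪X x, leviCivita I Y x v⟫ := by
  have h := (leviCivita_isMetricCompatible I (M := M)).mvfderiv_inner_eq
    (FiberBundle.extend E v) hX hY
  simpa using h

theorem leviCivita_sub_leviCivita {X Y : Π x : M, TangentSpace I x} {x : M}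
    (hX : MDiffAt (T% X) x) (hY : MDiffAt (T% Y) x) :
    leviCivita I Y x (X x) - leviCivita I X x (Y x) = VectorField.mlieBracket I X Y x :=
  (CovariantDerivative.torsion_eq_zero_iff _).1 (leviCivita_torsion I (M := M)) hX hY

theorem leviCivita_congr {Y Y' : Π x : M, TangentSpace I x} {x : M}
    (hY : MDiffAt (T% Y) x) (h : ∀ᶠ y in 𝓝 x, Y y = Y' y) :
    leviCivita I Y x = leviCivita I Y' x := by
  refine (leviCivita I).isCovariantDerivativeOn.congr_of_eventuallyEq
    (s := univ) hY ?_ Filter.univ_mem h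
  refine hY.congr_of_eventuallyEq ?_
  filter_upwards [h] with y hy
  rw [hy]

theorem inner_grad (f : M → ℝ) (x : M) (v : TangentSpace I x) : ⟪grad I f x, v⟫ = d% f x v :=
  inner_sharp I _ _

theorem contMDiffAt_grad {n m : ℕ∞ω} {f : M → ℝ} {x : M} (hf : CMDiffAt m f x) (hm : n + 1 ≤ m)
    (hn : n ≤ ∞) : CMDiffAt n (T% (grad I f)) x := by
  obtain ⟨W, e, hx, he⟩ := exists_orthonormalFrame I x
  refine he.contMDiffAt_of_inner hx hn fun i => ?_
  simp_rw [real_inner_comm (grad I f _), inner_grad]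
  exact contMDiffAt_mvfderiv_apply I hf ((he.contMDiffAt i x hx).of_le hn) hm

/-- The Hessian of a function is symmetric. -/
theorem inner_leviCivita_grad_comm {f : M → ℝ} {x : M} (hf : CMDiffAt 2 f x)
    (v w : TangentSpace I x) :
    ⟪leviCivita I (grad I f) x v, w⟫ = ⟪leviCivita I (grad I f) x w, v⟫ := by
  obtain ⟨X, hX, rfl⟩ : ∃ Z : Π x : M, TangentSpace I x, MDiffAt (T% Z) x ∧ Z x = v :=
    ⟨_, FiberBundle.mdifferentiableAt_extend (I := I) (F := E) v, by simp⟩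
  obtain ⟨Y, hY, rfl⟩ : ∃ Z : Π x : M, TangentSpace I x, MDiffAt (T% Z) x ∧ Z x = w :=
    ⟨_, FiberBundle.mdifferentiableAt_extend (I := I) (F := E) w, by simp⟩
  have hG : MDiffAt (T% (grad I f)) x :=
    (contMDiffAt_grad I (n := 1) hf (by norm_num) (by exact_mod_cast le_top)).mdifferentiableAt
      (by simp)
  have h1 := mvfderiv_inner I hG hY (X x)
  have h2 := mvfderiv_inner I hG hX (Y x)
  have h3 := mvfderiv_mlieBracket I hf hX hY
  simp_rw [inner_grad] at h1 h2
  rw [← leviCivita_sub_leviCivita I hX hY, map_sub, h1, h2] at h3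
  linarith

theorem laplacian_eq_sum {ι : Type*} [Fintype ι] {x : M} (b : OrthonormalBasis ι ℝ
    (TangentSpace I x))
    (f : M → ℝ) : laplacian I f x = ∑ i, ⟪leviCivita I (grad I f) x (b i), b i⟫ := by
  rw [laplacian, LinearMap.trace_eq_sum_inner _ b]
  exact Finset.sum_congr rfl fun i _ => real_inner_comm _ _

theorem grad_add {f h : M → ℝ} {x : M} (hf : MDiffAt f x) (hh : MDiffAt h x) :
    grad I (fun y => f y + h y) x = grad I f x + grad I h x := by
  refine ext_inner_right ℝ fun v => ?_
  rw [inner_add_left, inner_grad, inner_grad, inner_grad, mvfderiv_fun_add hf hh]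
  rfl

theorem grad_const_mul (c : ℝ) {f : M → ℝ} {x : M} (hf : MDiffAt f x) :
    grad I (fun y => c * f y) x = c • grad I f x := by
  refine ext_inner_right ℝ fun v => ?_
  rw [real_inner_smul_left, inner_grad, inner_grad, mvfderiv_fun_mul mdifferentiableAt_const hf,
    mvfderiv_const]
  simp

theorem grad_mul {f h : M → ℝ} {x : M} (hf : MDiffAt f x) (hh : MDiffAt h x) :
    grad I (fun y => f y * h y) x = f x • grad I h x + h x • grad I f x := by
  refine ext_inner_right ℝ fun v => ?_
  rw [inner_add_left, real_inner_smul_left, real_inner_smul_left, inner_grad, inner_grad,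
    inner_grad, mvfderiv_fun_mul hf hh]
  rfl

theorem mdifferentiableAt_grad {f : M → ℝ} {x : M} (hf : CMDiffAt 2 f x) :
    MDiffAt (T% (grad I f)) x :=
  (contMDiffAt_grad I (n := 1) hf (by norm_num) (by exact_mod_cast le_top)).mdifferentiableAt
    (by simp)

theorem leviCivita_grad_add {f h : M → ℝ} {x : M} (hf : CMDiffAt 2 f x) (hh : CMDiffAt 2 h x) :
    leviCivita I (grad I (fun y => f y + h y)) x =
      leviCivita I (grad I f) x + leviCivita I (grad I h) x := by
  have h1 : ∀ᶠ y in 𝓝 x, grad I (fun y => f y + h y) y = (grad I f + grad I h) y := by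
    filter_upwards [eventually_mdifferentiableAt I hf,
      eventually_mdifferentiableAt I hh] with y h1 h2
    rw [grad_add I h1 h2, Pi.add_apply]
  rw [leviCivita_congr I (mdifferentiableAt_grad I (f := fun y => f y + h y) (hf.add hh)) h1]
  exact (leviCivita I).isCovariantDerivativeOn.add (mdifferentiableAt_grad I hf)
    (mdifferentiableAt_grad I hh)

theorem laplacian_add {f h : M → ℝ} {x : M} (hf : CMDiffAt 2 f x) (hh : CMDiffAt 2 h x) :
    laplacian I (fun y => f y + h y) x = laplacian I f x + laplacian I h x := by
  rw [laplacian, leviCivita_grad_add I hf hh]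
  simp [laplacian]

theorem leviCivita_grad_const_mul (c : ℝ) {f : M → ℝ} {x : M} (hf : CMDiffAt 2 f x) :
    leviCivita I (grad I (fun y => c * f y)) x = c • leviCivita I (grad I f) x := by
  have h1 : ∀ᶠ y in 𝓝 x, grad I (fun y => c * f y) y = (c • grad I f) y := by
    filter_upwards [eventually_mdifferentiableAt I hf] with y h1
    rw [grad_const_mul I c h1, Pi.smul_apply]
  rw [leviCivita_congr I (mdifferentiableAt_grad I (f := fun y => c * f y)
    (contMDiffAt_const.mul hf)) h1,
    (leviCivita I).isCovariantDerivativeOn.smul_const c (mdifferentiableAt_grad I hf)]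

theorem laplacian_const_mul (c : ℝ) {f : M → ℝ} {x : M} (hf : CMDiffAt 2 f x) :
    laplacian I (fun y => c * f y) x = c * laplacian I f x := by
  rw [laplacian, leviCivita_grad_const_mul I c hf]
  simp [laplacian]

theorem laplacian_mul {f h : M → ℝ} {x : M} (hf : CMDiffAt 2 f x) (hh : CMDiffAt 2 h x) :
    laplacian I (fun y => f y * h y) x =
      f x * laplacian I h x + h x * laplacian I f x + 2 * ⟪grad I f x, grad I h x⟫ := by
  have h1 : ∀ᶠ y in 𝓝 x, grad I (fun y => f y * h y) y = (f • grad I h + h • grad I f) y := by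
    filter_upwards [eventually_mdifferentiableAt I hf,
      eventually_mdifferentiableAt I hh] with y h1 h2
    rw [grad_mul I h1 h2]
    rfl
  have df := hf.mdifferentiableAt (by simp)
  have dh := hh.mdifferentiableAt (by simp)
  have gf := mdifferentiableAt_grad I hf
  have gh := mdifferentiableAt_grad I hh
  let b := stdOrthonormalBasis ℝ (TangentSpace I x)
  have h2 : leviCivita I (grad I (fun y => f y * h y)) x =
      f x • leviCivita I (grad I h) x + (d% f x).smulRight (grad I h x) +
      (h x • leviCivita I (grad I f) x + (d% h x).smulRight (grad I f x)) := by
    rw [leviCivita_congr I (mdifferentiableAt_grad I (f := fun y => f y * h y) (hf.mul hh)) h1,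
      (leviCivita I).isCovariantDerivativeOn.add (df.smul_section gh) (dh.smul_section gf),
      (leviCivita I).isCovariantDerivativeOn.leibniz gh df,
      (leviCivita I).isCovariantDerivativeOn.leibniz gf dh]
  rw [laplacian_eq_sum I b, laplacian_eq_sum I b, laplacian_eq_sum I b, h2, Finset.mul_sum,
    Finset.mul_sum]
  rw [← b.sum_inner_mul_inner, Finset.mul_sum, ← Finset.sum_add_distrib, ← Finset.sum_add_distrib]
  refine Finset.sum_congr rfl fun i _ => ?_
  simp only [add_apply, smul_apply, ContinuousLinearMap.smulRight_apply,
    inner_add_left, real_inner_smul_left, ← inner_grad]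
  rw [real_inner_comm (grad I h x) (b i)]
  ring

/-! ### Conformal pairs -/

/-- `(u, v)` is a conformal pair near `x`: the gradients are orthogonal and of equal length. -/
def IsConformalPairAt (u v : M → ℝ) (x : M) : Prop :=
  ∀ᶠ y in 𝓝 x, ⟪grad I u y, grad I u y⟫ = ⟪grad I v y, grad I v y⟫ ∧
    ⟪grad I u y, grad I v y⟫ = 0

theorem mvfderiv_congr {f h : M → ℝ} {x : M} (hf : f =ᶠ[𝓝 x] h) : d% f x = d% h x := by
  rw [mvfderiv, mvfderiv, hf.mfderiv_eq, hf.self_of_nhds]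

namespace IsConformalPairAt

variable {I} {u v : M → ℝ} {x : M}

/-- The identity `|grad u| ^ 2 = |grad v| ^ 2`, differentiated. -/
theorem hessian_left (h : IsConformalPairAt I u v x) (hu : CMDiffAt 2 u x) (hv : CMDiffAt 2 v x)
    (w : TangentSpace I x) : ⟪leviCivita I (grad I u) x w, grad I u x⟫ =
      ⟪leviCivita I (grad I v) x w, grad I v x⟫ := by
  have gu := mdifferentiableAt_grad I hu
  have gv := mdifferentiableAt_grad I hv
  have h1 := mvfderiv_inner I gu gu w
  have h2 := mvfderiv_inner I gv gv w
  rw [mvfderiv_congr I (h.mono fun y hy => hy.1), h2, real_inner_comm (grad I u x)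
    (leviCivita I _ x w),
    real_inner_comm (grad I v x) (leviCivita I _ x w)] at h1
  rw [real_inner_comm (grad I u x), real_inner_comm (grad I v x)]
  linarith

/-- The identity `⟪grad u, grad v⟫ = 0`, differentiated. -/
theorem hessian_right (h : IsConformalPairAt I u v x) (hu : CMDiffAt 2 u x) (hv : CMDiffAt 2 v x)
    (w : TangentSpace I x) : ⟪leviCivita I (grad I u) x w, grad I v x⟫ =
      -⟪leviCivita I (grad I v) x w, grad I u x⟫ := by
  have h1 := mvfderiv_inner I (mdifferentiableAt_grad I hu) (mdifferentiableAt_grad I hv) w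
  have h2 : (fun y => ⟪grad I u y, grad I v y⟫) =ᶠ[𝓝 x] fun _ => (0 : ℝ) := h.mono fun y hy => hy.2
  rw [mvfderiv_congr I h2, mvfderiv_const] at h1
  rw [real_inner_comm (grad I u x)]
  simp only [zero_apply] at h1
  linarith

/-- The Hessian of the first function of a conformal pair is trace-free on the span of the two
gradients. -/
theorem hessian_trace (h : IsConformalPairAt I u v x) (hu : CMDiffAt 2 u x) (hv : CMDiffAt 2 v x) :
    ⟪leviCivita I (grad I u) x (grad I u x), grad I u x⟫ +
      ⟪leviCivita I (grad I u) x (grad I v x), grad I v x⟫ = 0 := by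
  rw [h.hessian_left hu hv, h.hessian_right hu hv, inner_leviCivita_grad_comm I hv]
  ring

theorem symm (h : IsConformalPairAt I u v x) : IsConformalPairAt I v u x :=
  h.mono fun y hy => ⟨hy.1.symm, by rw [real_inner_comm]; exact hy.2⟩

/-- In dimension two the gradients of a conformal pair span the tangent space, so the functions are
harmonic. -/
theorem laplacian_eq_zero (h : IsConformalPairAt I u v x) (hu : CMDiffAt 2 u x)
    (hv : CMDiffAt 2 v x) (h0 : grad I u x ≠ 0) (hE : Module.finrank ℝ E = 2) :
    laplacian I u x = 0 := by
  have hp : 0 < ‖grad I u x‖ := norm_pos_iff.2 h0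
  have hq : ‖grad I v x‖ = ‖grad I u x‖ := by
    have := h.self_of_nhds.1
    rw [real_inner_self_eq_norm_sq, real_inner_self_eq_norm_sq] at this
    exact ((pow_left_inj₀ (norm_nonneg _) (norm_nonneg _) two_ne_zero).1 this).symm
  have hor : Orthonormal ℝ ![‖grad I u x‖⁻¹ • grad I u x, ‖grad I u x‖⁻¹ • grad I v x] := by
    rw [orthonormal_vecCons_iff]
    refine ⟨?_, ?_, ?_⟩
    · rw [norm_smul, norm_inv, norm_norm, inv_mul_cancel₀ hp.ne']
    · intro i
      simp [real_inner_smul_left, real_inner_smul_right, h.self_of_nhds.2]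
    · rw [orthonormal_vecCons_iff]
      simp [norm_smul, hq, hp.ne']
  let b : OrthonormalBasis (Fin 2) ℝ (TangentSpace I x) :=
    OrthonormalBasis.mk hor (hor.linearIndependent.span_eq_top_of_card_eq_finrank'
      (by rw [Fintype.card_fin]; exact hE.symm)).ge
  rw [laplacian_eq_sum I b]
  have := h.hessian_trace hu hv
  simp only [b, OrthonormalBasis.coe_mk, Fin.sum_univ_two, Matrix.cons_val_zero,
    Matrix.cons_val_one, map_smul, real_inner_smul_left, real_inner_smul_right]
  linear_combination (‖grad I u x‖⁻¹)^2 * this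

end IsConformalPairAt

/-! ### Curvature and the Bochner formula -/

/-- The curvature operator `R(X₁, X₂) Y = ∇_{X₁} ∇_{X₂} Y - ∇_{X₂} ∇_{X₁} Y - ∇_{[X₁, X₂]} Y`
on vector fields. -/
def curvature (X₁ X₂ Y : Π x : M, TangentSpace I x) (x : M) : TangentSpace I x :=
  leviCivita I (fun y => leviCivita I Y y (X₂ y)) x (X₁ x)
    - leviCivita I (fun y => leviCivita I Y y (X₁ y)) x (X₂ x)
    - leviCivita I Y x (VectorField.mlieBracket I X₁ X₂ x)

/-- The curvature operator is skew; this follows from differentiating `⟪Y, Z⟫` along `[X₁, X₂]`. -/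
theorem inner_curvature {X₁ X₂ Y Z : Π x : M, TangentSpace I x} {x : M}
    (h1 : CMDiffAt 2 (T% X₁) x) (h2 : CMDiffAt 2 (T% X₂) x) (hY : CMDiffAt 2 (T% Y) x)
    (hZ : CMDiffAt 2 (T% Z) x) :
    ⟪curvature I X₁ X₂ Y x, Z x⟫ = -⟪Y x, curvature I X₁ X₂ Z x⟫ := by
  have key : ∀ {X₁ X₂ Y Z : Π x : M, TangentSpace I x}, CMDiffAt 2 (T% X₂) x →
      CMDiffAt 2 (T% Y) x → CMDiffAt 2 (T% Z) x →
      d% (fun y => d% (fun y => ⟪Y y, Z y⟫) y (X₂ y)) x (X₁ x) =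
        ⟪leviCivita I (fun y => leviCivita I Y y (X₂ y)) x (X₁ x), Z x⟫ +
        ⟪leviCivita I Y x (X₂ x), leviCivita I Z x (X₁ x)⟫ +
        (⟪leviCivita I Y x (X₁ x), leviCivita I Z x (X₂ x)⟫ +
        ⟪Y x, leviCivita I (fun y => leviCivita I Z y (X₂ y)) x (X₁ x)⟫) := by
    intro X₁ X₂ Y Z h2 hY hZ
    have e : (fun y => d% (fun y => ⟪Y y, Z y⟫) y (X₂ y)) =ᶠ[𝓝 x]
        fun y => ⟪leviCivita I Y y (X₂ y), Z y⟫ + ⟪Y y, leviCivita I Z y (X₂ y)⟫ := by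
      filter_upwards [eventually_mdifferentiableAt_section I (n := 1) hY,
        eventually_mdifferentiableAt_section I (n := 1) hZ] with y h1 h2
      exact mvfderiv_inner I h1 h2 _
    have dY : MDiffAt (T% Y) x := hY.mdifferentiableAt (by simp)
    have dZ : MDiffAt (T% Z) x := hZ.mdifferentiableAt (by simp)
    have cY : MDiffAt (T% (fun y => leviCivita I Y y (X₂ y))) x :=
      (contMDiffAt_leviCivita I (n := 1) h2 hY).mdifferentiableAt (by simp)
    have cZ : MDiffAt (T% (fun y => leviCivita I Z y (X₂ y))) x :=
      (contMDiffAt_leviCivita I (n := 1) h2 hZ).mdifferentiableAt (by simp)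
    rw [mvfderiv_congr I e, mvfderiv_fun_add (mdiffAt_inner I cY dZ) (mdiffAt_inner I dY cZ),
      add_apply, mvfderiv_inner I cY dZ, mvfderiv_inner I dY cZ]
  have hi : CMDiffAt 2 (fun y => ⟪Y y, Z y⟫) x :=
    contMDiffAt_inner I two_le_infty hY hZ
  have hb := mvfderiv_mlieBracket I hi (h1.mdifferentiableAt (by simp)) (h2.mdifferentiableAt
    (by simp))
  rw [key (X₁ := X₁) h2 hY hZ, key (X₁ := X₂) h1 hY hZ,
    mvfderiv_inner I (hY.mdifferentiableAt (by simp)) (hZ.mdifferentiableAt (by simp))] at hb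
  simp only [curvature, inner_sub_left, inner_sub_right]
  linarith

theorem contMDiffAt_curvature {X₁ X₂ Y : Π x : M, TangentSpace I x} {x : M}
    (h1 : CMDiffAt 2 (T% X₁) x) (h2 : CMDiffAt 2 (T% X₂) x) (hY : CMDiffAt 2 (T% Y) x) :
    CMDiffAt 0 (T% (curvature I X₁ X₂ Y)) x := by
  have br : CMDiffAt 1 (T% (VectorField.mlieBracket I X₁ X₂)) x := by
    have e1 := contMDiffAt_leviCivita I (n := 1) h1 hY
    have e2 := contMDiffAt_leviCivita I (n := 1) h1 h2
    have e3 := contMDiffAt_leviCivita I (n := 1) h2 h1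
    refine (ContMDiffAt.sub_section e2 e3).congr_of_eventuallyEq ?_
    filter_upwards [eventually_mdifferentiableAt_section I (n := 1) h1,
        eventually_mdifferentiableAt_section I (n := 1) h2] with y h1 h2
    rw [← leviCivita_sub_leviCivita I h1 h2]
    rfl
  have l : ∀ {X : Π x : M, TangentSpace I x}, CMDiffAt 2 (T% X) x → CMDiffAt 1 (T% X) x :=
    fun h => h.of_le (by norm_num)
  have e1 := contMDiffAt_leviCivita I (n := 0) (l h1) (contMDiffAt_leviCivita I (n := 1) h2 hY)
  have e2 := contMDiffAt_leviCivita I (n := 0) (l h2) (contMDiffAt_leviCivita I (n := 1) h1 hY)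
  have e3 := contMDiffAt_leviCivita I (n := 0) br (l hY)
  exact ContMDiffAt.sub_section (ContMDiffAt.sub_section e1 e2) e3

theorem mvfderiv_fun_sum {ι : Type*} (s : Finset ι) {h : ι → M → ℝ} {x : M}
    (hh : ∀ i ∈ s, MDiffAt (h i) x) :
    MDiffAt (fun y => ∑ i ∈ s, h i y) x ∧
      d% (fun y => ∑ i ∈ s, h i y) x = ∑ i ∈ s, d% (h i) x := by
  classical
  induction s using Finset.induction_on with
  | empty => simpa using ⟨mdifferentiableAt_const, mvfderiv_const (0 : ℝ)⟩
  | insert a s ha ih =>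
    obtain ⟨h1, h2⟩ := ih fun i hi => hh i (Finset.mem_insert_of_mem hi)
    have h3 := hh a (Finset.mem_insert_self a s)
    simp only [Finset.sum_insert ha]
    exact ⟨h3.add h1, by rw [mvfderiv_fun_add h3 h1, h2]⟩

/-- The Laplacian `∑ i, e_i (e_i h) - (∇_{e_i} e_i) h` of `h`, written in the orthonormal
frame `e`. -/
def frameLaplacian {ι : Type*} [Fintype ι] (e : ι → Π x : M, TangentSpace I x) (h : M → ℝ)
    (x : M) : ℝ :=
  ∑ i, (d% (fun y => d% h y (e i y)) x (e i x) - d% h x (leviCivita I (e i) x (e i x)))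

theorem frameLaplacian_congr {ι : Type*} [Fintype ι] (e : ι → Π x : M, TangentSpace I x)
    {h k : M → ℝ} {x : M} (hk : h =ᶠ[𝓝 x] k) :
    frameLaplacian I e h x = frameLaplacian I e k x := by
  refine Finset.sum_congr rfl fun i _ => ?_
  have : (fun y => d% h y (e i y)) =ᶠ[𝓝 x] fun y => d% k y (e i y) := by
    filter_upwards [hk.eventuallyEq_nhds] with y hy
    rw [mvfderiv_congr I hy]
  rw [mvfderiv_congr I hk, mvfderiv_congr I this]

variable {I} in
/-- The connection form of an orthonormal frame is skew. -/
theorem frame_rotation_antisymm {ι : Type*} [Fintype ι] {e : ι → Π x : M, TangentSpace I x}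
    {W : Set M}
    (he : IsOrthonormalFrameOn I ∞ e W) {x : M} (hx : x ∈ W) (v : TangentSpace I x) (i k : ι) :
    ⟪leviCivita I (e i) x v, e k x⟫ = -⟪leviCivita I (e k) x v, e i x⟫ := by
  classical
  have d : ∀ i, MDiffAt (T% (e i)) x := fun i => (he.contMDiffAt i x hx).mdifferentiableAt (by simp)
  have h1 := mvfderiv_inner I (d i) (d k) v
  have h2 : (fun y => ⟪e i y, e k y⟫) =ᶠ[𝓝 x] fun _ => if i = k then (1 : ℝ) else 0 := by
    filter_upwards [he.isOpen.mem_nhds hx] with y hy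
    exact orthonormal_iff_ite.1 (he.orthonormal y hy) i k
  rw [mvfderiv_congr I h2, mvfderiv_const, zero_apply] at h1
  rw [real_inner_comm (e i x)]
  linarith

/-- The Bochner formula for a harmonic function. The curvature operator is moved from `grad f` to
the frame, so that no tensoriality of the curvature in `grad f` is needed and the curvature term is
visibly quadratic in `grad f` with continuous coefficients. -/
theorem frameLaplacian_inner_grad {ι : Type*} [Fintype ι] {e : ι → Π x : M, TangentSpace I x}
    {W : Set M} (he : IsOrthonormalFrameOn I ∞ e W) {x : M} (hx : x ∈ W) {f : M → ℝ}
    (hf : CMDiffAt 3 f x) (hΔ : ∀ᶠ y in 𝓝 x, laplacian I f y = 0) :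
    frameLaplacian I e (fun y => ⟪grad I f y, grad I f y⟫) x =
      2 * ∑ i, ⟪leviCivita I (grad I f) x (e i x), leviCivita I (grad I f) x (e i x)⟫
      - 2 * ∑ i, ∑ j, ⟪grad I f x, e j x⟫ * ⟪grad I f x, curvature I (e i) (e j) (e i) x⟫ := by
  set G := grad I f with hGdef
  have hG : CMDiffAt 2 (T% G) x := contMDiffAt_grad I hf (by norm_num) two_le_infty
  have dG : MDiffAt (T% G) x := hG.mdifferentiableAt (by simp)
  have c2 : ∀ i, CMDiffAt 2 (T% (e i)) x := fun i => (he.contMDiffAt i x hx).of_le two_le_infty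
  have d : ∀ i, MDiffAt (T% (e i)) x := fun i => (c2 i).mdifferentiableAt (by simp)
  have dd : ∀ i, MDiffAt (T% (fun y => leviCivita I G y (e i y))) x := fun i =>
    (contMDiffAt_leviCivita I (n := 1) (c2 i) hG).mdifferentiableAt (by simp)
  have evG := eventually_mdifferentiableAt_section I (n := 1) hG
  have evf : ∀ᶠ y in 𝓝 x, CMDiffAt 2 f y :=
    (contMDiffAt_iff_contMDiffAt_nhds (by simp)).1 (hf.of_le (by norm_num))
  have hH : ∀ᶠ y in 𝓝 x, ∀ v w : TangentSpace I y,
      ⟪leviCivita I G y v, w⟫ = ⟪leviCivita I G y w, v⟫ :=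
    evf.mono fun y hy v w => inner_leviCivita_grad_comm I hy v w
  have hHx := hH.self_of_nhds
  -- the second covariant derivatives of `G` in the frame
  let D : ι → ι → TangentSpace I x := fun i j =>
    leviCivita I (fun y => leviCivita I G y (e j y)) x (e i x)
  let N : ι → ι → TangentSpace I x := fun i j => leviCivita I (e j) x (e i x)
  let A : TangentSpace I x →L[ℝ] TangentSpace I x := leviCivita I G x
  have hA : ∀ v w, ⟪A v, w⟫ = ⟪A w, v⟫ := hHx
  have h1 : ∀ i, d% (fun y => d% (fun y => ⟪G y, G y⟫) y (e i y)) x (e i x) =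
      2 * (⟪D i i, G x⟫ + ⟪A (e i x), A (e i x)⟫) := by
    intro i
    have e1 : (fun y => d% (fun y => ⟪G y, G y⟫) y (e i y)) =ᶠ[𝓝 x]
        fun y => ⟪leviCivita I G y (e i y), G y⟫ + ⟪leviCivita I G y (e i y), G y⟫ := by
      filter_upwards [evG] with y hy
      rw [mvfderiv_inner I hy hy, real_inner_comm (G y)]
    rw [mvfderiv_congr I e1, mvfderiv_fun_add (mdiffAt_inner I (dd i) dG)
      (mdiffAt_inner I (dd i) dG), add_apply, mvfderiv_inner I (dd i) dG]
    simp only [D, A]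
    ring
  have h2 : ∀ i, d% (fun y => ⟪G y, G y⟫) x (N i i) = 2 * ⟪A (N i i), G x⟫ := by
    intro i
    rw [mvfderiv_inner I dG dG, real_inner_comm (G x)]
    exact (two_mul _).symm
  -- symmetry of the Hessian, differentiated
  have h3 : ∀ i j k, ⟪D k i, e j x⟫ + ⟪A (e i x), N k j⟫ = ⟪D k j, e i x⟫ + ⟪A (e j x), N k i⟫ := by
    intro i j k
    have e1 : (fun y => ⟪leviCivita I G y (e i y), e j y⟫) =ᶠ[𝓝 x]
        fun y => ⟪leviCivita I G y (e j y), e i y⟫ := hH.mono fun y hy => hy _ _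
    have := congrArg (fun L => L (e k x)) (mvfderiv_congr I e1)
    simp only [mvfderiv_inner I (dd i) (d j), mvfderiv_inner I (dd j) (d i)] at this
    exact this
  -- harmonicity, differentiated
  have h4 : ∀ j, ∑ i, (⟪D j i, e i x⟫ + ⟪A (e i x), N j i⟫) = 0 := by
    intro j
    have e1 : (fun y => ∑ i, ⟪leviCivita I G y (e i y), e i y⟫) =ᶠ[𝓝 x] fun _ => (0 : ℝ) := by
      filter_upwards [hΔ, he.isOpen.mem_nhds hx] with y hy hyW
      rw [← hy, laplacian_eq_sum I (he.basisAt hyW)]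
      simp only [he.basisAt_apply, hGdef]
    have e2 := congrArg (fun L => L (e j x)) (mvfderiv_congr I e1)
    have e3 : d% (fun y => ∑ i, ⟪leviCivita I G y (e i y), e i y⟫) x =
        ∑ i, d% (fun y => ⟪leviCivita I G y (e i y), e i y⟫) x :=
      (mvfderiv_fun_sum I _ fun i _ => mdiffAt_inner I (dd i) (d i)).2
    simp only [e3, mvfderiv_const, zero_apply, sum_apply, mvfderiv_inner I (dd _) (d _)] at e2
    exact e2
  -- a symmetric form paired with a skew one
  have h5 : ∀ j, ∑ i, ⟪A (e i x), N j i⟫ = 0 := by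
    intro j
    have e1 : ∀ i, ⟪A (e i x), N j i⟫ = ∑ k, ⟪A (e i x), e k x⟫ * ⟪e k x, N j i⟫ := fun i =>
      (he.sum_inner_mul_inner hx _ _).symm
    simp only [e1]
    have e2 : ∑ i, ∑ k, ⟪A (e i x), e k x⟫ * ⟪e k x, N j i⟫ = -∑ i, ∑ k, ⟪A (e i x),
      e k x⟫ * ⟪e k x, N j i⟫ := by
      conv_rhs => rw [Finset.sum_comm]
      rw [← Finset.sum_neg_distrib]
      refine Finset.sum_congr rfl fun i _ => ?_
      rw [← Finset.sum_neg_distrib]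
      refine Finset.sum_congr rfl fun k _ => ?_
      have := frame_rotation_antisymm he hx (e j x) i k
      rw [hA, real_inner_comm (N j i), real_inner_comm (N j k)]
      simp only [N, this]
      ring
    linarith
  -- commutation of the second covariant derivatives
  have h6 : ∀ i j, D i j = curvature I (e i) (e j) G x + D j i + A (N i j) - A (N j i) := by
    intro i j
    simp only [curvature, D, N, A]
    rw [← leviCivita_sub_leviCivita I (d i) (d j), map_sub]
    abel
  -- the rough Laplacian of `G` is a curvature term
  have h7 : ∀ j, ∑ i, (⟪D i i, e j x⟫ - ⟪A (N i i), e j x⟫) =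
      ∑ i, ⟪curvature I (e i) (e j) G x, e i x⟫ := by
    intro j
    have e1 : ∀ i, ⟪D i i, e j x⟫ - ⟪A (N i i), e j x⟫ = ⟪curvature I (e i) (e j) G x, e i x⟫ +
        (⟪D j i, e i x⟫ + ⟪A (e i x), N j i⟫) - 2 * ⟪A (e i x), N j i⟫ := by
      intro i
      have := h3 i j i
      rw [h6 i j, inner_sub_left, inner_add_left, inner_add_left, hA (N i j), hA (N j i), hA
        (e j x)] at this
      linarith
    rw [Finset.sum_congr rfl fun i _ => e1 i, Finset.sum_sub_distrib, Finset.sum_add_distrib,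
      h4, ← Finset.mul_sum, h5]
    ring
  have h8 : ∀ i j, ⟪curvature I (e i) (e j) G x, e i x⟫ = -⟪G x, curvature I (e i) (e j) (e i) x⟫ :=
    fun i j => inner_curvature I (c2 i) (c2 j) hG (c2 i)
  have h9 : ∑ i, (⟪D i i, G x⟫ - ⟪A (N i i), G x⟫) =
      ∑ j, ⟪G x, e j x⟫ * ∑ i, (⟪D i i, e j x⟫ - ⟪A (N i i), e j x⟫) := by
    simp only [Finset.mul_sum]
    rw [Finset.sum_comm]
    refine Finset.sum_congr rfl fun i _ => ?_
    rw [← inner_sub_left, ← he.sum_inner_mul_inner hx]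
    refine Finset.sum_congr rfl fun j _ => ?_
    rw [← inner_sub_left, mul_comm, real_inner_comm (e j x) (G x)]
  have h10 : frameLaplacian I e (fun y => ⟪G y, G y⟫) x = 2 * ∑ i, (⟪D i i, G x⟫ - ⟪A (N i i), G x⟫)
      + 2 * ∑ i, ⟪A (e i x), A (e i x)⟫ := by
    rw [frameLaplacian, Finset.mul_sum, Finset.mul_sum, ← Finset.sum_add_distrib]
    refine Finset.sum_congr rfl fun i _ => ?_
    have := h2 i
    simp only [N] at this
    rw [h1, this]
    simp only [N]
    ring
  rw [h10, h9]
  have h11 : ∑ i, ∑ j, ⟪G x, e j x⟫ * ⟪G x, curvature I (e i) (e j) (e i) x⟫ =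
      - ∑ j, ⟪G x, e j x⟫ * ∑ i, (⟪D i i, e j x⟫ - ⟪A (N i i), e j x⟫) := by
    rw [Finset.sum_comm, ← Finset.sum_neg_distrib]
    refine Finset.sum_congr rfl fun j _ => ?_
    rw [h7, ← Finset.mul_sum, ← mul_neg, ← Finset.sum_neg_distrib]
    congr 1
    refine Finset.sum_congr rfl fun i _ => ?_
    rw [h8, neg_neg]
  rw [h11]
  simp only [A]
  ring

/-- Near each point the curvature term in the Bochner formula for harmonic functions is bounded by
a constant times `‖grad f‖ ^ 2`. -/
theorem exists_bochner_bound (p : M) : ∃ (W : Set M)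
    (e : Fin (Module.finrank ℝ E) → Π x : M, TangentSpace I x) (C : ℝ), p ∈ W ∧
      IsOrthonormalFrameOn I ∞ e W ∧ 0 ≤ C ∧ ∀ x ∈ W, ∀ f : M → ℝ, CMDiffAt 3 f x →
        (∀ᶠ y in 𝓝 x, laplacian I f y = 0) →
        |frameLaplacian I e (fun y => ⟪grad I f y, grad I f y⟫) x / 2 -
          ∑ i, ⟪leviCivita I (grad I f) x (e i x), leviCivita I (grad I f) x (e i x)⟫| ≤
          C * ‖grad I f x‖ ^ 2 := by
  obtain ⟨W, e, hp, he⟩ := exists_orthonormalFrame I p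
  have c2 : ∀ i, CMDiffAt 2 (T% (e i)) p := fun i => (he.contMDiffAt i p hp).of_le two_le_infty
  have hR : ∀ i j, ContinuousAt (fun y => ‖curvature I (e i) (e j) (e i) y‖) p := by
    intro i j
    have h := contMDiffAt_curvature I (c2 i) (c2 j) (c2 i)
    have h2 := (contMDiffAt_inner I (by simp) h h).continuousAt
    refine (Real.continuous_sqrt.continuousAt.comp h2).congr (Filter.Eventually.of_forall fun y =>
      ?_)
    exact (norm_eq_sqrt_real_inner _).symm
  have hev : ∀ᶠ y in 𝓝 p, ∀ i j, ‖curvature I (e i) (e j) (e i) y‖ <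
      ‖curvature I (e i) (e j) (e i) p‖ + 1 :=
    Filter.eventually_all.2 fun i => Filter.eventually_all.2 fun j =>
      (hR i j).eventually (gt_mem_nhds (lt_add_one _))
  obtain ⟨W', hW', hW'o, hpW'⟩ := eventually_nhds_iff.1 hev
  refine ⟨W ∩ W', e, ∑ i, ∑ j, (‖curvature I (e i) (e j) (e i) p‖ + 1), ⟨hp, hpW'⟩,
    ⟨he.isOpen.inter hW'o, fun i x hx => he.contMDiffAt i x hx.1,
      fun x hx => he.orthonormal x hx.1, he.card⟩, by positivity, fun x hx f hf hΔ => ?_⟩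
  rw [frameLaplacian_inner_grad I he hx.1 hf hΔ]
  have h1 : ∀ a b : ℝ, |(2 * a - 2 * b) / 2 - a| = |b| := fun a b => by
    rw [← abs_neg b]; congr 1; ring
  rw [h1, Finset.sum_mul]
  refine (Finset.abs_sum_le_sum_abs _ _).trans (Finset.sum_le_sum fun i _ => ?_)
  rw [Finset.sum_mul]
  refine (Finset.abs_sum_le_sum_abs _ _).trans (Finset.sum_le_sum fun j _ => ?_)
  have h2 : |⟪grad I f x, e j x⟫| ≤ ‖grad I f x‖ := by
    simpa [(he.orthonormal x hx.1).1 j] using abs_real_inner_le_norm (grad I f x) (e j x)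
  have h3 := abs_real_inner_le_norm (grad I f x) (curvature I (e i) (e j) (e i) x)
  have h4 := (hW' x hx.2 i j).le
  rw [abs_mul]
  calc _ ≤ ‖grad I f x‖ * (‖grad I f x‖ * (‖curvature I (e i) (e j) (e i) p‖ + 1)) := by
        gcongr
        exact h3.trans (by gcongr)
    _ = _ := by ring

end Riemannian

/-! ### Complex structures on Euclidean spaces of dimension four -/

section LinearAlgebra

variable {V : Type*} [NormedAddCommGroup V] [InnerProductSpace ℝ V]

theorem sum_inner_apply_eq_trace [FiniteDimensional ℝ V] {ι : Type*} [Fintype ι]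
    (b : OrthonormalBasis ι ℝ V) (A B : V →L[ℝ] V) : ∑ i, ⟪A (b i), B (b i)⟫ =
      LinearMap.trace ℝ V (LinearMap.adjoint A.toLinearMap ∘ₗ B.toLinearMap) := by
  rw [LinearMap.trace_eq_sum_inner _ b]
  refine Finset.sum_congr rfl fun i _ => ?_
  rw [LinearMap.comp_apply, LinearMap.adjoint_inner_right]
  rfl

/-- The Hilbert-Schmidt inner product does not depend on the orthonormal basis. -/
theorem sum_inner_apply_eq [FiniteDimensional ℝ V] {ι κ : Type*} [Fintype ι] [Fintype κ]
    (b : OrthonormalBasis ι ℝ V) (c : OrthonormalBasis κ ℝ V) (A B : V →L[ℝ] V) :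
    ∑ i, ⟪A (b i), B (b i)⟫ = ∑ i, ⟪A (c i), B (c i)⟫ := by
  rw [sum_inner_apply_eq_trace, sum_inner_apply_eq_trace]

theorem hsNorm_sq [FiniteDimensional ℝ V] {ι : Type*} [Fintype ι] (b : OrthonormalBasis ι ℝ V)
    (L : V →L[ℝ] V) : hsNorm L ^ 2 = ∑ i, ‖L (b i)‖ ^ 2 := by
  rw [hsNorm, Real.sq_sqrt (by positivity)]
  simp_rw [← real_inner_self_eq_norm_sq]
  exact sum_inner_apply_eq _ b L L

theorem orientation_neg_of_flip {d : ℕ} (b b' : OrthonormalBasis (Fin d) ℝ V) (k : Fin d)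
    (h : ∀ i ≠ k, b' i = b i) (hk : b' k = -b k) :
    b'.toBasis.orientation = -b.toBasis.orientation := by
  rw [← Module.Basis.orientation_neg_single b.toBasis k]
  congr 1
  ext i
  by_cases hi : i = k
  · subst hi
    simp [Module.Basis.unitsSMul_apply, hk]
  · simp [Module.Basis.unitsSMul_apply, h i hi, hi]

/-- The orthonormal basis obtained from `b` by changing the sign of `b k`. -/
def flipBasis {d : ℕ} (b : OrthonormalBasis (Fin d) ℝ V) (k : Fin d) : OrthonormalBasis
    (Fin d) ℝ V :=
  (b.toBasis.unitsSMul (Function.update 1 k (-1))).toOrthonormalBasis (by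
    rw [orthonormal_iff_ite]
    intro i j
    have hb := orthonormal_iff_ite.1 b.orthonormal i j
    by_cases hi : i = k <;> by_cases hj : j = k
    · simp_all [Module.Basis.unitsSMul_apply, Units.smul_def]
    · have : k ≠ j := fun h => hj h.symm
      simp_all [Module.Basis.unitsSMul_apply, Units.smul_def]
    · simp_all [Module.Basis.unitsSMul_apply, Units.smul_def]
    · simp_all [Module.Basis.unitsSMul_apply])

theorem flipBasis_self {d : ℕ} (b : OrthonormalBasis (Fin d) ℝ V) (k : Fin d) :
    flipBasis b k k = -b k := by simp [flipBasis, Module.Basis.unitsSMul_apply]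

theorem flipBasis_of_ne {d : ℕ} (b : OrthonormalBasis (Fin d) ℝ V) {k i : Fin d} (h : i ≠ k) :
    flipBasis b k i = b i := by simp [flipBasis, Module.Basis.unitsSMul_apply, h]

theorem orientation_flipBasis {d : ℕ} (b : OrthonormalBasis (Fin d) ℝ V) (k : Fin d) :
    (flipBasis b k).toBasis.orientation = -b.toBasis.orientation :=
  orientation_neg_of_flip _ _ k (fun _ h => flipBasis_of_ne b h) (flipBasis_self b k)

/-- The complex structure rotating `u 0` to `u 1` and `u 2` to `u 3`. -/
def frameJ (u : Fin 4 → V) : V →L[ℝ] V :=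
  (innerSL ℝ (u 0)).smulRight (u 1) - (innerSL ℝ (u 1)).smulRight (u 0) +
    ((innerSL ℝ (u 2)).smulRight (u 3) - (innerSL ℝ (u 3)).smulRight (u 2))

theorem frameJ_apply (u : Fin 4 → V) (v : V) : frameJ u v =
    ⟪u 0, v⟫ • u 1 - ⟪u 1, v⟫ • u 0 + (⟪u 2, v⟫ • u 3 - ⟪u 3, v⟫ • u 2) := rfl

variable (b : OrthonormalBasis (Fin 4) ℝ V)

theorem inner_basis (i j : Fin 4) : ⟪b i, b j⟫ = if i = j then (1 : ℝ) else 0 :=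
  orthonormal_iff_ite.1 b.orthonormal i j

theorem frameJ_zero : frameJ b (b 0) = b 1 := by simp [frameJ_apply]
theorem frameJ_one : frameJ b (b 1) = -b 0 := by simp [frameJ_apply]
theorem frameJ_two : frameJ b (b 2) = b 3 := by simp [frameJ_apply]
theorem frameJ_three : frameJ b (b 3) = -b 2 := by simp [frameJ_apply]

theorem inner_frameJ_zero (v : V) : ⟪b 0, frameJ b v⟫ = -⟪b 1, v⟫ := by
  simp [frameJ_apply, inner_add_right, inner_sub_right, inner_smul_right]
theorem inner_frameJ_one (v : V) : ⟪b 1, frameJ b v⟫ = ⟪b 0, v⟫ := by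
  simp [frameJ_apply, inner_add_right, inner_sub_right, inner_smul_right]
theorem inner_frameJ_two (v : V) : ⟪b 2, frameJ b v⟫ = -⟪b 3, v⟫ := by
  simp [frameJ_apply, inner_add_right, inner_sub_right, inner_smul_right]
theorem inner_frameJ_three (v : V) : ⟪b 3, frameJ b v⟫ = ⟪b 2, v⟫ := by
  simp [frameJ_apply, inner_add_right, inner_sub_right, inner_smul_right]

theorem ext_inner_basis {v w : V} (h : ∀ i, ⟪b i, v⟫ = ⟪b i, w⟫) : v = w := by
  rw [← b.sum_repr' v, ← b.sum_repr' w]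
  simp [h]

theorem frameJ_sq (v : V) : frameJ b (frameJ b v) = -v := by
  refine ext_inner_basis b fun i => ?_
  fin_cases i <;> simp [inner_frameJ_zero, inner_frameJ_one, inner_frameJ_two, inner_frameJ_three]

theorem frameJ_isometry (v w : V) : ⟪frameJ b v, frameJ b w⟫ = ⟪v, w⟫ := by
  rw [← b.sum_inner_mul_inner, ← b.sum_inner_mul_inner v w]
  simp only [Fin.sum_univ_four, real_inner_comm (b _) (frameJ b v), inner_frameJ_zero,
    inner_frameJ_one, inner_frameJ_two, inner_frameJ_three]
  simp only [real_inner_comm v]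
  ring

/-- The real determinant of a complex linear map of `ℂ²` is the square of the modulus of its complex
determinant; so all the bases `(x, Jx, y, Jy)` define the same orientation. -/
theorem inducesOrientation_frameJ : InducesOrientation b.toBasis.orientation (frameJ b) := by
  intro c h1 h3
  refine Eq.symm ((b.toBasis.orientation_eq_iff_det_pos c).2 ?_)
  have hne : b.toBasis.det c ≠ 0 := (b.toBasis.isUnit_det c).ne_zero
  have e : ∀ i j, b.toBasis.toMatrix c i j = ⟪b i, c j⟫ := fun i j => by
    simp [Module.Basis.toMatrix_apply, OrthonormalBasis.repr_apply_apply]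
  have hM : b.toBasis.toMatrix c = !![⟪b 0, c 0⟫, -⟪b 1, c 0⟫, ⟪b 0, c 2⟫, -⟪b 1, c 2⟫;
      ⟪b 1, c 0⟫, ⟪b 0, c 0⟫, ⟪b 1, c 2⟫, ⟪b 0, c 2⟫;
      ⟪b 2, c 0⟫, -⟪b 3, c 0⟫, ⟪b 2, c 2⟫, -⟪b 3, c 2⟫;
      ⟪b 3, c 0⟫, ⟪b 2, c 0⟫, ⟪b 3, c 2⟫, ⟪b 2, c 2⟫] := by
    ext i j
    rw [e]
    fin_cases i <;> fin_cases j <;>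
      simp [h1, h3, inner_frameJ_zero, inner_frameJ_one, inner_frameJ_two, inner_frameJ_three]
  have hd : b.toBasis.det c =
      (⟪b 0, c 0⟫ * ⟪b 2, c 2⟫ - ⟪b 1, c 0⟫ * ⟪b 3, c 2⟫
        - ⟪b 2, c 0⟫ * ⟪b 0, c 2⟫ + ⟪b 3, c 0⟫ * ⟪b 1, c 2⟫) ^ 2 +
      (⟪b 0, c 0⟫ * ⟪b 3, c 2⟫ + ⟪b 1, c 0⟫ * ⟪b 2, c 2⟫
        - ⟪b 2, c 0⟫ * ⟪b 1, c 2⟫ - ⟪b 3, c 0⟫ * ⟪b 0, c 2⟫) ^ 2 := by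
    rw [Module.Basis.det_apply, hM, Matrix.det_succ_row_zero]
    simp [Fin.sum_univ_succ, Matrix.det_fin_three, Matrix.submatrix, Fin.succAbove]
    ring
  refine lt_of_le_of_ne ?_ hne.symm
  rw [hd]
  positivity

theorem inner_complexStructure_left {J : V →L[ℝ] V} (hsq : ∀ v, J (J v) = -v)
    (hiso : ∀ v w, ⟪J v, J w⟫ = ⟪v, w⟫) (v w : V) : ⟪J v, w⟫ = -⟪v, J w⟫ := by
  rw [← hiso v (J w), hsq, inner_neg_right, neg_neg]

/-- An orthogonal complex structure which agrees with `frameJ b` on `b 0` and `b 1` rotates the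
orthogonal plane by `±π/2`, and the orientation decides the sign. -/
theorem eq_frameJ {J : V →L[ℝ] V} (hsq : ∀ v, J (J v) = -v)
    (hiso : ∀ v w, ⟪J v, J w⟫ = ⟪v, w⟫)
    (hor : InducesOrientation b.toBasis.orientation J)
    (h0 : ∀ v, ⟪b 0, J v⟫ = -⟪b 1, v⟫) (h1 : ∀ v, ⟪b 1, J v⟫ = ⟪b 0, v⟫) : J = frameJ b := by
  have skew := inner_complexStructure_left hsq hiso
  have J0 : J (b 0) = b 1 := ext_inner_right ℝ fun v => by rw [skew, h0, neg_neg]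
  have J1 : J (b 1) = -b 0 := by rw [← J0, hsq]
  have s2 : ⟪b 2, J (b 2)⟫ = 0 := by
    have := skew (b 2) (b 2)
    rw [real_inner_comm] at this
    linarith
  have c0 : ⟪b 0, J (b 2)⟫ = 0 := by rw [h0]; simp
  have c1 : ⟪b 1, J (b 2)⟫ = 0 := by rw [h1]; simp
  have J2 : J (b 2) = ⟪b 3, J (b 2)⟫ • b 3 := by
    conv_lhs => rw [← b.sum_repr' (J (b 2))]
    simp [Fin.sum_univ_four, c0, c1, s2]
  have hs : ⟪b 3, J (b 2)⟫ ^ 2 = 1 := by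
    have := hiso (b 2) (b 2)
    rw [J2, real_inner_smul_left, real_inner_smul_right] at this
    simp only [inner_basis, if_true] at this
    linarith
  have hs' : (⟪b 3, J (b 2)⟫ - 1) * (⟪b 3, J (b 2)⟫ + 1) = 0 := by linear_combination hs
  rcases mul_eq_zero.1 hs' with h | h
  · rw [sub_eq_zero.1 h, one_smul] at J2
    have J3 : J (b 3) = -b 2 := by rw [← J2, hsq]
    have hi : ∀ i, J (b i) = frameJ b (b i) := by
      intro i
      fin_cases i
      · exact J0.trans (frameJ_zero b).symm
      · exact J1.trans (frameJ_one b).symm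
      · exact J2.trans (frameJ_two b).symm
      · exact J3.trans (frameJ_three b).symm
    ext v
    rw [← b.sum_repr' v, map_sum, map_sum]
    exact Finset.sum_congr rfl fun i _ => by rw [map_smul, map_smul, hi]
  · -- here `J` induces the opposite orientation
    rw [eq_neg_of_add_eq_zero_left h, neg_one_smul] at J2
    have h5 := hor (flipBasis b 3).toBasis
      (by simpa [flipBasis_of_ne] using J0.symm)
      (by simpa [flipBasis_of_ne, flipBasis_self] using J2.symm)
    rw [orientation_flipBasis] at h5
    exact absurd h5.symm (Module.Ray.ne_neg_self _)

/-- If `L` is skew and anticommutes with the complex structure of the orthonormal basis `b`, then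
its Hilbert-Schmidt norm is twice the norm of any of its columns; the first column is orthogonal to
`b 0` and `b 1`. -/
theorem hsNorm_sq_of_anticommute [FiniteDimensional ℝ V] {L J : V →L[ℝ] V}
    (hL : ∀ v w, ⟪L v, w⟫ = -⟪v, L w⟫) (hJ : ∀ v w, ⟪J v, w⟫ = -⟪v, J w⟫)
    (hsq : ∀ v, J (J v) = -v) (hLJ : ∀ v, L (J v) = -J (L v)) (h0 : J (b 0) = b 1)
    (h2 : J (b 2) = b 3) :
    hsNorm L ^ 2 = 4 * (⟪b 2, L (b 0)⟫ ^ 2 + ⟪b 3, L (b 0)⟫ ^ 2) := by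
  have h1 : J (b 1) = -b 0 := by rw [← h0, hsq]
  have h3 : J (b 3) = -b 2 := by rw [← h2, hsq]
  have skew : ∀ i j, ⟪b i, L (b j)⟫ = -⟪b j, L (b i)⟫ := fun i j => by
    rw [real_inner_comm, hL]
  have col : ∀ i j, ⟪b i, L (J (b j))⟫ = ⟪J (b i), L (b j)⟫ := fun i j => by
    rw [hLJ, hJ, inner_neg_right]
  have e01 := col 0 0
  have e11 := col 1 0
  have e21 := col 2 0
  have e31 := col 3 0
  have e23 := col 2 2
  rw [h0] at e01 e11 e21 e31
  rw [h1, inner_neg_left] at e11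
  rw [h2] at e21 e23
  rw [h3, inner_neg_left] at e31
  rw [hsNorm_sq b]
  simp_rw [← b.sum_sq_inner_right, Fin.sum_univ_four]
  have s00 : ⟪b 0, L (b 0)⟫ = 0 := by linarith [skew 0 0]
  have s11 : ⟪b 1, L (b 1)⟫ = 0 := by linarith [skew 1 1]
  have s22 : ⟪b 2, L (b 2)⟫ = 0 := by linarith [skew 2 2]
  have s33 : ⟪b 3, L (b 3)⟫ = 0 := by linarith [skew 3 3]
  have s01 : ⟪b 0, L (b 1)⟫ = 0 := by linarith [skew 0 1]
  have s10 : ⟪b 1, L (b 0)⟫ = 0 := by linarith [skew 0 1]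
  have s23 : ⟪b 2, L (b 3)⟫ = 0 := by linarith [skew 2 3]
  have s32 : ⟪b 3, L (b 2)⟫ = 0 := by linarith [skew 2 3]
  rw [s00, s11, s22, s33, s01, s10, s23, s32, skew 0 2, skew 0 3, skew 1 2, skew 1 3, e21, e31]
  ring

/-- Let `A`, `B` be the real and imaginary parts of a complex-valued symmetric form `S`, trace free,
with `S (b 1, ·) = i S (b 0, ·)`. Then `⟨S, S⟩ = 2 (S₂₂ ^ 2 + S₂₃ ^ 2)`, and `S₂₂ ^ 2 + S₂₃ ^ 2`
is the product of `S₂₂ + i S₂₃` and `S₂₂ - i S₂₃`; the squared moduli of both sides are equated. -/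
theorem mul_eq_of_isotropic {A B : V →L[ℝ] V}
    (hA : ∀ v w, ⟪A v, w⟫ = ⟪A w, v⟫) (hB : ∀ v w, ⟪B v, w⟫ = ⟪B w, v⟫)
    (h0 : ∀ w, ⟪A w, b 0⟫ = ⟪B w, b 1⟫) (h1 : ∀ w, ⟪A w, b 1⟫ = -⟪B w, b 0⟫)
    (trA : ∑ i, ⟪A (b i), b i⟫ = 0) (trB : ∑ i, ⟪B (b i), b i⟫ = 0) :
    ((⟪b 2, B (b 2)⟫ + ⟪b 3, A (b 2)⟫) ^ 2 + (⟪b 3, B (b 2)⟫ - ⟪b 2, A (b 2)⟫) ^ 2) *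
      ((⟪b 2, B (b 2)⟫ - ⟪b 3, A (b 2)⟫) ^ 2 + (⟪b 3, B (b 2)⟫ + ⟪b 2, A (b 2)⟫) ^ 2) =
    ((∑ i, ⟪A (b i), A (b i)⟫ - ∑ i, ⟪B (b i), B (b i)⟫) / 2) ^ 2 +
      (∑ i, ⟪A (b i), B (b i)⟫) ^ 2 := by
  have e : ∀ v w : V, ⟪v, w⟫ = ⟪v, b 0⟫ * ⟪w, b 0⟫ + ⟪v, b 1⟫ * ⟪w, b 1⟫ + ⟪v, b 2⟫ * ⟪w, b 2⟫
      + ⟪v, b 3⟫ * ⟪w, b 3⟫ := fun v w => by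
    rw [← b.sum_inner_mul_inner, Fin.sum_univ_four]
    simp only [real_inner_comm w]
  simp only [Fin.sum_univ_four] at trA trB ⊢
  simp only [real_inner_comm (A (b 2)) (b _), real_inner_comm (B (b 2)) (b _)]
  rw [e (A (b 0)) (A (b 0)), e (A (b 1)) (A (b 1)), e (A (b 2)) (A (b 2)), e (A (b 3)) (A (b 3)),
    e (B (b 0)) (B (b 0)), e (B (b 1)) (B (b 1)), e (B (b 2)) (B (b 2)), e (B (b 3)) (B (b 3)),
    e (A (b 0)) (B (b 0)), e (A (b 1)) (B (b 1)), e (A (b 2)) (B (b 2)), e (A (b 3)) (B (b 3))]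
  simp only [hA (b 0) (b 2), hA (b 1) (b 2), hA (b 0) (b 3), hA (b 1) (b 3), hB (b 0) (b 2),
    hB (b 1) (b 2), hB (b 0) (b 3), hB (b 1) (b 3), hA (b 3) (b 2), hB (b 3) (b 2),
    hB (b 1) (b 0), h0, h1] at trA trB ⊢
  have t1 : ⟪A (b 3), b 3⟫ = -⟪A (b 2), b 2⟫ := by linarith
  have t2 : ⟪B (b 1), b 1⟫ = -⟪B (b 0), b 0⟫ := by
    have := hA (b 0) (b 1)
    rw [h0, h1] at this
    linarith
  have t3 : ⟪B (b 3), b 3⟫ = -⟪B (b 2), b 2⟫ := by linarith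
  rw [t1, t2, t3]
  ring

end LinearAlgebra

/-! ### Orientations and orthonormal frames -/

section RiemannianFrames

variable {E : Type*} [NormedAddCommGroup E] [NormedSpace ℝ E] [FiniteDimensional ℝ E]
  {H : Type*} [TopologicalSpace H] (I : ModelWithCorners ℝ E H) [I.Boundaryless]
  {M : Type*} [TopologicalSpace M] [ChartedSpace H M] [IsManifold I ∞ M]
  [RiemannianBundle (fun x : M => TangentSpace I x)]
  [IsContMDiffRiemannianBundle I ∞ E (fun x : M => TangentSpace I x)]

theorem continuousAt_frameDet {ι : Type*} [Fintype ι] [DecidableEq ι]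
    {e s : ι → Π x : M, TangentSpace I x} {x : M} (he : ∀ i, CMDiffAt 0 (T% (e i)) x)
    (hs : ∀ i, CMDiffAt 0 (T% (s i)) x) :
    ContinuousAt (fun y => (Matrix.of fun i j => ⟪e i y, s j y⟫).det) x := by
  have h1 : ∀ i j, ContinuousAt (fun y => ⟪e i y, s j y⟫) x := fun i j =>
    (contMDiffAt_inner I (n := 0) (by simp) (he i) (hs j)).continuousAt
  exact (continuous_id.matrix_det (R := ℝ)).continuousAt.comp
    (continuousAt_pi.2 fun i => continuousAt_pi.2 fun j => h1 i j)

theorem IsOrthonormalFrameOn.det_basisAt {k : ℕ∞ω} {ι : Type*} [Fintype ι] [DecidableEq ι]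
    {e : ι → Π x : M, TangentSpace I x} {W : Set M}
    (he : IsOrthonormalFrameOn I k e W) {y : M} (hy : y ∈ W) (s : ι → TangentSpace I y) :
    (he.basisAt hy).toBasis.det s = (Matrix.of fun i j => ⟪e i y, s j⟫).det := by
  rw [Module.Basis.det_apply]
  congr 1
  ext i j
  simp [Module.Basis.toMatrix_apply, OrthonormalBasis.repr_apply_apply, he.basisAt_apply]

/-- The opposite orientation is continuous: change the sign of one member of the local frames. -/
theorem IsOrientationOn.neg {n : ℕ} {o : Π x : M, Orientation ℝ (TangentSpace I x) (Fin n)}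
    {U : Set M} (ho : IsOrientationOn I o U) (k : Fin n) : IsOrientationOn I (fun x => -o x) U := by
  intro x hx
  obtain ⟨W, hW, hxW, b, hb, hbo⟩ := ho x hx
  refine ⟨W, hW, hxW, fun y => (b y).unitsSMul (Function.update 1 k (-1)), fun i => ?_,
    fun y hy => ?_⟩
  · by_cases hi : i = k
    · subst hi
      have h := contMDiffOn_zero_iff.1 ((contMDiffOn_zero_iff (I := I)
        (I' := I.prod 𝓘(ℝ, E)).2 (hb i)).neg_section (s := fun y => b y i))
      simpa [Module.Basis.unitsSMul_apply] using h
    · simpa [Module.Basis.unitsSMul_apply, hi] using hb i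
  · rw [Module.Basis.orientation_neg_single, hbo y hy]

section OrientedFrames

variable {k : ℕ∞ω} {n : ℕ} {e : Fin n → Π x : M, TangentSpace I x} {W : Set M}

/-- The sign of the determinant relating an orthonormal frame to the frames that define `o` is
locally constant. -/
theorem orientation_of_orthonormalFrame (he : IsOrthonormalFrameOn I k e W)
    {o : Π x : M, Orientation ℝ (TangentSpace I x) (Fin n)} {U : Set M}
    (ho : IsOrientationOn I o U) {x : M} (hx : x ∈ W) (hxU : x ∈ U) :
    (∀ᶠ y in 𝓝 x, ∀ hy : y ∈ W, (he.basisAt hy).toBasis.orientation = o y) ∨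
      ∀ᶠ y in 𝓝 x, ∀ hy : y ∈ W, (he.basisAt hy).toBasis.orientation = -o y := by
  obtain ⟨W', hW', hxW', b, hb, hbo⟩ := ho x hxU
  set d : M → ℝ := fun y => (Matrix.of fun i j => ⟪e i y, b y j⟫).det
  have hdet : ∀ y (hy : y ∈ W), (he.basisAt hy).toBasis.det (b y) = d y := fun y hy =>
    he.det_basisAt I hy (b y)
  have hcont : ContinuousAt d x :=
    continuousAt_frameDet I (s := fun i y => b y i)
      (fun i => (he.contMDiffAt i x hx).of_le (by simp))
      fun j => (contMDiffOn_zero_iff.2 (hb j)).contMDiffAt (hW'.mem_nhds hxW')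
  have h0 : d x ≠ 0 := by
    rw [← hdet x hx]
    exact ((he.basisAt hx).toBasis.isUnit_det (b x)).ne_zero
  rcases lt_or_gt_of_ne h0 with h | h
  · right
    filter_upwards [hcont.eventually_lt_const h, hW'.mem_nhds hxW'] with y hy hyW' hyW
    rw [← hbo y hyW']
    refine ((b y).orientation_ne_iff_eq_neg _).1 fun h' => ?_
    have := ((he.basisAt hyW).toBasis.orientation_eq_iff_det_pos (b y)).1 h'
    rw [hdet] at this
    exact absurd hy this.not_gt
  · left
    filter_upwards [hcont.eventually_const_lt h, hW'.mem_nhds hxW'] with y hy hyW' hyW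
    rw [← hbo y hyW', Module.Basis.orientation_eq_iff_det_pos, hdet]
    exact hy

theorem IsOrthonormalFrameOn.flip (he : IsOrthonormalFrameOn I k e W) (j : Fin n) :
    IsOrthonormalFrameOn I k (Function.update e j (fun y => -e j y)) W where
  isOpen := he.isOpen
  contMDiffAt i x hx := by
    by_cases hi : i = j
    · subst hi
      simpa using (he.contMDiffAt i x hx).neg_section
    · simpa [hi] using he.contMDiffAt i x hx
  orthonormal x hx := by
    convert (flipBasis (he.basisAt hx) j).orthonormal using 1
    ext i
    by_cases hi : i = j
    · subst hi
      simp [flipBasis_self, he.basisAt_apply]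
    · simp [flipBasis_of_ne _ hi, he.basisAt_apply, hi]
  card := he.card

/-- An orthonormal frame can be made positive near a given point by changing the sign of one of its
members. -/
theorem exists_oriented_frame (he : IsOrthonormalFrameOn I k e W)
    {o : Π x : M, Orientation ℝ (TangentSpace I x) (Fin n)} {U : Set M}
    (ho : IsOrientationOn I o U) {x : M} (hx : x ∈ W) (hxU : x ∈ U) (j : Fin n) :
    ∃ e' : Fin n → Π x : M, TangentSpace I x, ∃ he' : IsOrthonormalFrameOn I k e' W,
      (∀ i ≠ j, e' i = e i) ∧
      ∀ᶠ y in 𝓝 x, ∀ hy : y ∈ W, (he'.basisAt hy).toBasis.orientation = o y := by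
  rcases orientation_of_orthonormalFrame I he ho hx hxU with h | h
  · exact ⟨e, he, fun _ _ => rfl, h⟩
  · refine ⟨_, he.flip I j, fun i hi => by simp [hi], ?_⟩
    filter_upwards [h] with y h hy
    rw [orientation_neg_of_flip (he.basisAt hy) ((he.flip I j).basisAt hy) j
      (fun i hi => by simp [IsOrthonormalFrameOn.basisAt_apply, hi])
      (by simp [IsOrthonormalFrameOn.basisAt_apply]), h hy]
    exact neg_neg (o y)

end OrientedFrames

theorem exists_orthonormalFrame_fin {d : ℕ} (hd : Module.finrank ℝ E = d) (p : M) :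
    ∃ (W : Set M) (e : Fin d → Π x : M, TangentSpace I x), p ∈ W ∧
      IsOrthonormalFrameOn I ∞ e W := by
  subst hd
  exact exists_orthonormalFrame I p

theorem exists_field_extending (x : M) (v : TangentSpace I x) :
    ∃ X : Π y : M, TangentSpace I y, X x = v ∧ ∀ᶠ y in 𝓝 x, CMDiffAt ∞ (T% X) y := by
  obtain ⟨W, e, hx, he⟩ := exists_orthonormalFrame I x
  refine ⟨fun y => ∑ i, ⟪e i x, v⟫ • e i y, he.sum_inner_smul hx v, ?_⟩
  filter_upwards [he.isOpen.mem_nhds hx] with y hy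
  exact ContMDiffAt.sum_section fun i _ => contMDiffAt_const.smul_section (he.contMDiffAt i y hy)

/-- Two orthogonal non-vanishing fields on a manifold of dimension four are, after normalization,
the first two members of an orthonormal frame. -/
theorem exists_orthonormalFrame_extending (hE : Module.finrank ℝ E = 4) {n : ℕ∞ω} (hn : n ≤ ∞)
    {p q : Π y : M, TangentSpace I y} {x : M} (hp : ∀ᶠ y in 𝓝 x, CMDiffAt n (T% p) y)
    (hq : ∀ᶠ y in 𝓝 x, CMDiffAt n (T% q) y) (hpx : p x ≠ 0) (hqx : q x ≠ 0)
    (hpq : ∀ᶠ y in 𝓝 x, ⟪p y, q y⟫ = 0) :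
    ∃ (W : Set M) (e : Fin 4 → Π y : M, TangentSpace I y), x ∈ W ∧ IsOrthonormalFrameOn I n e W ∧
      ∀ y ∈ W, e 0 y = ‖p y‖⁻¹ • p y ∧ e 1 y = ‖q y‖⁻¹ • q y := by
  obtain ⟨W₀, e, hx₀, he⟩ := exists_orthonormalFrame_fin I hE x
  have hdim : Module.finrank ℝ (TangentSpace I x) = Fintype.card (Fin 4) := by
    rw [Fintype.card_fin]
    exact hE
  obtain ⟨b, hb⟩ := Orthonormal.exists_orthonormalBasis_extension_of_card_eq (𝕜 := ℝ)
    (ι := Fin 4) hdim (v := ![‖p x‖⁻¹ • p x, ‖q x‖⁻¹ • q x, 0, 0]) (s := {0, 1}) (by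
      rw [orthonormal_iff_ite]
      have h0 := hpq.self_of_nhds
      have h1 : ⟪q x, p x⟫ = 0 := by rw [real_inner_comm, h0]
      have h2 : ‖p x‖ ≠ 0 := norm_ne_zero_iff.2 hpx
      have h3 : ‖q x‖ ≠ 0 := norm_ne_zero_iff.2 hqx
      rintro ⟨i, hi⟩ ⟨j, hj⟩
      have h4 : ¬ (0 : Fin 4) = 1 := by decide
      simp only [Subtype.mk_eq_mk]
      rcases hi with rfl | rfl <;> rcases hj with rfl | rfl <;>
        simp [inner_smul_left, inner_smul_right, h0, h1, h2, h3, norm_smul, h4])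
  obtain ⟨X, hX, hX'⟩ := exists_field_extending I x (b 2)
  obtain ⟨Y, hY, hY'⟩ := exists_field_extending I x (b 3)
  have b0 : b 0 = ‖p x‖⁻¹ • p x := hb 0 (by simp)
  have b1 : b 1 = ‖q x‖⁻¹ • q x := hb 1 (by simp)
  let s : Fin 4 → Π y : M, TangentSpace I y :=
    ![fun y => ‖p y‖⁻¹ • p y, fun y => ‖q y‖⁻¹ • q y, X, Y]
  have hne : ∀ {r : Π y : M, TangentSpace I y}, CMDiffAt n (T% r) x → r x ≠ 0 →
      ∀ᶠ y in 𝓝 x, r y ≠ 0 := fun {r} hr h0 => by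
    have := (contMDiffAt_inner I hn hr hr).continuousAt.eventually_ne (y := 0) (by simpa using h0)
    filter_upwards [this] with y hy
    simpa using hy
  have hs : ∀ᶠ y in 𝓝 x, ∀ i, CMDiffAt n (T% (s i)) y := by
    filter_upwards [hp, hq, hX', hY', hne hp.self_of_nhds hpx, hne hq.self_of_nhds hqx]
      with y h1 h2 h3 h4 h5 h6 i
    fin_cases i
    · exact ((contMDiffAt_norm I hn h1 h5).inv₀ (norm_ne_zero_iff.2 h5)).smul_section h1
    · exact ((contMDiffAt_norm I hn h2 h6).inv₀ (norm_ne_zero_iff.2 h6)).smul_section h2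
    · exact h3.of_le hn
    · exact h4.of_le hn
  have hsx : (fun i => s i x) = b := by
    ext i
    fin_cases i
    · exact b0.symm
    · exact b1.symm
    · exact hX
    · exact hY
  have hdet := continuousAt_frameDet I (fun i => (he.contMDiffAt i x hx₀).of_le (by simp))
    (fun i => (hs.self_of_nhds i).of_le (by simp))
  have hli : ∀ᶠ y in 𝓝 x, LinearIndependent ℝ (fun i => s i y) := by
    have h0 : (Matrix.of fun i j => ⟪e i x, s j x⟫).det ≠ 0 := by
      rw [← he.det_basisAt I hx₀ (fun i => s i x), hsx]
      exact ((he.basisAt hx₀).toBasis.isUnit_det b.toBasis).ne_zero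
    filter_upwards [hdet.eventually_ne h0, he.isOpen.mem_nhds hx₀] with y hy hyW
    rw [← he.det_basisAt I hyW (fun i => s i y)] at hy
    exact (((he.basisAt hyW).toBasis.is_basis_iff_det).2 hy.isUnit).1
  obtain ⟨W, hW, hWo, hxW⟩ := eventually_nhds_iff.1 ((hs.and hli).and (hpq.and
    ((hne hp.self_of_nhds hpx).and (hne hq.self_of_nhds hqx))))
  refine ⟨W, fun i y => InnerProductSpace.gramSchmidtNormed ℝ (fun i => s i y) i, hxW,
    ⟨hWo, fun i y hy => contMDiffAt_gramSchmidtNormed I hn (hW y hy).1.1 (hW y hy).1.2 i,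
    fun y hy => InnerProductSpace.gramSchmidtNormed_orthonormal (hW y hy).1.2, by simp [hE]⟩,
    fun y hy => ?_⟩
  obtain ⟨-, h0, h1, h2⟩ := hW y hy
  have g0 : InnerProductSpace.gramSchmidt ℝ (fun i => s i y) 0 = s 0 y := by
    have hI : Finset.Iio (0 : Fin 4) = ∅ := by decide
    rw [InnerProductSpace.gramSchmidt_def, hI]
    simp
  have hI : Finset.Iio (1 : Fin 4) = {0} := by decide
  have g1 : InnerProductSpace.gramSchmidt ℝ (fun i => s i y) 1 = s 1 y := by
    rw [InnerProductSpace.gramSchmidt_def, hI, Finset.sum_singleton, g0,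
      Submodule.starProjection_singleton]
    simp [s, inner_smul_left, inner_smul_right, h0]
  have n0 : ‖s 0 y‖ = 1 := by simp [s, norm_smul, h1]
  have n1 : ‖s 1 y‖ = 1 := by simp [s, norm_smul, h2]
  simp only [InnerProductSpace.gramSchmidtNormed, g0, g1, n0, n1]
  simp [s]

/-! ### Fields of endomorphisms -/

/-- A field of endomorphisms is differentiable if it maps the coordinate vector fields to
differentiable fields. -/
theorem endMDiffAt_of_apply {J : Π y : M, TangentSpace I y →L[ℝ] TangentSpace I y} {x : M}
    (h : ∀ v : TangentSpace I x, MDiffAt (T% (fun y => J y (FiberBundle.extend E v y))) x) :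
    EndMDiffAt I J x := by
  unfold EndMDiffAt
  rw [mdifferentiableAt_hom_bundle]
  refine ⟨mdifferentiableAt_id, ?_⟩
  set φ : M → E →L[ℝ] E := fun y => ContinuousLinearMap.inCoordinates E
    (fun y : M => TangentSpace I y) E (fun y : M => TangentSpace I y) x y x y (J y) with hφ
  have hb : ∀ v : E, MDiffAt (fun y => φ y v) x := by
    intro v
    set t := trivializationAt E (fun y : M => TangentSpace I y) x with ht
    have hx := FiberBundle.mem_baseSet_trivializationAt' (F := E) (E := fun y : M =>
      TangentSpace I y) x
    have h1 := (mdifferentiableAt_section _ _).1 (h (t.symm x v))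
    refine h1.congr_of_eventuallyEq ?_
    filter_upwards [t.open_baseSet.mem_nhds hx] with y hy
    rw [hφ]
    simp only [ContinuousLinearMap.inCoordinates_eq hy hy]
    have hv : (t ⟨x, t.symm x v⟩).2 = v := by
      have := t.apply_mk_symm hx v
      rw [this]
    simp only [FiberBundle.extend, ← ht, hv]
    simp
  let b := Module.finBasis ℝ E
  let S : Fin (Module.finrank ℝ E) → E →L[ℝ] (E →L[ℝ] E) := fun i =>
    ContinuousLinearMap.smulRightL ℝ E E (LinearMap.toContinuousLinearMap (b.coord i))
  have hS : φ = ∑ i, fun y => S i (φ y (b i)) := by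
    ext y v
    conv_lhs => rw [← b.sum_repr v, map_sum]
    simp [S]
  change MDiffAt φ x
  rw [hS]
  exact MDifferentiableAt.sum fun i _ =>
    (S i).differentiableAt.mdifferentiableAt.comp x (hb (b i))

theorem endMDiffAt_congr {J J' : Π y : M, TangentSpace I y →L[ℝ] TangentSpace I y} {x : M}
    (hJ : EndMDiffAt I J x) (h : ∀ᶠ y in 𝓝 x, J' y = J y) : EndMDiffAt I J' x := by
  refine MDifferentiableAt.congr_of_eventuallyEq hJ ?_
  filter_upwards [h] with y hy
  rw [hy]

theorem endMDiffAt_frameJ {e : Fin 4 → Π x : M, TangentSpace I x} {x : M}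
    (he : ∀ i, MDiffAt (T% (e i)) x) : EndMDiffAt I (fun y => frameJ fun i => e i y) x := by
  refine endMDiffAt_of_apply I fun v => ?_
  have hv := FiberBundle.mdifferentiableAt_extend (I := I) (F := E) v
  have h : ∀ i j, MDiffAt (T% (fun y => ⟪e i y, FiberBundle.extend E v y⟫ • e j y)) x := fun i j =>
    (mdiffAt_inner I (he i) hv).smul_section (he j)
  exact mdifferentiableAt_add_section (mdifferentiableAt_sub_section (h 0 1) (h 1 0))
    (mdifferentiableAt_sub_section (h 2 3) (h 3 2))

section CovariantDerivative

variable {J : Π y : M, TangentSpace I y →L[ℝ] TangentSpace I y} {x : M}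

theorem covDerivEnd_skew (hJ : EndMDiffAt I J x)
    (h : ∀ᶠ y in 𝓝 x, ∀ v w, ⟪J y v, w⟫ = -⟪v, J y w⟫) (T v w : TangentSpace I x) :
    ⟪covDerivEnd I J x T v, w⟫ = -⟪v, covDerivEnd I J x T w⟫ := by
  have hv := FiberBundle.mdifferentiableAt_extend (I := I) (F := E) v
  have hw := FiberBundle.mdifferentiableAt_extend (I := I) (F := E) w
  set Y := FiberBundle.extend E v (E := fun y : M => TangentSpace I y)
  set Z := FiberBundle.extend E w (E := fun y : M => TangentSpace I y)
  have e1 : Y x = v := by simp [Y]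
  have e2 : Z x = w := by simp [Z]
  rw [← e1, ← e2, covDerivEnd_apply I hJ T hv, covDerivEnd_apply I hJ T hw, inner_sub_left,
    inner_sub_right, h.self_of_nhds]
  have h1 := mvfderiv_inner I (hJ.apply I hv) hw T
  have h2 := mvfderiv_inner I hv (hJ.apply I hw) T
  have h3 : d% (fun y => ⟪J y (Y y), Z y⟫) x = -d% (fun y => ⟪Y y, J y (Z y)⟫) x := by
    rw [← mvfderiv_neg]
    refine mvfderiv_congr I ?_
    filter_upwards [h] with y hy
    exact hy _ _
  rw [h3, neg_apply] at h1
  rw [h.self_of_nhds] at h1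
  linarith

theorem covDerivEnd_anticommute (hJ : EndMDiffAt I J x)
    (h : ∀ᶠ y in 𝓝 x, ∀ v, J y (J y v) = -v) (T v : TangentSpace I x) :
    covDerivEnd I J x T (J x v) = -J x (covDerivEnd I J x T v) := by
  have hv := FiberBundle.mdifferentiableAt_extend (I := I) (F := E) v
  set Y := FiberBundle.extend E v (E := fun y : M => TangentSpace I y)
  have e1 : Y x = v := by simp [Y]
  have h1 := hJ.apply I hv
  have h2 : leviCivita I (fun y => J y (J y (Y y))) x = leviCivita I ((-1 : ℝ) • Y) x := by
    refine leviCivita_congr I (hJ.apply I h1) ?_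
    filter_upwards [h] with y hy
    rw [hy, Pi.smul_apply, neg_one_smul]
  rw [(leviCivita I).isCovariantDerivativeOn.smul_const (-1) hv] at h2
  rw [← e1, covDerivEnd_apply I hJ T h1, covDerivEnd_apply I hJ T hv, h2, map_sub,
    h.self_of_nhds]
  simp [sub_eq_add_neg]

/-- The covariant derivative of `J` on a field `Y` with `J Y = Z`. -/
theorem covDerivEnd_apply_of_eq (hJ : EndMDiffAt I J x) {Y Z : Π y : M, TangentSpace I y}
    (hY : MDiffAt (T% Y) x) (h : ∀ᶠ y in 𝓝 x, J y (Y y) = Z y) (T : TangentSpace I x) :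
    covDerivEnd I J x T (Y x) = leviCivita I Z x T - J x (leviCivita I Y x T) := by
  rw [covDerivEnd_apply I hJ T hY, leviCivita_congr I (hJ.apply I hY) h]

end CovariantDerivative

end RiemannianFrames

/-! ### The weighted Wiener algebra -/

section WeightedConvolution

open MeasureTheory FourierTransform ComplexConjugate
open scoped Convolution

/-- The submultiplicative weight `(1 + |ξ|) ^ 2`. -/
def weight (ξ : ℂ) : ℝ := (1 + ‖ξ‖) ^ 2

theorem one_le_weight (ξ : ℂ) : 1 ≤ weight ξ := by
  have := norm_nonneg ξ
  unfold weight
  nlinarith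

theorem weight_pos (ξ : ℂ) : 0 < weight ξ := lt_of_lt_of_le one_pos (one_le_weight ξ)

theorem continuous_weight : Continuous weight := by
  unfold weight
  fun_prop

theorem weight_le_mul (ξ η : ℂ) : weight ξ ≤ weight η * weight (ξ - η) := by
  have h : ‖ξ‖ ≤ ‖η‖ + ‖ξ - η‖ := by simpa using norm_add_le η (ξ - η)
  have h2 : 0 ≤ ‖η‖ * ‖ξ - η‖ := by positivity
  unfold weight
  rw [← mul_pow]
  gcongr
  nlinarith

/-- Membership in the weighted space `L¹((1 + |ξ|) ^ 2 dξ)`. -/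
def WeightedIntegrable (φ : ℂ → ℂ) : Prop := Integrable fun ξ => weight ξ • φ ξ

/-- The norm of the weighted space `L¹((1 + |ξ|) ^ 2 dξ)`. -/
def weightedNorm (φ : ℂ → ℂ) : ℝ := ∫ ξ, ‖weight ξ • φ ξ‖

variable {φ ψ m : ℂ → ℂ}

theorem WeightedIntegrable.aestronglyMeasurable (h : WeightedIntegrable φ) :
    AEStronglyMeasurable φ := by
  have h1 := (continuous_weight.inv₀ fun ξ => (weight_pos ξ).ne').aestronglyMeasurable.smul
    (MeasureTheory.Integrable.aestronglyMeasurable h) (μ := volume)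
  refine h1.congr (Filter.Eventually.of_forall fun ξ => ?_)
  simp [(weight_pos ξ).ne']

theorem weightedIntegrable_iff : WeightedIntegrable φ ↔
    AEStronglyMeasurable φ ∧ Integrable fun ξ => weight ξ * ‖φ ξ‖ := by
  refine ⟨fun h => ⟨h.aestronglyMeasurable, ?_⟩, fun h => ?_⟩
  · refine (Integrable.norm h).congr (Filter.Eventually.of_forall fun ξ => ?_)
    simp [abs_of_pos (weight_pos ξ)]
  · refine h.2.mono' (continuous_weight.aestronglyMeasurable.smul h.1)
      (Filter.Eventually.of_forall fun ξ => ?_)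
    simp [abs_of_pos (weight_pos ξ)]

theorem weightedNorm_eq (φ : ℂ → ℂ) : weightedNorm φ = ∫ ξ, weight ξ * ‖φ ξ‖ := by
  simp_rw [weightedNorm, norm_smul, Real.norm_eq_abs, abs_of_pos (weight_pos _)]

theorem WeightedIntegrable.mono (h : WeightedIntegrable φ) (hψ : AEStronglyMeasurable ψ)
    {v : ℂ → ℝ} (hv : ∀ ξ, ‖v ξ‖ ≤ weight ξ) (hvc : Continuous v) (hle : ∀ ξ, ‖ψ ξ‖ ≤ ‖φ ξ‖) :
    Integrable fun ξ => v ξ * ‖ψ ξ‖ := by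
  refine (weightedIntegrable_iff.1 h).2.mono' (hvc.aestronglyMeasurable.mul hψ.norm)
    (Filter.Eventually.of_forall fun ξ => ?_)
  rw [norm_mul, norm_norm]
  exact mul_le_mul (hv ξ) (hle ξ) (norm_nonneg _) (weight_pos ξ).le

theorem WeightedIntegrable.integrable (h : WeightedIntegrable φ) : Integrable φ := by
  have := h.mono h.aestronglyMeasurable (v := fun _ => 1) (by simpa using one_le_weight)
    continuous_const (fun _ => le_rfl)
  simp only [one_mul] at this
  exact (integrable_norm_iff h.aestronglyMeasurable).1 this

theorem WeightedIntegrable.integral_norm_le (h : WeightedIntegrable φ) :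
    ∫ ξ, ‖φ ξ‖ ≤ weightedNorm φ := by
  rw [weightedNorm_eq]
  refine integral_mono h.integrable.norm (weightedIntegrable_iff.1 h).2 fun ξ => ?_
  exact le_mul_of_one_le_left (norm_nonneg _) (one_le_weight ξ)

theorem WeightedIntegrable.mul_left (h : WeightedIntegrable φ) (hm : Measurable m)
    (hm1 : ∀ ξ, ‖m ξ‖ ≤ 1) : WeightedIntegrable (fun ξ => m ξ * φ ξ) ∧
      weightedNorm (fun ξ => m ξ * φ ξ) ≤ weightedNorm φ := by
  have hle : ∀ ξ, ‖m ξ * φ ξ‖ ≤ ‖φ ξ‖ := fun ξ => by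
    rw [norm_mul]
    exact mul_le_of_le_one_left (norm_nonneg _) (hm1 ξ)
  have h1 : AEStronglyMeasurable (fun ξ => m ξ * φ ξ) :=
    hm.aestronglyMeasurable.mul h.aestronglyMeasurable
  have h2 := h.mono h1 (v := weight)
    (fun ξ => by rw [Real.norm_eq_abs, abs_of_pos (weight_pos ξ)]) continuous_weight hle
  refine ⟨weightedIntegrable_iff.2 ⟨h1, h2⟩, ?_⟩
  rw [weightedNorm_eq, weightedNorm_eq]
  exact integral_mono h2 (weightedIntegrable_iff.1 h).2
    fun ξ => mul_le_mul_of_nonneg_left (hle ξ) (weight_pos ξ).le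

/-- The weighted space is a Banach algebra for the convolution. -/
theorem WeightedIntegrable.convolution (hφ : WeightedIntegrable φ) (hψ : WeightedIntegrable ψ) :
    WeightedIntegrable (φ ⋆[ContinuousLinearMap.mul ℂ ℂ] ψ) ∧
      weightedNorm (φ ⋆[ContinuousLinearMap.mul ℂ ℂ] ψ) ≤ weightedNorm φ * weightedNorm ψ := by
  have h1 := (weightedIntegrable_iff.1 hφ).2
  have h2 := (weightedIntegrable_iff.1 hψ).2
  have h3 := h1.integrable_convolution (ContinuousLinearMap.mul ℝ ℝ) h2
  have hle : ∀ᵐ ξ : ℂ, weight ξ * ‖(φ ⋆[ContinuousLinearMap.mul ℂ ℂ] ψ) ξ‖ ≤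
      ((fun ξ => weight ξ * ‖φ ξ‖) ⋆[ContinuousLinearMap.mul ℝ ℝ] fun ξ => weight ξ * ‖ψ ξ‖) ξ := by
    filter_upwards [h1.ae_convolution_exists (ContinuousLinearMap.mul ℝ ℝ) h2] with ξ hξ
    rw [convolution_def, convolution_def, ← abs_of_pos (weight_pos ξ), ← Real.norm_eq_abs,
      ← norm_smul, ← integral_smul]
    refine norm_integral_le_of_norm_le hξ (Filter.Eventually.of_forall fun η => ?_)
    simp only [ContinuousLinearMap.mul_apply', norm_smul, norm_mul, Real.norm_eq_abs,
      abs_of_pos (weight_pos ξ)]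
    calc weight ξ * (‖φ η‖ * ‖ψ (ξ - η)‖)
        ≤ weight η * weight (ξ - η) * (‖φ η‖ * ‖ψ (ξ - η)‖) := by
          gcongr
          exact weight_le_mul ξ η
      _ = _ := by ring
  have h4 := (hφ.integrable.integrable_convolution (ContinuousLinearMap.mul ℂ ℂ)
    hψ.integrable).aestronglyMeasurable
  have h5 : Integrable fun ξ => weight ξ * ‖(φ ⋆[ContinuousLinearMap.mul ℂ ℂ] ψ) ξ‖ := by
    refine h3.mono' (continuous_weight.aestronglyMeasurable.mul h4.norm) ?_
    filter_upwards [hle] with ξ hξ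
    rwa [norm_mul, norm_norm, Real.norm_eq_abs, abs_of_pos (weight_pos ξ)]
  refine ⟨weightedIntegrable_iff.2 ⟨h4, h5⟩, ?_⟩
  rw [weightedNorm_eq, weightedNorm_eq, weightedNorm_eq]
  refine (integral_mono_ae h5 h3 hle).trans_eq ?_
  rw [integral_convolution _ h1 h2]
  rfl

/-- The sum of an absolutely convergent series in `L¹` can be taken pointwise. -/
theorem integrable_tsum {F : ℕ → ℂ → ℂ} (hF : ∀ n, Integrable (F n))
    (hs : Summable fun n => ∫ ξ, ‖F n ξ‖) : Integrable fun ξ => ∑' n, F n ξ := by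
  have h1 : Summable fun n => ‖(hF n).toL1 (F n)‖ := by
    simpa only [L1.norm_of_fun_eq_integral_norm] using hs
  have h2 := Lp.hasSum_coeFn_tsum (f := fun n => (hF n).toL1 (F n))
    (tsum_enorm_ne_top_iff_summable_norm.2 h1)
  refine (L1.integrable_coeFn (∑' n, (hF n).toL1 (F n))).congr ?_
  filter_upwards [h2, ae_all_iff.2 fun n => (hF n).coeFn_toL1] with ξ h3 h4
  rw [← h3.tsum_eq]
  exact tsum_congr h4

theorem hasSum_fourier {F : ℕ → ℂ → ℂ} (hF : ∀ n, Integrable (F n))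
    (hs : Summable fun n => ∫ ξ, ‖F n ξ‖) (z : ℂ) :
    HasSum (fun n => 𝓕 (F n) z) (𝓕 (fun ξ => ∑' n, F n ξ) z) := by
  simp_rw [Real.fourier_eq]
  have h := hasSum_integral_of_summable_integral_norm
    (F := fun n ξ => Real.fourierChar (-⟪ξ, z⟫) • F n ξ)
    (fun n => (Real.fourierIntegral_convergent_iff z).2 (hF n)) (by simpa using hs)
  simpa only [Circle.smul_def, tsum_const_smul''] using h

/-- Solution by a Neumann series of the equation `Φ = k (1 + S Φ)`, where `S` is the Fourier
multiplier with symbol `m`: here `k` and `Φ` are the Fourier transforms of `K` and `ψ`, products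
become convolutions, and `S` does not increase the weighted norm. -/
theorem exists_neumann {K : ℂ → ℂ} (hK : WeightedIntegrable K) (hK1 : weightedNorm K ≤ 1 / 3)
    (hm : Measurable m) (hm1 : ∀ ξ, ‖m ξ‖ ≤ 1) :
    ∃ ψ, WeightedIntegrable ψ ∧ (∀ z, 𝓕 ψ z = 𝓕 K z * (1 + 𝓕 (fun ξ => m ξ * ψ ξ) z)) ∧
      ‖𝓕 (fun ξ => m ξ * ψ ξ) 0‖ < 1 := by
  let F : ℕ → ℂ → ℂ := fun n => Nat.rec K
    (fun _ φ => K ⋆[ContinuousLinearMap.mul ℂ ℂ] (fun ξ => m ξ * φ ξ)) n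
  have hF : ∀ n, WeightedIntegrable (F n) ∧ weightedNorm (F n) ≤ (1 / 3) ^ (n + 1) := by
    intro n
    induction n with
    | zero => exact ⟨hK, by rw [zero_add, pow_one]; exact hK1⟩
    | succ n ih =>
      have h1 := ih.1.mul_left hm hm1
      have h2 := hK.convolution h1.1
      refine ⟨h2.1, h2.2.trans ?_⟩
      rw [pow_succ' _ (n + 1)]
      exact mul_le_mul hK1 (h1.2.trans ih.2) (integral_nonneg fun _ => norm_nonneg _) (by norm_num)
  have hmF := fun n => (hF n).1.mul_left hm hm1
  have geo : HasSum (fun n : ℕ => ((1 : ℝ) / 3) ^ (n + 1)) (1 / 2) := by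
    have := (hasSum_geometric_of_lt_one (r := (1 : ℝ) / 3) (by norm_num) (by norm_num)).mul_left
      ((1 : ℝ) / 3)
    simp_rw [pow_succ']
    rwa [show (1 : ℝ) / 3 * (1 - 1 / 3)⁻¹ = 1 / 2 by norm_num] at this
  have s0 : Summable fun n => ∫ ξ, ‖F n ξ‖ :=
    geo.summable.of_nonneg_of_le (fun n => integral_nonneg fun _ => norm_nonneg _)
      fun n => (hF n).1.integral_norm_le.trans (hF n).2
  have hle : ∀ n, ∫ ξ, ‖m ξ * F n ξ‖ ≤ (1 / 3) ^ (n + 1) := fun n =>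
    (hmF n).1.integral_norm_le.trans ((hmF n).2.trans (hF n).2)
  have s1 : Summable fun n => ∫ ξ, ‖m ξ * F n ξ‖ :=
    geo.summable.of_nonneg_of_le (fun n => integral_nonneg fun _ => norm_nonneg _) hle
  have s2 : Summable fun n => ∫ ξ, ‖weight ξ • F n ξ‖ :=
    geo.summable.of_nonneg_of_le (fun n => integral_nonneg fun _ => norm_nonneg _)
      fun n => (hF n).2
  have hsum := hasSum_fourier (fun n => (hF n).1.integrable) s0
  have hsum' : ∀ z, HasSum (fun n => 𝓕 (fun ξ => m ξ * F n ξ) z)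
      (𝓕 (fun ξ => m ξ * ∑' n, F n ξ) z) := fun z => by
    simpa only [tsum_mul_left] using hasSum_fourier (fun n => (hmF n).1.integrable) s1 z
  refine ⟨fun ξ => ∑' n, F n ξ, ?_, fun z => ?_, ?_⟩
  · refine (integrable_tsum (fun n => (hF n).1) s2).congr (Filter.Eventually.of_forall fun ξ => ?_)
    exact tsum_const_smul'' _
  · have h1 : ∀ n, 𝓕 (F (n + 1)) z = 𝓕 K z * 𝓕 (fun ξ => m ξ * F n ξ) z := fun n =>
      Real.fourier_mul_convolution_eq hK.integrable (hmF n).1.integrable z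
    have h2 := (hsum z).summable.tsum_eq_zero_add
    rw [(hsum z).tsum_eq] at h2
    rw [h2]
    simp_rw [h1]
    rw [tsum_mul_left, (hsum' z).tsum_eq]
    change 𝓕 K z + _ = _
    ring
  · refine ((hsum' 0).norm_le_of_bounded geo fun n => ?_).trans_lt (by norm_num)
    rw [Real.fourier_eq]
    refine (norm_integral_le_integral_norm _).trans ?_
    simpa using hle n

end WeightedConvolution

/-! ### The Cauchy transform -/

section CauchyTransform

open MeasureTheory FourierTransform ComplexConjugate
open scoped Convolution

variable {ψ : ℂ → ℂ}

/-- The symbol of the Beurling transform `∂ ∂̄⁻¹` (with value `0` at the origin). -/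
def beurlingSymbol (ξ : ℂ) : ℂ := conj ξ / ξ

theorem measurable_beurlingSymbol : Measurable beurlingSymbol :=
  Complex.continuous_conj.measurable.div measurable_id

theorem norm_beurlingSymbol_le (ξ : ℂ) : ‖beurlingSymbol ξ‖ ≤ 1 := by
  rw [beurlingSymbol, norm_div, RCLike.norm_conj]
  exact div_self_le_one _

theorem WeightedIntegrable.contDiff_fourier (h : WeightedIntegrable ψ) : ContDiff ℝ 2 (𝓕 ψ) := by
  refine Real.contDiff_fourier (N := 2) fun n hn => ?_
  have hn : n ≤ 2 := by exact_mod_cast hn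
  refine h.mono h.aestronglyMeasurable (v := fun ξ => ‖ξ‖ ^ n) (fun ξ => ?_) (by fun_prop)
    fun _ => le_rfl
  rw [norm_pow, norm_norm, weight]
  have h0 := norm_nonneg ξ
  calc ‖ξ‖ ^ n ≤ (1 + ‖ξ‖) ^ n := by gcongr; linarith
    _ ≤ (1 + ‖ξ‖) ^ 2 := pow_le_pow_right₀ (by linarith) hn

/-- The real differential `v ↦ p v̄ + q v`. -/
def complexDifferential (p q : ℂ) : ℂ →L[ℝ] ℂ :=
  p • (Complex.conjCLE : ℂ →L[ℝ] ℂ) + q • ContinuousLinearMap.id ℝ ℂ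

theorem complexDifferential_apply (p q v : ℂ) :
    complexDifferential p q v = p * conj v + q * v := rfl

/-- A primitive of the form `Φ dz̄ + Ψ dz`, where `Φ` is the Fourier transform of `ψ` and `Ψ` its
Beurling transform. Subtracting `1` from the character makes the integral converge at `ξ = 0`
without any condition on `ψ`. -/
def cauchyTransform (ψ : ℂ → ℂ) (z : ℂ) : ℂ :=
  ∫ ξ, ((Real.fourierChar (-innerSL ℝ ξ z) : ℂ) - 1) * (ψ ξ / (-(Real.pi * Complex.I) * ξ))

theorem hasFDerivAt_cauchyTransform (h : WeightedIntegrable ψ) (z : ℂ) :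
    HasFDerivAt (cauchyTransform ψ)
      (complexDifferential (𝓕 ψ z) (𝓕 (fun ξ => beurlingSymbol ξ * ψ ξ) z)) z := by
  have hm := (h.mul_left measurable_beurlingSymbol norm_beurlingSymbol_le).1
  set G : ℂ → ℂ := fun ξ => ψ ξ / (-(Real.pi * Complex.I) * ξ) with hG
  have hGle : ∀ ξ, ‖ξ‖ * ‖G ξ‖ ≤ ‖ψ ξ‖ / Real.pi := fun ξ => by
    rw [hG]
    by_cases h0 : ξ = 0
    · simp only [h0, norm_zero, zero_mul]
      positivity
    · have : ‖ξ‖ ≠ 0 := norm_ne_zero_iff.2 h0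
      have := Real.pi_pos
      simp only [norm_div, norm_mul, norm_neg, Complex.norm_I, Complex.norm_real, Real.norm_eq_abs,
        abs_of_pos this]
      apply le_of_eq
      field_simp
  have hGm : AEStronglyMeasurable G :=
    (h.aestronglyMeasurable.aemeasurable.div
      (by fun_prop : Measurable fun ξ : ℂ =>
        -(Real.pi * Complex.I) * ξ).aemeasurable).aestronglyMeasurable
  have hem : ∀ z : ℂ, Continuous fun ξ : ℂ => (Real.fourierChar (-innerSL ℝ ξ z) : ℂ) := fun z => by
    simp only [innerSL_apply_apply]
    fun_prop
  let F' : ℂ → ℂ → ℂ →L[ℝ] ℂ := fun z ξ =>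
    G ξ • ((-2 * Real.pi * Complex.I * Real.fourierChar (-innerSL ℝ ξ z)) •
      (Complex.ofRealCLM ∘L innerSL ℝ ξ))
  have hF'm : AEStronglyMeasurable (F' z) := by
    refine hGm.smul (Continuous.aestronglyMeasurable ?_)
    refine ((continuous_const.mul (hem z))).smul ?_
    exact (ContinuousLinearMap.compL ℝ ℂ ℝ ℂ Complex.ofRealCLM).continuous.comp
      (innerSL ℝ).continuous
  have hF'b : ∀ w ξ, ‖F' w ξ‖ ≤ 2 * ‖ψ ξ‖ := fun w ξ => by
    have h2 : ‖Complex.ofRealCLM ∘L innerSL ℝ ξ‖ ≤ ‖ξ‖ := by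
      refine ContinuousLinearMap.opNorm_le_bound _ (norm_nonneg _) fun v => ?_
      rw [ContinuousLinearMap.comp_apply, Complex.ofRealCLM_apply, Complex.norm_real]
      exact norm_inner_le_norm ξ v
    simp only [F']
    rw [norm_smul, norm_smul]
    simp only [norm_mul, norm_neg, Complex.norm_I, Complex.norm_real, Real.norm_eq_abs,
      abs_of_pos Real.pi_pos, Circle.norm_coe, mul_one, Complex.norm_ofNat]
    calc _ ≤ ‖G ξ‖ * (2 * Real.pi * ‖ξ‖) := by gcongr
      _ = 2 * Real.pi * (‖ξ‖ * ‖G ξ‖) := by ring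
      _ ≤ 2 * Real.pi * (‖ψ ξ‖ / Real.pi) := by
        have := Real.pi_pos
        gcongr
        exact hGle ξ
      _ = 2 * ‖ψ ξ‖ := by
        have := Real.pi_pos
        field_simp
  have key : HasFDerivAt (cauchyTransform ψ) (∫ ξ, F' z ξ) z := by
    refine hasFDerivAt_integral_of_dominated_of_fderiv_le (F' := F')
      (bound := fun ξ => 2 * ‖ψ ξ‖) Filter.univ_mem ?_ ?_ hF'm ?_ (h.integrable.norm.const_mul 2) ?_
    · exact Filter.Eventually.of_forall fun w =>
        (((hem w).sub continuous_const).aestronglyMeasurable).mul hGm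
    · refine (h.integrable.norm.const_mul (2 * ‖z‖)).mono'
        ((((hem z).sub continuous_const).aestronglyMeasurable).mul hGm)
        (Filter.Eventually.of_forall fun ξ => ?_)
      have h1 : ‖(Real.fourierChar (-innerSL ℝ ξ z) : ℂ) - 1‖ ≤ 2 * Real.pi * (‖ξ‖ * ‖z‖) := by
        rw [Real.fourierChar_apply, mul_comm _ Complex.I]
        refine (Real.norm_exp_I_mul_ofReal_sub_one_le (x := 2 * Real.pi *
          (-innerSL ℝ ξ z))).trans ?_
        rw [norm_mul, norm_neg, norm_mul, Real.norm_eq_abs Real.pi, abs_of_pos Real.pi_pos,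
          Real.norm_ofNat]
        gcongr
        exact norm_inner_le_norm ξ z
      rw [norm_mul]
      calc _ ≤ 2 * Real.pi * (‖ξ‖ * ‖z‖) * ‖G ξ‖ := by gcongr
        _ = 2 * Real.pi * ‖z‖ * (‖ξ‖ * ‖G ξ‖) := by ring
        _ ≤ 2 * Real.pi * ‖z‖ * (‖ψ ξ‖ / Real.pi) := by
          have := Real.pi_pos
          gcongr
          exact hGle ξ
        _ = 2 * ‖z‖ * ‖ψ ξ‖ := by
          have := Real.pi_pos
          field_simp
    · exact Filter.Eventually.of_forall fun ξ w _ => hF'b w ξ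
    · refine Filter.Eventually.of_forall fun ξ w _ => ?_
      exact ((Real.hasFDerivAt_fourierChar_neg_bilinear_right
        (innerSL ℝ) ξ w).sub_const 1).mul_const
        (G ξ)
  convert key using 1
  have hF'i : Integrable (F' z) := (h.integrable.norm.const_mul 2).mono' hF'm
    (Filter.Eventually.of_forall fun ξ => hF'b z ξ)
  ext1 v
  rw [ContinuousLinearMap.integral_apply hF'i, complexDifferential_apply, Real.fourier_eq,
    Real.fourier_eq, ← integral_mul_const, ← integral_mul_const, ← integral_add]
  · refine integral_congr_ae ?_
    filter_upwards [compl_mem_ae_iff.2 (measure_singleton (0 : ℂ))] with ξ hξ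
    have hξ : ξ ≠ 0 := hξ
    have hre : (2 : ℂ) * (innerSL ℝ ξ v : ℝ) = ξ * conj v + conj ξ * v := by
      rw [innerSL_apply_apply, Complex.inner, Complex.re_eq_add_conj]
      simp
      ring
    have hpi : (Real.pi : ℂ) ≠ 0 := by exact_mod_cast Real.pi_ne_zero
    simp only [F', hG, beurlingSymbol, smul_apply, ContinuousLinearMap.comp_apply,
      Complex.ofRealCLM_apply, smul_eq_mul, Circle.smul_def]
    have h3 : ∀ e : ℂ, ψ ξ / (-(Real.pi * Complex.I) * ξ) * (-2 * Real.pi * Complex.I * e *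
        (innerSL ℝ ξ v : ℝ)) = e * ψ ξ / ξ * (2 * (innerSL ℝ ξ v : ℝ)) := fun e => by
      field_simp [Complex.I_ne_zero]
    rw [h3, hre]
    simp only [innerSL_apply_apply]
    field_simp
  · exact ((Real.fourierIntegral_convergent_iff z).2 h.integrable).mul_const _
  · exact ((Real.fourierIntegral_convergent_iff z).2 hm.integrable).mul_const _

theorem contDiff_cauchyTransform (h : WeightedIntegrable ψ) : ContDiff ℝ 3 (cauchyTransform ψ) := by
  have hm := (h.mul_left measurable_beurlingSymbol norm_beurlingSymbol_le).1
  refine (contDiff_succ_iff_hasFDerivAt (n := 2)).2 ⟨_, ?_, hasFDerivAt_cauchyTransform h⟩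
  unfold complexDifferential
  have h1 := h.contDiff_fourier
  have h2 := hm.contDiff_fourier
  exact (h1.smul contDiff_const).add (h2.smul contDiff_const)

end CauchyTransform

/-! ### The Beltrami equation -/

section Beltrami

open MeasureTheory FourierTransform ComplexConjugate

theorem exists_smooth_cutoff {μ : ℂ → ℂ} (hμ : ∀ᶠ z in 𝓝 (0 : ℂ), ContDiffAt ℝ ∞ μ z) :
    ∃ g : ℂ → ℂ, ContDiff ℝ ∞ g ∧ HasCompactSupport g ∧ g =ᶠ[𝓝 0] μ := by
  obtain ⟨r, hr, hball⟩ := Metric.eventually_nhds_iff_ball.1 hμ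
  let χ : ContDiffBump (0 : ℂ) := ⟨r / 4, r / 2, by positivity, by linarith⟩
  refine ⟨fun z => χ z • μ z, ?_, χ.hasCompactSupport.smul_right, ?_⟩
  · rw [contDiff_iff_contDiffAt]
    intro z
    by_cases hz : z ∈ Metric.ball (0 : ℂ) r
    · exact χ.contDiff.contDiffAt.smul (hball z hz)
    · have hz' : z ∉ tsupport χ := by
        rw [χ.tsupport_eq]
        intro h
        refine hz ?_
        have : dist z 0 ≤ r / 2 := h
        exact lt_of_le_of_lt this (by linarith)
      refine (contDiffAt_const (c := (0 : ℂ))).congr_of_eventuallyEq ?_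
      filter_upwards [notMem_tsupport_iff_eventuallyEq.1 hz'] with y hy
      rw [hy]
      simp
  · filter_upwards [χ.eventuallyEq_one] with z hz
    rw [hz]
    simp

/-- The derivatives of the rescaled functions `z ↦ χ(z) g(ε z)` are `O(ε)` if `g 0 = 0`. -/
theorem exists_bound_iteratedFDeriv_rescaled {g : ℂ → ℂ} (hg : ContDiff ℝ ∞ g)
    (hgc : HasCompactSupport g) (h0 : g 0 = 0) (χ : ContDiffBump (0 : ℂ)) (n : ℕ) :
    ∃ C, 0 ≤ C ∧ ∀ ε ∈ Ioc (0 : ℝ) 1, ∀ z,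
      ‖iteratedFDeriv ℝ n (fun z => (χ z : ℂ) * g (ε • z)) z‖ ≤ ε * C := by
  have hχ : ContDiff ℝ ∞ (fun z => (χ z : ℂ)) := Complex.ofRealCLM.contDiff.comp χ.contDiff
  have hχc : HasCompactSupport (fun z => (χ z : ℂ)) :=
    χ.hasCompactSupport.comp_left (g := fun x : ℝ => (x : ℂ)) Complex.ofReal_zero
  have bound : ∀ f : ℂ → ℂ, ContDiff ℝ ∞ f → HasCompactSupport f →
      ∃ B : ℕ → ℝ, ∀ n z, ‖iteratedFDeriv ℝ n f z‖ ≤ B n := fun f hf hfc => by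
    choose B hB using fun n : ℕ => (hfc.iteratedFDeriv (𝕜 := ℝ) n).exists_bound_of_continuous
      (hf.continuous_iteratedFDeriv (m := n) (by exact_mod_cast le_top))
    exact ⟨B, hB⟩
  obtain ⟨A, hA⟩ := bound _ hχ hχc
  obtain ⟨B, hB⟩ := bound _ hg hgc
  obtain ⟨L, hL⟩ := ContDiff.lipschitzWith_of_hasCompactSupport (𝕂 := ℝ) hgc hg (by simp)
  have hA0 : ∀ n, 0 ≤ A n := fun n => (norm_nonneg _).trans (hA n 0)
  have hB0 : ∀ n, 0 ≤ B n := fun n => (norm_nonneg _).trans (hB n 0)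
  let C : ℝ := ∑ i ∈ Finset.range (n + 1), (n.choose i : ℝ) * A i * (B (n - i) + L * χ.rOut)
  have hr := χ.rOut_pos
  refine ⟨C, Finset.sum_nonneg fun i _ => ?_, fun ε hε z => ?_⟩
  · have := hA0 i
    have := hB0 (n - i)
    positivity
  by_cases hz : z ∈ tsupport (fun z => (χ z : ℂ) * g (ε • z))
  · have hz' : ‖z‖ ≤ χ.rOut := by
      have h1 : z ∈ tsupport χ := by
        refine closure_mono (fun y hy => ?_) hz
        intro h
        exact hy (by simp [h])
      rw [χ.tsupport_eq] at h1
      simpa using h1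
    have hgε : ContDiff ℝ ∞ (fun z : ℂ => g (ε • z)) := hg.comp (contDiff_const_smul ε)
    refine (norm_iteratedFDeriv_mul_le hχ hgε z (n := n) (by exact_mod_cast le_top)).trans ?_
    rw [Finset.mul_sum]
    refine Finset.sum_le_sum fun i _ => ?_
    have key : ‖iteratedFDeriv ℝ (n - i) (fun z : ℂ => g (ε • z)) z‖ ≤
        ε * (B (n - i) + L * χ.rOut) := by
      have hε0 := hε.1.le
      have hB1 := hB0 (n - i)
      have hLr : 0 ≤ (L : ℝ) * χ.rOut := by positivity
      rw [iteratedFDeriv_comp_const_smul ε (contDiff_infty.1 hg (n - i)), norm_smul,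
        norm_pow, Real.norm_eq_abs, abs_of_nonneg hε0]
      rcases Nat.eq_zero_or_pos (n - i) with h | h
      · rw [h, pow_zero, one_mul, norm_iteratedFDeriv_zero]
        have h2 := hL.dist_le_mul (ε • z) 0
        rw [h0, dist_zero_right, dist_zero_right, norm_smul, Real.norm_eq_abs,
          abs_of_nonneg hε0] at h2
        rw [h] at hB1
        calc ‖g (ε • z)‖ ≤ L * (ε * ‖z‖) := h2
          _ ≤ L * (ε * χ.rOut) := by gcongr
          _ ≤ ε * (B 0 + L * χ.rOut) := by nlinarith [mul_nonneg hε0 hB1]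
      · calc ε ^ (n - i) * ‖iteratedFDeriv ℝ (n - i) g (ε • z)‖ ≤ ε ^ 1 * B (n - i) :=
              mul_le_mul (pow_le_pow_of_le_one hε0 hε.2 h) (hB _ _) (norm_nonneg _) (by positivity)
          _ ≤ _ := by
            rw [pow_one]
            gcongr
            linarith
    have h1 := hA i z
    have h2 := hA0 i
    calc _ ≤ (n.choose i : ℝ) * A i * (ε * (B (n - i) + L * χ.rOut)) := by gcongr
      _ = _ := by ring
  · have h1 : iteratedFDeriv ℝ n (fun z => (χ z : ℂ) * g (ε • z)) z = 0 := by
      by_contra h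
      exact hz (support_iteratedFDeriv_subset n h)
    rw [h1, norm_zero]
    refine mul_nonneg hε.1.le (Finset.sum_nonneg fun i _ => ?_)
    have := hA0 i
    have := hB0 (n - i)
    positivity

/-- Decay of order five suffices for integrability against the weight, since `(1 + |ξ|) ^ (-3)` is
integrable over the plane. -/
theorem weighted_bound_of_pow_bound {f : ℂ → ℂ} {D : ℝ} (h0 : ∀ ξ, ‖f ξ‖ ≤ D)
    (h5 : ∀ ξ, ‖ξ‖ ^ 5 * ‖f ξ‖ ≤ D) (ξ : ℂ) :
    weight ξ * ‖f ξ‖ ≤ 32 * D * (1 + ‖ξ‖) ^ (-3 : ℝ) := by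
  have hx := norm_nonneg ξ
  have h1 : 0 < 1 + ‖ξ‖ := by positivity
  have h2 : (1 + ‖ξ‖) ^ 5 * ‖f ξ‖ ≤ 32 * D := by
    have h3 : (1 + ‖ξ‖) ^ 5 ≤ 16 * (1 + ‖ξ‖ ^ 5) := by
      have := add_pow_le (zero_le_one) hx 5
      norm_num at this
      linarith
    calc _ ≤ 16 * (1 + ‖ξ‖ ^ 5) * ‖f ξ‖ := by gcongr
      _ ≤ _ := by linarith [h0 ξ, h5 ξ]
  rw [Real.rpow_neg h1.le, weight, ← div_eq_mul_inv, le_div_iff₀ (by positivity)]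
  rw [show (3 : ℝ) = ((3 : ℕ) : ℝ) by norm_num, Real.rpow_natCast]
  calc _ = (1 + ‖ξ‖) ^ 5 * ‖f ξ‖ := by ring
    _ ≤ _ := h2

/-- A smooth function vanishing at the origin agrees, after rescaling, on the unit disc with the
Fourier transform of a function which is small in the weighted `L¹` space. -/
theorem exists_small_fourier {μ : ℂ → ℂ} (hμ : ∀ᶠ z in 𝓝 (0 : ℂ), ContDiffAt ℝ ∞ μ z)
    (h0 : μ 0 = 0) {δ : ℝ} (hδ : 0 < δ) : ∃ ε : ℝ, 0 < ε ∧ ∃ K, WeightedIntegrable K ∧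
      weightedNorm K ≤ δ ∧ ∀ z ∈ Metric.ball (0 : ℂ) 1, 𝓕 K z = μ (ε • z) := by
  obtain ⟨g, hg, hgc, hgμ⟩ := exists_smooth_cutoff hμ
  have hg0 : g 0 = 0 := hgμ.self_of_nhds.trans h0
  obtain ⟨r, hr, hball⟩ := Metric.eventually_nhds_iff_ball.1 hgμ
  let χ : ContDiffBump (0 : ℂ) := ⟨1, 2, one_pos, one_lt_two⟩
  choose C hC0 hC using exists_bound_iteratedFDeriv_rescaled hg hgc hg0 χ
  let V : ℝ := volume.real (Metric.closedBall (0 : ℂ) 2)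
  let S : ℝ := ∑ q ∈ Finset.range 6, C q * V
  have hS : 0 ≤ S := Finset.sum_nonneg fun q _ => mul_nonneg (hC0 q) measureReal_nonneg
  let T : ℝ := ∫ ξ : ℂ, (1 + ‖ξ‖) ^ (-3 : ℝ)
  have hTi : Integrable fun ξ : ℂ => (1 + ‖ξ‖) ^ (-3 : ℝ) :=
    integrable_one_add_norm (by rw [Complex.finrank_real_complex]; norm_num)
  have hT : 0 ≤ T := integral_nonneg fun ξ => by positivity
  obtain ⟨ε, hε0, hε1, hεr, hεδ⟩ : ∃ ε : ℝ, 0 < ε ∧ ε ≤ 1 ∧ ε ≤ r ∧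
      32 * (32 * (ε * S)) * T ≤ δ := by
    refine ⟨min (min 1 r) (δ / (1024 * S * T + 1)), by positivity,
      (min_le_left _ _).trans (min_le_left _ _), (min_le_left _ _).trans (min_le_right _ _), ?_⟩
    have hP : 0 < 1024 * S * T + 1 := by positivity
    calc _ = min (min 1 r) (δ / (1024 * S * T + 1)) * (1024 * S * T) := by ring
      _ ≤ δ / (1024 * S * T + 1) * (1024 * S * T + 1) :=
        mul_le_mul (min_le_right _ _) (by linarith) (by positivity) (by positivity)
      _ = δ := by field_simp
  let G : ℂ → ℂ := fun z => (χ z : ℂ) * g (ε • z)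
  have hχ : ContDiff ℝ ∞ (fun z => (χ z : ℂ)) := Complex.ofRealCLM.contDiff.comp χ.contDiff
  have hG : ContDiff ℝ ∞ G := hχ.mul (hg.comp (contDiff_const_smul ε))
  have hGc : HasCompactSupport G := HasCompactSupport.mul_right
    (χ.hasCompactSupport.comp_left (g := fun x : ℝ => (x : ℂ)) Complex.ofReal_zero)
  have hGs : tsupport G ⊆ Metric.closedBall (0 : ℂ) 2 := by
    rw [← show tsupport χ = Metric.closedBall (0 : ℂ) 2 from χ.tsupport_eq]
    refine closure_mono fun y hy h => hy ?_
    simp [G, h]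
  have hint : ∀ q, ∫ v, ‖v‖ ^ 0 * ‖iteratedFDeriv ℝ q G v‖ ≤ ε * (C q * V) := fun q => by
    simp only [pow_zero, one_mul]
    have hi : Integrable ((Metric.closedBall (0 : ℂ) 2).indicator fun _ => ε * C q) :=
      (integrable_indicator_iff measurableSet_closedBall).2
        (integrableOn_const (isCompact_closedBall _ _).measure_lt_top.ne)
    refine (integral_mono_of_nonneg (Filter.Eventually.of_forall fun _ => norm_nonneg _) hi
      (Filter.Eventually.of_forall fun v => ?_)).trans_eq ?_
    · by_cases hv : v ∈ Metric.closedBall (0 : ℂ) 2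
      · rw [indicator_of_mem hv]
        exact hC q ε ⟨hε0, hε1⟩ v
      · rw [indicator_of_notMem hv]
        by_contra h
        refine hv (hGs (support_iteratedFDeriv_subset (𝕜 := ℝ) q fun h' => h ?_))
        exact (norm_eq_zero.2 h').le
    · rw [integral_indicator_const _ measurableSet_closedBall, smul_eq_mul]
      ring
  have hpow : ∀ n ≤ 5, ∀ ξ, ‖ξ‖ ^ n * ‖𝓕 G ξ‖ ≤ 32 * (ε * S) := fun n hn ξ => by
    have h1 := Real.pow_mul_norm_iteratedFDeriv_fourier_le (K := 0) (N := 5) (f := G)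
      (contDiff_infty.1 hG 5) (fun k n hk _ => by
        have hk0 : k = 0 := by simpa using hk
        subst hk0
        simp only [pow_zero, one_mul]
        exact ((contDiff_infty.1 hG n).continuous_iteratedFDeriv
          le_rfl).norm.integrable_of_hasCompactSupport
          (hGc.iteratedFDeriv n).norm)
      (k := 0) (n := n) le_rfl (by exact_mod_cast hn) ξ
    rw [norm_iteratedFDeriv_zero] at h1
    refine h1.trans ?_
    rw [Finset.sum_product, Finset.sum_range_one]
    have h2 : ∑ q ∈ Finset.range (n + 1), ∫ v, ‖v‖ ^ 0 * ‖iteratedFDeriv ℝ q G v‖ ≤ ε * S := by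
      rw [Finset.mul_sum]
      refine (Finset.sum_le_sum fun q _ => hint q).trans ?_
      exact Finset.sum_le_sum_of_subset_of_nonneg (Finset.range_subset_range.2 (by omega))
        fun q _ _ => mul_nonneg hε0.le (mul_nonneg (hC0 q) measureReal_nonneg)
    have h3 : (2 : ℝ) ^ n ≤ 32 := by
      calc (2 : ℝ) ^ n ≤ 2 ^ 5 := pow_le_pow_right₀ one_le_two hn
        _ = 32 := by norm_num
    simp only [pow_zero, one_mul, Nat.cast_zero, mul_zero, zero_add]
    simp only [pow_zero, one_mul] at h2
    exact mul_le_mul h3 h2 (Finset.sum_nonneg fun q _ => integral_nonneg fun _ => norm_nonneg _)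
      (by norm_num)
  -- `K` is the inverse Fourier transform of `G`
  let K : ℂ → ℂ := fun ξ => 𝓕 G (-ξ)
  have hK := weighted_bound_of_pow_bound (f := K) (D := 32 * (ε * S))
    (fun ξ => by simpa using hpow 0 (by norm_num) (-ξ))
    (fun ξ => by simpa using hpow 5 (by norm_num) (-ξ))
  have hGi : Integrable G := hG.continuous.integrable_of_hasCompactSupport hGc
  have hFc : Continuous (𝓕 G) := (Real.contDiff_fourier (N := 0) fun n hn => by
    have hn0 : n = 0 := by simpa using hn
    subst hn0
    simpa using hGi.norm).continuous
  have hKm : AEStronglyMeasurable K := (hFc.comp continuous_neg).aestronglyMeasurable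
  have hKw : WeightedIntegrable K := by
    refine weightedIntegrable_iff.2 ⟨hKm, (hTi.const_mul (32 * (32 * (ε * S)))).mono'
      (continuous_weight.aestronglyMeasurable.mul hKm.norm) (Filter.Eventually.of_forall fun ξ =>
        ?_)⟩
    rw [norm_mul, norm_norm, Real.norm_eq_abs, abs_of_pos (weight_pos ξ)]
    exact hK ξ
  refine ⟨ε, hε0, K, hKw, ?_, fun z hz => ?_⟩
  · rw [weightedNorm_eq]
    refine (integral_mono (weightedIntegrable_iff.1 hKw).2 (hTi.const_mul _) hK).trans ?_
    rw [integral_const_mul]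
    exact hεδ
  · have h1 : K = 𝓕⁻ G := by
      ext ξ
      rw [Real.fourierInv_eq_fourier_neg]
    rw [h1, hG.continuous.fourier_fourierInv_eq hGi]
    · have h2 : χ z = 1 := χ.one_of_mem_closedBall (Metric.ball_subset_closedBall hz)
      simp only [G, h2, Complex.ofReal_one, one_mul]
      refine hball _ ?_
      rw [mem_ball_zero_iff] at hz ⊢
      rw [norm_smul, Real.norm_eq_abs, abs_of_pos hε0]
      calc ε * ‖z‖ < ε * 1 := by gcongr
        _ ≤ r := by linarith
    · simpa [K] using hKw.integrable.comp_neg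

/-- Local solvability of the Beltrami equation `f_z̄ = μ f_z` with smooth coefficient `μ`. After
rescaling, `f z = z + cauchyTransform ψ z` solves it if `Φ = f_z̄` satisfies `Φ = μ (1 + S Φ)`,
where `S` is the Beurling transform. -/
theorem exists_beltrami {μ : ℂ → ℂ} (hμ : ∀ᶠ z in 𝓝 (0 : ℂ), ContDiffAt ℝ ∞ μ z) (h0 : μ 0 = 0) :
    ∃ (f a : ℂ → ℂ), ContDiff ℝ 3 f ∧ a 0 ≠ 0 ∧
      ∀ᶠ z in 𝓝 (0 : ℂ), ∀ v, fderiv ℝ f z v = a z * (v + μ z * conj v) := by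
  obtain ⟨ε, hε, K, hK, hKδ, hKμ⟩ := exists_small_fourier hμ h0 (δ := 1 / 3) (by norm_num)
  obtain ⟨ψ, hψ, hψK, hψ1⟩ := exists_neumann hK hKδ measurable_beurlingSymbol norm_beurlingSymbol_le
  set Ψ := 𝓕 (fun ξ => beurlingSymbol ξ * ψ ξ)
  let h : ℂ → ℂ := fun z => z + cauchyTransform ψ z
  have hh : ContDiff ℝ 3 h := contDiff_id.add (contDiff_cauchyTransform hψ)
  have hd : ∀ z, HasFDerivAt h (ContinuousLinearMap.id ℝ ℂ + complexDifferential (𝓕 ψ z) (Ψ z)) z :=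
    fun z => (hasFDerivAt_id z).add (hasFDerivAt_cauchyTransform hψ z)
  refine ⟨fun z => h (ε⁻¹ • z), fun z => ε⁻¹ * (1 + Ψ (ε⁻¹ • z)), hh.comp (contDiff_const_smul _),
    ?_, ?_⟩
  · refine mul_ne_zero (by simpa using hε.ne') fun h1 => ?_
    rw [smul_zero, add_comm] at h1
    rw [eq_neg_of_add_eq_zero_left h1, norm_neg, norm_one] at hψ1
    exact lt_irrefl _ hψ1
  · filter_upwards [Metric.ball_mem_nhds (0 : ℂ) hε] with z hz v
    have hz' : ε⁻¹ • z ∈ Metric.ball (0 : ℂ) 1 := by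
      rw [mem_ball_zero_iff] at hz ⊢
      rw [norm_smul, norm_inv, Real.norm_eq_abs, abs_of_pos hε, inv_mul_lt_one₀ hε]
      exact hz
    have h1 := (hd (ε⁻¹ • z)).comp z ((hasFDerivAt_id z).const_smul ε⁻¹)
    have h2 : fderiv ℝ (fun z => h (ε⁻¹ • z)) z = _ := h1.fderiv
    rw [h2]
    simp only [ContinuousLinearMap.comp_apply, smul_apply, add_apply,
      ContinuousLinearMap.id_apply, complexDifferential_apply, hψK, hKμ _ hz']
    rw [smul_smul, mul_inv_cancel₀ hε.ne', one_smul]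
    simp only [Complex.real_smul, map_mul, Complex.ofReal_inv]
    rw [map_inv₀, Complex.conj_ofReal]
    ring

end Beltrami

/-! ### Isothermal coordinates -/

section Isothermal

open ComplexConjugate

variable {E : Type*} [NormedAddCommGroup E] [NormedSpace ℝ E] [FiniteDimensional ℝ E]
  {H : Type*} [TopologicalSpace H] (I : ModelWithCorners ℝ E H) [I.Boundaryless]
  {M : Type*} [TopologicalSpace M] [ChartedSpace H M] [IsManifold I ∞ M]
  [RiemannianBundle (fun x : M => TangentSpace I x)]
  [IsContMDiffRiemannianBundle I ∞ E (fun x : M => TangentSpace I x)]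

theorem mvfderiv_comp_fderiv {F G : Type*} [NormedAddCommGroup F] [NormedSpace ℝ F]
    [NormedAddCommGroup G] [NormedSpace ℝ G] {ζ : M → F} {g : F → G} {y : M}
    (hg : DifferentiableAt ℝ g (ζ y)) (hζ : MDifferentiableAt I 𝓘(ℝ, F) ζ y)
      (v : TangentSpace I y) :
    d% (fun y => g (ζ y)) y v = fderiv ℝ g (ζ y) (d% ζ y v) := by
  have h := mfderiv_comp_apply (I' := 𝓘(ℝ, F)) (I'' := 𝓘(ℝ, G)) y hg.mdifferentiableAt hζ v
  rw [mfderiv_eq_fderiv] at h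
  exact h

/-- A linear map of the chart domain which takes a given frame at `x` to `(1, i)`. -/
theorem exists_linearCoordinate {e : Fin 2 → Π x : M, TangentSpace I x} {W : Set M}
    (he : IsOrthonormalFrameOn I ∞ e W) {x : M} (hx : x ∈ W) :
    ∃ Λ : E ≃L[ℝ] ℂ, ∀ i,
      Λ (mfderiv I 𝓘(ℝ, E) (extChartAt I x) x (e i x)) = Complex.basisOneI i := by
  obtain ⟨D, hD⟩ := isInvertible_mfderiv_extChartAt (I := I) (mem_extChartAt_source (I := I) x)
  let B : Module.Basis (Fin 2) ℝ E := (he.basisAt hx).toBasis.map D.toLinearEquiv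
  have hB : ∀ i, B i = mfderiv I 𝓘(ℝ, E) (extChartAt I x) x (e i x) := fun i => by
    rw [← hD, ← he.basisAt_apply hx i]
    exact congrArg D (by simp)
  refine ⟨(B.equiv Complex.basisOneI (Equiv.refl _)).toContinuousLinearEquiv, fun i => ?_⟩
  rw [← hB]
  exact B.equiv_apply i Complex.basisOneI (Equiv.refl _)

/-- A complex coordinate in which a given frame is `(1, i)` at the origin. -/
theorem exists_complexCoordinate {e : Fin 2 → Π x : M, TangentSpace I x} {W : Set M}
    (he : IsOrthonormalFrameOn I ∞ e W) {x : M} (hx : x ∈ W) :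
    ∃ (ζ : M → ℂ) (σ : ℂ → M), ζ x = 0 ∧ σ 0 = x ∧ (∀ᶠ y in 𝓝 x, ContMDiffAt I 𝓘(ℝ, ℂ) ∞ ζ y) ∧
      (∀ᶠ z in 𝓝 (0 : ℂ), ContMDiffAt 𝓘(ℝ, ℂ) I ∞ σ z) ∧ (∀ᶠ y in 𝓝 x, σ (ζ y) = y) ∧
      d% ζ x (e 0 x) = 1 ∧ d% ζ x (e 1 x) = Complex.I := by
  obtain ⟨Λ, hΛ⟩ := exists_linearCoordinate I he hx
  set φ := extChartAt I x
  have hΛc : ContDiff ℝ ∞ (fun w : E => Λ (w - φ x)) := Λ.contDiff.comp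
    (contDiff_id.sub contDiff_const)
  have hder : ∀ i, d% (fun y => Λ (φ y - φ x)) x (e i x) = Complex.basisOneI i := fun i => by
    have h1 : MDifferentiableAt I 𝓘(ℝ, E) φ x := mdifferentiableAt_extChartAt (by simp)
    have h2 : HasFDerivAt (fun w : E => Λ (w - φ x)) (Λ : E →L[ℝ] ℂ) (φ x) :=
      (Λ : E →L[ℝ] ℂ).hasFDerivAt.comp (φ x) ((hasFDerivAt_id (φ x)).sub_const (φ x))
    rw [mvfderiv_comp_fderiv I (g := fun w : E => Λ (w - φ x)) h2.differentiableAt h1, h2.fderiv]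
    exact hΛ i
  refine ⟨fun y => Λ (φ y - φ x), fun z => φ.symm (Λ.symm z + φ x), by simp, ?_, ?_, ?_, ?_, ?_, ?_⟩
  · simp [φ]
  · filter_upwards [(chartAt H x).open_source.mem_nhds (mem_chart_source H x)] with y hy
    exact hΛc.contMDiff.contMDiffAt.comp y (contMDiffAt_extChartAt' hy)
  · have hc : ContDiff ℝ ∞ (fun z : ℂ => Λ.symm z + φ x) := Λ.symm.contDiff.add contDiff_const
    have h0 : φ.target ∈ 𝓝 (Λ.symm 0 + φ x) := by
      rw [map_zero, zero_add]
      exact extChartAt_target_mem_nhds (I := I) x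
    filter_upwards [hc.continuous.continuousAt.eventually (eventually_mem_nhds_iff.2 h0)] with z hz
    exact ((contMDiffOn_extChartAt_symm (I := I) (n := ∞) x).contMDiffAt hz).comp z
      hc.contMDiff.contMDiffAt
  · filter_upwards [extChartAt_source_mem_nhds (I := I) x] with y hy
    simp [φ.left_inv hy]
  · simpa using hder 0
  · simpa using hder 1

/-- Existence of isothermal coordinates: the Cauchy-Riemann equations in an orthonormal frame have
local solutions with non-vanishing differential. -/
theorem exists_isothermal {e : Fin 2 → Π x : M, TangentSpace I x} {W : Set M}
    (he : IsOrthonormalFrameOn I ∞ e W) {x : M} (hx : x ∈ W) :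
    ∃ u v : M → ℝ, ∀ᶠ y in 𝓝 x, CMDiffAt 3 u y ∧ CMDiffAt 3 v y ∧
      d% v y (e 0 y) = -d% u y (e 1 y) ∧ d% v y (e 1 y) = d% u y (e 0 y) ∧
      (d% u y (e 0 y) ≠ 0 ∨ d% u y (e 1 y) ≠ 0) := by
  obtain ⟨ζ, σ, hζ0, hσ0, hζ, hσ, hσζ, h0, h1⟩ := exists_complexCoordinate I he hx
  -- the components of the frame in the complex coordinate
  let Z : Fin 2 → M → ℂ := fun i y => d% ζ y (e i y)
  have hZ : ∀ᶠ y in 𝓝 x, ∀ i, ContMDiffAt I 𝓘(ℝ, ℂ) ∞ (Z i) y := by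
    filter_upwards [hζ, he.isOpen.mem_nhds hx] with y hy hyW i
    exact contMDiffAt_mvfderiv_apply I hy (he.contMDiffAt i y hyW) (by simp)
  have hden0 : conj (Z 0 x) + Complex.I * conj (Z 1 x) ≠ 0 := by
    simp [Z, h0, h1]
  have hne : ∀ᶠ y in 𝓝 x, conj (Z 0 y) + Complex.I * conj (Z 1 y) ≠ 0 := by
    have h2 := fun i => (hZ.self_of_nhds i).continuousAt
    exact ((Complex.continuous_conj.continuousAt.comp (h2 0)).add
      (continuousAt_const.mul (Complex.continuous_conj.continuousAt.comp
        (h2 1)))).eventually_ne hden0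
  -- the Beltrami coefficient for which `Z 0 + ν conj (Z 0) = -i (Z 1 + ν conj (Z 1))`
  let ν : M → ℂ := fun y => -(Z 0 y + Complex.I * Z 1 y) / (conj (Z 0 y) + Complex.I * conj (Z 1 y))
  have hν : ∀ᶠ y in 𝓝 x, ContMDiffAt I 𝓘(ℝ, ℂ) ∞ ν y := by
    filter_upwards [hZ, hne] with y hy hy0
    have hconj : ContDiff ℝ ∞ (fun z : ℂ => conj z) := Complex.conjCLE.contDiff
    have h2 : ContDiffAt ℝ ∞ (fun w : ℂ × ℂ =>
        -(w.1 + Complex.I * w.2) / (conj w.1 + Complex.I * conj w.2)) (Z 0 y, Z 1 y) := by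
      simp only [div_eq_mul_inv]
      have h3 : ContDiff ℝ ∞ (fun w : ℂ × ℂ => conj w.1 + Complex.I * conj w.2) :=
        (hconj.comp contDiff_fst).add (contDiff_const.mul (hconj.comp contDiff_snd))
      have h4 : ContDiff ℝ ∞ (fun w : ℂ × ℂ => -(w.1 + Complex.I * w.2)) :=
        (contDiff_fst.add (contDiff_const.mul contDiff_snd)).neg
      exact h4.contDiffAt.mul (ContDiffAt.inv h3.contDiffAt hy0)
    exact h2.contMDiffAt.comp y ((hy 0).prodMk_space (hy 1))
  have hσc : Filter.Tendsto σ (𝓝 0) (𝓝 x) := by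
    have := hσ.self_of_nhds.continuousAt.tendsto
    rwa [hσ0] at this
  have hζc : Filter.Tendsto ζ (𝓝 x) (𝓝 0) := by
    have := hζ.self_of_nhds.continuousAt.tendsto
    rwa [hζ0] at this
  obtain ⟨f, a, hf, ha0, hfa⟩ := exists_beltrami (μ := fun z => ν (σ z)) (by
    filter_upwards [hσ, hσc.eventually hν] with z hz hz'
    exact (ContMDiffAt.comp z hz' hz).contDiffAt) (by
    simp [hσ0, ν, Z, h0, h1])
  have hh : ∀ᶠ y in 𝓝 x, ∀ i, d% (fun y => f (ζ y)) y (e i y) =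
      a (ζ y) * (Z i y + ν y * conj (Z i y)) := by
    filter_upwards [hζ, hζc.eventually hfa, hσζ] with y hy hfy hσy i
    rw [mvfderiv_comp_fderiv I (hf.differentiable (by norm_num)).differentiableAt
      (hy.mdifferentiableAt (by simp)), hfy, hσy]
  have hdiff : ∀ᶠ y in 𝓝 x, ContMDiffAt I 𝓘(ℝ, ℂ) 3 (fun y => f (ζ y)) y := by
    filter_upwards [hζ] with y hy
    exact hf.contMDiff.contMDiffAt.comp y (hy.of_le three_le_infty)
  have hnz : ∀ᶠ y in 𝓝 x, d% (fun y => f (ζ y)) y (e 0 y) ≠ 0 := by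
    have hc : ContinuousAt (fun y => d% (fun y => f (ζ y)) y (e 0 y)) x :=
      (contMDiffAt_mvfderiv_apply I (n := 0) hdiff.self_of_nhds
        ((he.contMDiffAt 0 x hx).of_le (by simp)) (by norm_num)).continuousAt
    refine hc.eventually_ne ?_
    rw [hh.self_of_nhds]
    simp [ν, Z, h0, h1, hζ0, ha0]
  refine ⟨fun y => (f (ζ y)).re, fun y => (f (ζ y)).im, ?_⟩
  filter_upwards [hh, hdiff, hnz, hne] with y hy hd hz hny
  have hre : ∀ w, d% (fun y => (f (ζ y)).re) y w = (d% (fun y => f (ζ y)) y w).re := fun w => by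
    rw [mvfderiv_comp_fderiv I (ζ := fun y => f (ζ y)) (g := fun z : ℂ => z.re)
      Complex.reCLM.differentiableAt (hd.mdifferentiableAt (by norm_num))]
    exact congrArg (fun L : ℂ →L[ℝ] ℝ => L _) Complex.reCLM.fderiv
  have him : ∀ w, d% (fun y => (f (ζ y)).im) y w = (d% (fun y => f (ζ y)) y w).im := fun w => by
    rw [mvfderiv_comp_fderiv I (ζ := fun y => f (ζ y)) (g := fun z : ℂ => z.im)
      Complex.imCLM.differentiableAt (hd.mdifferentiableAt (by norm_num))]
    exact congrArg (fun L : ℂ →L[ℝ] ℝ => L _) Complex.imCLM.fderiv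
  have hCR : d% (fun y => f (ζ y)) y (e 0 y) + Complex.I * d% (fun y => f (ζ y)) y (e 1 y) = 0 := by
    have hν' : ν y * (conj (Z 0 y) + Complex.I * conj (Z 1 y)) = -(Z 0 y + Complex.I * Z 1 y) :=
      div_mul_cancel₀ _ hny
    rw [hy, hy]
    linear_combination a (ζ y) * hν'
  have c1 := congrArg Complex.re hCR
  have c2 := congrArg Complex.im hCR
  simp only [Complex.add_re, Complex.add_im, Complex.mul_re, Complex.mul_im, Complex.I_re,
    Complex.I_im, zero_mul, one_mul, zero_sub, zero_add, Complex.zero_re, Complex.zero_im] at c1 c2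
  refine ⟨Complex.reCLM.contDiff.contMDiff.contMDiffAt.comp y hd,
    Complex.imCLM.contDiff.contMDiff.contMDiffAt.comp y hd, ?_, ?_, ?_⟩
  · rw [him, hre]
    linarith
  · rw [him, hre]
    linarith
  · rw [hre, hre]
    by_contra! h
    refine hz (Complex.ext h.1 ?_)
    simp only [Complex.zero_im]
    linarith

end Isothermal

/-! ### Holomorphic coordinates and harmonic morphisms -/

section ConjugateHarmonic

/-- The rotation by `π/2` takes the first member of a positive orthonormal basis to the second. -/
theorem rightAngleRotation_basis {V : Type*} [NormedAddCommGroup V] [InnerProductSpace ℝ V]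
    [Fact (Module.finrank ℝ V = 2)] (b : OrthonormalBasis (Fin 2) ℝ V) :
    b.toBasis.orientation.rightAngleRotation (b 0) = b 1 := by
  refine InnerProductSpace.ext_inner_left_basis b.toBasis fun i => ?_
  have h : ⟪b.toBasis i, b 1⟫ = if i = 1 then (1 : ℝ) else 0 := by
    simpa using orthonormal_iff_ite.1 b.orthonormal i 1
  rw [h, real_inner_comm, Orientation.inner_rightAngleRotation_left]
  fin_cases i
  · simp
  · rw [Orientation.areaForm_to_volumeForm, Orientation.volumeForm_robust _ b rfl]
    have : (![b 0, b 1] : Fin 2 → V) = b.toBasis := by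
      ext j; fin_cases j <;> simp
    simpa [this] using b.toBasis.det_self

variable {N : Type*} [TopologicalSpace N] [ChartedSpace (EuclideanSpace ℝ (Fin 2)) N]
  [IsManifold (𝓡 2) ∞ N] [RiemannianBundle (fun y : N => TangentSpace (𝓡 2) y)]
  [IsContMDiffRiemannianBundle (𝓡 2) ∞ (EuclideanSpace ℝ (Fin 2))
    (fun y : N => TangentSpace (𝓡 2) y)]

/-- Every point of an oriented surface has a neighbourhood with a coordinate `u + i v` which is
holomorphic, that is, `j (grad u) = grad v`. -/
theorem exists_holomorphicCoordinate {oN : ∀ y : N, Orientation ℝ (TangentSpace (𝓡 2) y) (Fin 2)}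
    (hoN : IsOrientationOn (𝓡 2) oN univ) (z : N) :
    ∃ u v : N → ℝ, ∀ᶠ y in 𝓝 z, ContMDiffAt (𝓡 2) 𝓘(ℝ, ℝ) 3 u y ∧ ContMDiffAt (𝓡 2) 𝓘(ℝ, ℝ) 3 v y ∧
      grad (𝓡 2) u y ≠ 0 ∧ surfaceJ oN y (grad (𝓡 2) u y) = grad (𝓡 2) v y := by
  obtain ⟨W, e₀, hz, he₀⟩ := exists_orthonormalFrame_fin (𝓡 2) (d := 2)
    (finrank_euclideanSpace_fin (𝕜 := ℝ)) z
  obtain ⟨e, he, -, hor⟩ := exists_oriented_frame (𝓡 2) he₀ hoN hz (mem_univ z) 1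
  obtain ⟨u, v, huv⟩ := exists_isothermal (𝓡 2) he hz
  refine ⟨u, v, ?_⟩
  filter_upwards [huv, hor, he.isOpen.mem_nhds hz] with y ⟨hu, hv, h0, h1, h2⟩ hy hyW
  refine ⟨hu, hv, fun h => ?_, ?_⟩
  · rw [← inner_grad, ← inner_grad, h] at h2
    simp at h2
  · set b := he.basisAt hyW
    have hb : ∀ i, b i = e i y := he.basisAt_apply hyW
    have r0 : surfaceJ oN y (b 0) = b 1 := by
      rw [surfaceJ, ← hy hyW]
      exact rightAngleRotation_basis b
    have r1 : surfaceJ oN y (b 1) = -b 0 := by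
      rw [← r0]
      exact Orientation.rightAngleRotation_rightAngleRotation _ _
    have hu' := b.sum_repr' (grad (𝓡 2) u y)
    have hv' := b.sum_repr' (grad (𝓡 2) v y)
    simp only [Fin.sum_univ_two, real_inner_comm (grad (𝓡 2) _ y), inner_grad, hb] at hu' hv'
    have hadd : ∀ (α β : ℝ) (p q : TangentSpace (𝓡 2) y), surfaceJ oN y (α • p + β • q) =
        α • surfaceJ oN y p + β • surfaceJ oN y q := fun α β p q => by
      simp [surfaceJ]
    rw [← hu', ← hv', ← hb, ← hb, hadd, r0, r1, hb, hb, h0, h1]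
    module

end ConjugateHarmonic

section PullBack

variable {EM : Type*} [NormedAddCommGroup EM] [NormedSpace ℝ EM] [FiniteDimensional ℝ EM]
  {HM : Type*} [TopologicalSpace HM] {IM : ModelWithCorners ℝ EM HM} [IM.Boundaryless]
  {M : Type*} [TopologicalSpace M] [ChartedSpace HM M] [IsManifold IM ∞ M]
  [RiemannianBundle (fun x : M => TangentSpace IM x)]
  [IsContMDiffRiemannianBundle IM ∞ EM (fun x : M => TangentSpace IM x)]
  {EN : Type*} [NormedAddCommGroup EN] [NormedSpace ℝ EN] [FiniteDimensional ℝ EN]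
  {HN : Type*} [TopologicalSpace HN] {IN : ModelWithCorners ℝ EN HN} [IN.Boundaryless]
  {N : Type*} [TopologicalSpace N] [ChartedSpace HN N] [IsManifold IN ∞ N]
  [RiemannianBundle (fun x : N => TangentSpace IN x)]
  [IsContMDiffRiemannianBundle IN ∞ EN (fun x : N => TangentSpace IN x)]

theorem laplacian_sq_sub_sq {a b : M → ℝ} {x : M} (ha : CMDiffAt 2 a x) (hb : CMDiffAt 2 b x) :
    laplacian IM (fun y => a y * a y + -1 * (b y * b y)) x =
      2 * (a x * laplacian IM a x - b x * laplacian IM b x) +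
        2 * (⟪grad IM a x, grad IM a x⟫ - ⟪grad IM b x, grad IM b x⟫) := by
  rw [laplacian_add IM (f := fun y => a y * a y) (h := fun y => -1 * (b y * b y)) (ha.mul ha)
    (contMDiffAt_const.mul (hb.mul hb)), laplacian_mul IM ha ha,
    laplacian_const_mul IM (-1) (f := fun y => b y * b y) (hb.mul hb), laplacian_mul IM hb hb]
  ring

/-- A harmonic morphism pulls a pair of conjugate harmonic functions back to a conformal pair,
because it pulls back the harmonic functions `u v` and `u ^ 2 - v ^ 2` to harmonic functions. -/
theorem IsHarmonicMorphism.conformal {F : M → N} (hF : IsHarmonicMorphism IM IN F) {V : Set N}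
    (hV : IsOpen V) {u v : N → ℝ} (hu : IsHarmonicOn IN u V) (hv : IsHarmonicOn IN v V)
    (huv : ∀ z ∈ V, ⟪grad IN u z, grad IN u z⟫ = ⟪grad IN v z, grad IN v z⟫ ∧
      ⟪grad IN u z, grad IN v z⟫ = 0) {m : M} (hm : F m ∈ V) :
    ⟪grad IM (u ∘ F) m, grad IM (u ∘ F) m⟫ = ⟪grad IM (v ∘ F) m, grad IM (v ∘ F) m⟫ ∧
      ⟪grad IM (u ∘ F) m, grad IM (v ∘ F) m⟫ = 0 := by
  have hu2 : ∀ z ∈ V, CMDiffAt 2 u z := fun z hz => hu.1.contMDiffAt (hV.mem_nhds hz)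
  have hv2 : ∀ z ∈ V, CMDiffAt 2 v z := fun z hz => hv.1.contMDiffAt (hV.mem_nhds hz)
  have hFV := hV.preimage hF.1.continuous
  have ha := hF.2 V hV u hu
  have hb := hF.2 V hV v hv
  have ha2 : CMDiffAt 2 (u ∘ F) m := ha.1.contMDiffAt (hFV.mem_nhds hm)
  have hb2 : CMDiffAt 2 (v ∘ F) m := hb.1.contMDiffAt (hFV.mem_nhds hm)
  have h1 : IsHarmonicOn IN (fun z => u z * v z) V :=
    ⟨fun z hz => ((hu2 z hz).mul (hv2 z hz)).contMDiffWithinAt, fun z hz => by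
      rw [laplacian_mul IN (hu2 z hz) (hv2 z hz), hu.2 z hz, hv.2 z hz, (huv z hz).2]
      ring⟩
  have h2 : IsHarmonicOn IN (fun z => u z * u z + -1 * (v z * v z)) V :=
    ⟨fun z hz => (((hu2 z hz).mul (hu2 z hz)).add
      (contMDiffAt_const.mul ((hv2 z hz).mul (hv2 z hz)))).contMDiffWithinAt, fun z hz => by
      rw [laplacian_sq_sub_sq (hu2 z hz) (hv2 z hz), hu.2 z hz, hv.2 z hz, (huv z hz).1]
      ring⟩
  have k1 := (hF.2 V hV _ h1).2 m hm
  have k2 := (hF.2 V hV _ h2).2 m hm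
  have k3 := laplacian_mul IM ha2 hb2
  have k4 := laplacian_sq_sub_sq ha2 hb2
  rw [ha.2 m hm, hb.2 m hm] at k3 k4
  constructor
  · linarith [show (0 : ℝ) = _ from k1.symm.trans k3, show (0 : ℝ) = _ from k2.symm.trans k4]
  · linarith [show (0 : ℝ) = _ from k1.symm.trans k3]

theorem inner_grad_comp {F : M → N} {u : N → ℝ} {m : M} (hu : MDiffAt u (F m)) (hF : MDiffAt F m)
    (w : TangentSpace IM m) :
    ⟪grad IM (u ∘ F) m, w⟫ = ⟪grad IN u (F m), mfderiv IM IN F m w⟫ := by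
  rw [inner_grad, inner_grad]
  exact mfderiv_comp_apply m hu hF w

end PullBack

section Coordinates

variable {M : Type*} [TopologicalSpace M] [ChartedSpace (EuclideanSpace ℝ (Fin 4)) M]
  [IsManifold (𝓡 4) ∞ M] [RiemannianBundle (fun x : M => TangentSpace (𝓡 4) x)]
  [IsContMDiffRiemannianBundle (𝓡 4) ∞ (EuclideanSpace ℝ (Fin 4))
    (fun x : M => TangentSpace (𝓡 4) x)]
  {N : Type*} [TopologicalSpace N] [ChartedSpace (EuclideanSpace ℝ (Fin 2)) N]
  [IsManifold (𝓡 2) ∞ N] [RiemannianBundle (fun y : N => TangentSpace (𝓡 2) y)]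
  [IsContMDiffRiemannianBundle (𝓡 2) ∞ (EuclideanSpace ℝ (Fin 2))
    (fun y : N => TangentSpace (𝓡 2) y)]

/-- The properties at `m` of the pull-back `a + i b` under a harmonic morphism `F` of a holomorphic
coordinate of the surface: both functions are harmonic with orthogonal gradients of equal length,
and they detect the regular points, the vertical vectors and the complex linearity of `dF`. The
last is expressed for single vectors: `dF w = j (dF v)`. -/
structure IsPullbackCoordinateAt (oN : ∀ y : N, Orientation ℝ (TangentSpace (𝓡 2) y) (Fin 2))
    (F : M → N) (a b : M → ℝ) (m : M) : Prop where
  contMDiffAt_left : ContMDiffAt (𝓡 4) 𝓘(ℝ, ℝ) 3 a m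
  contMDiffAt_right : ContMDiffAt (𝓡 4) 𝓘(ℝ, ℝ) 3 b m
  laplacian_left : laplacian (𝓡 4) a m = 0
  laplacian_right : laplacian (𝓡 4) b m = 0
  inner_self : ⟪grad (𝓡 4) a m, grad (𝓡 4) a m⟫ = ⟪grad (𝓡 4) b m, grad (𝓡 4) b m⟫
  inner_eq_zero : ⟪grad (𝓡 4) a m, grad (𝓡 4) b m⟫ = 0
  regular_iff : IsRegularPoint (𝓡 4) (𝓡 2) F m ↔ grad (𝓡 4) a m ≠ 0
  vertical : ∀ T, mfderiv (𝓡 4) (𝓡 2) F m T = 0 →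
    ⟪grad (𝓡 4) a m, T⟫ = 0 ∧ ⟪grad (𝓡 4) b m, T⟫ = 0
  complexLinear_iff : ∀ v w, mfderiv (𝓡 4) (𝓡 2) F m w =
      surfaceJ oN (F m) (mfderiv (𝓡 4) (𝓡 2) F m v) ↔
    ⟪grad (𝓡 4) a m, w⟫ = -⟪grad (𝓡 4) b m, v⟫ ∧ ⟪grad (𝓡 4) b m, w⟫ = ⟪grad (𝓡 4) a m, v⟫

theorem exists_pullbackCoordinate {oN : ∀ y : N, Orientation ℝ (TangentSpace (𝓡 2) y) (Fin 2)}
    (hoN : IsOrientationOn (𝓡 2) oN univ) {F : M → N} (hF : IsHarmonicMorphism (𝓡 4) (𝓡 2) F)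
    (m : M) : ∃ a b : M → ℝ, ∀ᶠ y in 𝓝 m, IsPullbackCoordinateAt oN F a b y := by
  obtain ⟨u, v, huv⟩ := exists_holomorphicCoordinate hoN (F m)
  obtain ⟨V, hVuv, hV, hmV⟩ := eventually_nhds_iff.1 huv
  have hpair : ∀ z ∈ V, ⟪grad (𝓡 2) u z, grad (𝓡 2) u z⟫ = ⟪grad (𝓡 2) v z, grad (𝓡 2) v z⟫ ∧
      ⟪grad (𝓡 2) u z, grad (𝓡 2) v z⟫ = 0 := fun z hz => by
    obtain ⟨-, -, -, h⟩ := hVuv z hz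
    rw [← h, surfaceJ]
    exact ⟨by simp, by simp⟩
  have hpair' : ∀ z ∈ V, IsConformalPairAt (𝓡 2) u v z := fun z hz =>
    Filter.eventually_of_mem (hV.mem_nhds hz) hpair
  have hu2 : ∀ z ∈ V, ContMDiffAt (𝓡 2) 𝓘(ℝ, ℝ) 2 u z := fun z hz => (hVuv z hz).1.of_le
    (by norm_num)
  have hv2 : ∀ z ∈ V, ContMDiffAt (𝓡 2) 𝓘(ℝ, ℝ) 2 v z := fun z hz => (hVuv z hz).2.1.of_le
    (by norm_num)
  have hv0 : ∀ z ∈ V, grad (𝓡 2) v z ≠ 0 := fun z hz h => by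
    have := (hpair z hz).1
    rw [h, inner_zero_left] at this
    exact (hVuv z hz).2.2.1 (inner_self_eq_zero.1 this)
  have hE : Module.finrank ℝ (EuclideanSpace ℝ (Fin 2)) = 2 := finrank_euclideanSpace_fin
  have hu : IsHarmonicOn (𝓡 2) u V := ⟨fun z hz => (hu2 z hz).contMDiffWithinAt, fun z hz =>
    (hpair' z hz).laplacian_eq_zero (hu2 z hz) (hv2 z hz) (hVuv z hz).2.2.1 hE⟩
  have hv : IsHarmonicOn (𝓡 2) v V := ⟨fun z hz => (hv2 z hz).contMDiffWithinAt, fun z hz =>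
    (hpair' z hz).symm.laplacian_eq_zero (hv2 z hz) (hu2 z hz) (hv0 z hz) hE⟩
  refine ⟨u ∘ F, v ∘ F, ?_⟩
  filter_upwards [hF.1.continuous.continuousAt.eventually (hV.mem_nhds hmV)] with y hy
  obtain ⟨hu3, hv3, hu0, hj⟩ := hVuv _ hy
  have hFy : ContMDiffAt (𝓡 4) (𝓡 2) 3 F y := hF.1.contMDiffAt.of_le three_le_infty
  have hFd : MDifferentiableAt (𝓡 4) (𝓡 2) F y := hFy.mdifferentiableAt (by norm_num)
  have ia := inner_grad_comp (IM := 𝓡 4) (hu3.mdifferentiableAt (by norm_num)) hFd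
  have ib := inner_grad_comp (IM := 𝓡 4) (hv3.mdifferentiableAt (by norm_num)) hFd
  have hc := hF.conformal hV hu hv hpair hy
  -- a tangent vector of the surface is determined by its products with the two gradients
  have hinj : ∀ w w' : TangentSpace (𝓡 2) (F y), ⟪grad (𝓡 2) u (F y), w⟫ = ⟪grad (𝓡 2) u (F y),
    w'⟫ →
      ⟪grad (𝓡 2) v (F y), w⟫ = ⟪grad (𝓡 2) v (F y), w'⟫ → w = w' := fun w w' h1 h2 => by
    have h3 := (oN (F y)).inner_sq_add_areaForm_sq (grad (𝓡 2) u (F y)) (w - w')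
    rw [← (oN (F y)).inner_rightAngleRotation_left] at h3
    change _ + ⟪surfaceJ oN (F y) _, _⟫ ^ 2 = _ at h3
    rw [hj, inner_sub_right, inner_sub_right, h1, h2] at h3
    simpa [hu0, sub_eq_zero] using h3
  refine ⟨hu3.comp y hFy, hv3.comp y hFy, (hF.2 V hV u hu).2 y hy, (hF.2 V hV v hv).2 y hy,
    hc.1, hc.2, ⟨fun hr h0 => ?_, fun h0 w => ?_⟩, fun T hT => ?_, fun p q => ⟨fun h => ?_,
      fun h => ?_⟩⟩
  · obtain ⟨w, hw⟩ := hr (grad (𝓡 2) u (F y))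
    have := ia w
    rw [h0, hw, inner_zero_left] at this
    exact hu0 (inner_self_eq_zero.1 this.symm)
  · set p := grad (𝓡 4) (u ∘ F) y
    set q := grad (𝓡 4) (v ∘ F) y
    have hl : ⟪p, p⟫ ≠ 0 := fun h => h0 (inner_self_eq_zero.1 h)
    refine ⟨(⟪p, p⟫)⁻¹ • (⟪grad (𝓡 2) u (F y), w⟫ • p + ⟪grad (𝓡 2) v (F y), w⟫ • q),
      hinj _ _ ?_ ?_⟩
    · rw [← ia, inner_smul_right, inner_add_right, inner_smul_right, inner_smul_right, hc.2]
      field_simp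
      simp
    · rw [← ib, inner_smul_right, inner_add_right, inner_smul_right, inner_smul_right, ← hc.1,
        (real_inner_comm p q).trans hc.2]
      field_simp
      simp
  · rw [ia, ib, hT]
    simp
  · rw [ia, ia, ib, ib, h, ← hj, surfaceJ]
    simp
  · rw [ia, ia, ib, ib] at h
    refine hinj _ _ ?_ ?_
    · rw [h.1, ← hj, surfaceJ]
      simp
    · rw [h.2, ← hj, surfaceJ]
      simp

end Coordinates

/-! ### Hessians of a harmonic conformal pair -/

section HessianNorms

variable {E : Type*} [NormedAddCommGroup E] [NormedSpace ℝ E] [FiniteDimensional ℝ E]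
  {H : Type*} [TopologicalSpace H] (I : ModelWithCorners ℝ E H) [I.Boundaryless]
  {M : Type*} [TopologicalSpace M] [ChartedSpace H M] [IsManifold I ∞ M]
  [RiemannianBundle (fun x : M => TangentSpace I x)]
  [IsContMDiffRiemannianBundle I ∞ E (fun x : M => TangentSpace I x)]

/-- For harmonic functions whose gradients have the same length near a point, the Bochner formula
bounds the difference of the squared norms of the Hessians; for a conformal pair `(f, h)` this
applies both to `(f, h)` and to `(f + h, f - h)`. -/
theorem exists_hessian_bound (p : M) : ∃ W ∈ 𝓝 p, ∃ C : ℝ, 0 ≤ C ∧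
    ∀ x ∈ W, ∀ f h : M → ℝ, CMDiffAt 3 f x → CMDiffAt 3 h x →
      (∀ᶠ y in 𝓝 x, laplacian I f y = 0) → (∀ᶠ y in 𝓝 x, laplacian I h y = 0) →
      IsConformalPairAt I f h x → ∀ {ι : Type} [Fintype ι]
        (b : OrthonormalBasis ι ℝ (TangentSpace I x)),
      |∑ i, ⟪leviCivita I (grad I f) x (b i), leviCivita I (grad I f) x (b i)⟫ -
        ∑ i, ⟪leviCivita I (grad I h) x (b i), leviCivita I (grad I h) x (b i)⟫| ≤
          2 * C * ‖grad I f x‖ ^ 2 ∧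
      |∑ i, ⟪leviCivita I (grad I f) x (b i), leviCivita I (grad I h) x (b i)⟫| ≤
          C * ‖grad I f x‖ ^ 2 := by
  obtain ⟨W, e, C, hp, he, hC, hB⟩ := exists_bochner_bound I p
  have key : ∀ x ∈ W, ∀ f h : M → ℝ, CMDiffAt 3 f x → CMDiffAt 3 h x →
      (∀ᶠ y in 𝓝 x, laplacian I f y = 0) → (∀ᶠ y in 𝓝 x, laplacian I h y = 0) →
      (∀ᶠ y in 𝓝 x, ⟪grad I f y, grad I f y⟫ = ⟪grad I h y, grad I h y⟫) →
      ∀ {ι : Type} [Fintype ι] (b : OrthonormalBasis ι ℝ (TangentSpace I x)),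
      |∑ i, ⟪leviCivita I (grad I f) x (b i), leviCivita I (grad I f) x (b i)⟫ -
        ∑ i, ⟪leviCivita I (grad I h) x (b i), leviCivita I (grad I h) x (b i)⟫| ≤
          2 * C * ‖grad I f x‖ ^ 2 := by
    intro x hx f h hf hh hf0 hh0 heq ι _ b
    have h1 := hB x hx f hf hf0
    have h2 := hB x hx h hh hh0
    have h3 := heq.self_of_nhds
    rw [real_inner_self_eq_norm_sq, real_inner_self_eq_norm_sq] at h3
    rw [← frameLaplacian_congr I e heq, ← h3] at h2
    simp only [← he.basisAt_apply hx] at h1 h2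
    rw [sum_inner_apply_eq (he.basisAt hx) b] at h1 h2
    rw [abs_le] at h1 h2 ⊢
    constructor <;> linarith [h1.1, h1.2, h2.1, h2.2]
  refine ⟨W, he.isOpen.mem_nhds hp, C, hC, fun x hx f h hf hh hf0 hh0 hc ι _ b => ⟨?_, ?_⟩⟩
  · exact key x hx f h hf hh hf0 hh0 (hc.mono fun y hy => hy.1) b
  have hf2 : ∀ᶠ y in 𝓝 x, CMDiffAt 2 f y :=
    (contMDiffAt_iff_contMDiffAt_nhds (by simp)).1 (hf.of_le (by norm_num))
  have hh2 : ∀ᶠ y in 𝓝 x, CMDiffAt 2 h y :=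
    (contMDiffAt_iff_contMDiffAt_nhds (by simp)).1 (hh.of_le (by norm_num))
  have hn2 : ∀ {y}, CMDiffAt 2 h y → CMDiffAt 2 (fun y => -1 * h y) y := fun hy =>
    contMDiffAt_const.mul hy
  have hadd : ∀ᶠ y in 𝓝 x, laplacian I (fun y => f y + h y) y = 0 := by
    filter_upwards [hf2, hh2, hf0, hh0] with y h1 h2 h3 h4
    rw [laplacian_add I h1 h2, h3, h4, add_zero]
  have hsub : ∀ᶠ y in 𝓝 x, laplacian I (fun y => f y + -1 * h y) y = 0 := by
    filter_upwards [hf2, hh2, hf0, hh0] with y h1 h2 h3 h4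
    rw [laplacian_add I (h := fun y => -1 * h y) h1 (hn2 h2), laplacian_const_mul I _ h2, h3, h4]
    simp
  have gadd : ∀ᶠ y in 𝓝 x, grad I (fun y => f y + h y) y = grad I f y + grad I h y ∧
      grad I (fun y => f y + -1 * h y) y = grad I f y - grad I h y := by
    filter_upwards [hf2, hh2] with y h1 h2
    have d1 := h1.mdifferentiableAt (by simp)
    have d2 := h2.mdifferentiableAt (by simp)
    rw [grad_add I d1 d2, grad_add I (h := fun y => -1 * h y) d1
      ((hn2 h2).mdifferentiableAt (by simp)), grad_const_mul I _ d2]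
    exact ⟨rfl, by module⟩
  have h1 := key x hx (fun y => f y + h y) (fun y => f y + -1 * h y) (hf.add hh)
    (hf.add (contMDiffAt_const.mul hh)) hadd hsub (by
      filter_upwards [gadd, hc] with y h1 h2
      rw [h1.1, h1.2, inner_add_left, inner_add_right, inner_add_right, inner_sub_left,
        inner_sub_right, inner_sub_right, h2.2, (real_inner_comm (grad I f y)
          (grad I h y)).trans h2.2]
      ring) b
  have hnorm : ‖grad I f x + grad I h x‖ ^ 2 = 2 * ‖grad I f x‖ ^ 2 := by
    have h2 := hc.self_of_nhds
    rw [real_inner_self_eq_norm_sq, real_inner_self_eq_norm_sq] at h2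
    rw [norm_add_sq_real, h2.2, ← h2.1]
    ring
  rw [gadd.self_of_nhds.1, hnorm, leviCivita_grad_add I hf2.self_of_nhds hh2.self_of_nhds,
    leviCivita_grad_add I (h := fun y => -1 * h y) hf2.self_of_nhds (hn2 hh2.self_of_nhds),
    leviCivita_grad_const_mul I _ hh2.self_of_nhds, ← Finset.sum_sub_distrib] at h1
  have h4 : ∀ v w : TangentSpace I x, ⟪v + w, v + w⟫ - ⟪v + (-1 : ℝ) • w, v + (-1 : ℝ) • w⟫ =
      4 * ⟪v, w⟫ := fun v w => by
    simp only [inner_add_left, inner_add_right, inner_smul_left, inner_smul_right,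
      real_inner_comm v w, RCLike.conj_to_real]
    ring
  simp only [add_apply, smul_apply, h4] at h1
  rw [← Finset.mul_sum, abs_mul, abs_of_nonneg (by norm_num : (0 : ℝ) ≤ 4)] at h1
  linarith

end HessianNorms

/-! ### The adapted complex structures -/

section AdaptedStructures

/-- An orthogonal complex structure `J` and unit vectors `p`, `T` spanning orthogonal `J`-lines give
an orthonormal basis. -/
theorem exists_adaptedBasis {V : Type*} [NormedAddCommGroup V] [InnerProductSpace ℝ V]
    (hV : Module.finrank ℝ V = 4) {J : V →L[ℝ] V} (hsq : ∀ v, J (J v) = -v)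
    (hiso : ∀ v w, ⟪J v, J w⟫ = ⟪v, w⟫) {p T : V} (hp : ‖p‖ = 1) (hT : ‖T‖ = 1)
    (h : ⟪p, T⟫ = 0) (h' : ⟪J p, T⟫ = 0) :
    ∃ b : OrthonormalBasis (Fin 4) ℝ V, b 0 = p ∧ b 1 = J p ∧ b 2 = T ∧ b 3 = J T := by
  have skew := inner_complexStructure_left hsq hiso
  have self : ∀ v, ⟪v, J v⟫ = 0 := fun v => by
    have := skew v v
    rw [real_inner_comm] at this
    linarith
  have n : ∀ v, ‖J v‖ = ‖v‖ := fun v => by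
    rw [norm_eq_sqrt_real_inner, hiso, ← norm_eq_sqrt_real_inner]
  have hpJT : ⟪p, J T⟫ = 0 := by linarith [skew p T]
  have hon : Orthonormal ℝ ![p, J p, T, J T] := by
    refine ⟨fun i => ?_, fun i j hij => ?_⟩
    · fin_cases i <;> simp [n, hp, hT]
    · have hTp : ⟪T, p⟫ = 0 := by rw [real_inner_comm, h]
      have hTJp : ⟪T, J p⟫ = 0 := by rw [real_inner_comm, h']
      have hJTp : ⟪J T, p⟫ = 0 := by rw [real_inner_comm, hpJT]
      have self' : ∀ v, ⟪J v, v⟫ = 0 := fun v => by rw [real_inner_comm, self]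
      fin_cases i <;> fin_cases j <;> simp_all
  have : FiniteDimensional ℝ V := Module.finite_of_finrank_pos (by omega)
  refine ⟨OrthonormalBasis.mk hon
    (hon.linearIndependent.span_eq_top_of_card_eq_finrank' (by simp [hV])).ge, ?_⟩
  simp

variable {M : Type*} [TopologicalSpace M] [ChartedSpace (EuclideanSpace ℝ (Fin 4)) M]
  [IsManifold (𝓡 4) ∞ M] [RiemannianBundle (fun x : M => TangentSpace (𝓡 4) x)]
  [IsContMDiffRiemannianBundle (𝓡 4) ∞ (EuclideanSpace ℝ (Fin 4))
    (fun x : M => TangentSpace (𝓡 4) x)]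
  {N : Type*} [TopologicalSpace N] [ChartedSpace (EuclideanSpace ℝ (Fin 2)) N]
  [IsManifold (𝓡 2) ∞ N] [RiemannianBundle (fun y : N => TangentSpace (𝓡 2) y)]
  [IsContMDiffRiemannianBundle (𝓡 2) ∞ (EuclideanSpace ℝ (Fin 2))
    (fun y : N => TangentSpace (𝓡 2) y)]
  {oN : ∀ y : N, Orientation ℝ (TangentSpace (𝓡 2) y) (Fin 2)} {F : M → N} {a c : M → ℝ} {m : M}

namespace IsPullbackCoordinateAt

theorem norm_eq (h : IsPullbackCoordinateAt oN F a c m) :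
    ‖grad (𝓡 4) c m‖ = ‖grad (𝓡 4) a m‖ := by
  rw [norm_eq_sqrt_real_inner, norm_eq_sqrt_real_inner, h.inner_self]

/-- In an orthonormal basis starting with the normalized gradients, `frameJ` is the unique adapted
complex structure. -/
theorem isAdapted_iff (h : IsPullbackCoordinateAt oN F a c m) (hm : grad (𝓡 4) a m ≠ 0)
    (b : OrthonormalBasis (Fin 4) ℝ (TangentSpace (𝓡 4) m))
    (h0 : b 0 = ‖grad (𝓡 4) a m‖⁻¹ • grad (𝓡 4) a m)
    (h1 : b 1 = ‖grad (𝓡 4) c m‖⁻¹ • grad (𝓡 4) c m)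
    {J : TangentSpace (𝓡 4) m →L[ℝ] TangentSpace (𝓡 4) m} :
    IsAdapted oN F m b.toBasis.orientation J ↔ J = frameJ b := by
  rw [h.norm_eq] at h1
  have hl : ‖grad (𝓡 4) a m‖ ≠ 0 := norm_ne_zero_iff.2 hm
  constructor
  · intro hJ
    refine eq_frameJ b hJ.sq hJ.isometry hJ.orientation (fun v => ?_) fun v => ?_
    · rw [h0, h1, real_inner_smul_left, real_inner_smul_left,
        ((h.complexLinear_iff v (J v)).1 (hJ.complexLinear v)).1, mul_neg]
    · rw [h0, h1, real_inner_smul_left, real_inner_smul_left,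
        ((h.complexLinear_iff v (J v)).1 (hJ.complexLinear v)).2]
  · rintro rfl
    refine ⟨frameJ_sq b, frameJ_isometry b, inducesOrientation_frameJ b, fun v => ?_⟩
    have p0 : grad (𝓡 4) a m = ‖grad (𝓡 4) a m‖ • b 0 := by rw [h0, smul_inv_smul₀ hl]
    have p1 : grad (𝓡 4) c m = ‖grad (𝓡 4) a m‖ • b 1 := by rw [h1, smul_inv_smul₀ hl]
    rw [h.complexLinear_iff, p0, p1]
    simp only [real_inner_smul_left, inner_frameJ_zero, inner_frameJ_one]
    constructor <;> simp

theorem apply_grad (h : IsPullbackCoordinateAt oN F a c m)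
    {o : Orientation ℝ (TangentSpace (𝓡 4) m) (Fin 4)}
    {J : TangentSpace (𝓡 4) m →L[ℝ] TangentSpace (𝓡 4) m} (hJ : IsAdapted oN F m o J) :
    J (grad (𝓡 4) a m) = grad (𝓡 4) c m := by
  refine ext_inner_right ℝ fun v => ?_
  rw [inner_complexStructure_left hJ.sq hJ.isometry,
    ((h.complexLinear_iff v (J v)).1 (hJ.complexLinear v)).1, neg_neg]

/-- A `C^2` orthonormal frame starting with the normalized gradients. -/
theorem exists_frame (h : ∀ᶠ y in 𝓝 m, IsPullbackCoordinateAt oN F a c y)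
    (hm : grad (𝓡 4) a m ≠ 0) :
    ∃ (W : Set M) (e : Fin 4 → Π y : M, TangentSpace (𝓡 4) y), m ∈ W ∧
      IsOrthonormalFrameOn (𝓡 4) 2 e W ∧ ∀ y ∈ W,
        e 0 y = ‖grad (𝓡 4) a y‖⁻¹ • grad (𝓡 4) a y ∧
        e 1 y = ‖grad (𝓡 4) c y‖⁻¹ • grad (𝓡 4) c y :=
  exists_orthonormalFrame_extending (𝓡 4) finrank_euclideanSpace_fin two_le_infty
    (h.mono fun y hy => contMDiffAt_grad (𝓡 4) hy.contMDiffAt_left (by norm_num) two_le_infty)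
    (h.mono fun y hy => contMDiffAt_grad (𝓡 4) hy.contMDiffAt_right (by norm_num) two_le_infty)
    hm (fun h0 => by
      have := h.self_of_nhds.norm_eq
      rw [h0, norm_zero] at this
      exact hm (norm_eq_zero.1 this.symm))
    (h.mono fun y hy => hy.inner_eq_zero)

end IsPullbackCoordinateAt

/-- Both orientations admit a basis starting with the normalized gradients, because the last member
may change sign. -/
theorem existsUnique_isAdapted (hoN : IsOrientationOn (𝓡 2) oN univ)
    (hF : IsHarmonicMorphism (𝓡 4) (𝓡 2) F) (hm : IsRegularPoint (𝓡 4) (𝓡 2) F m)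
    (o : Orientation ℝ (TangentSpace (𝓡 4) m) (Fin 4)) : ∃! J, IsAdapted oN F m o J := by
  obtain ⟨a, c, h⟩ := exists_pullbackCoordinate hoN hF m
  have h' := h.self_of_nhds
  have hm0 := h'.regular_iff.1 hm
  obtain ⟨W, e, hmW, he, he01⟩ := IsPullbackCoordinateAt.exists_frame h hm0
  obtain ⟨b, hb0, hb1, hb⟩ : ∃ b : OrthonormalBasis (Fin 4) ℝ (TangentSpace (𝓡 4) m),
      b 0 = e 0 m ∧ b 1 = e 1 m ∧ b.toBasis.orientation = o := by
    have hb := he.basisAt_apply hmW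
    rcases Module.Basis.orientation_eq_or_eq_neg (he.basisAt hmW).toBasis o with ho | ho
    · exact ⟨_, hb 0, hb 1, ho.symm⟩
    · refine ⟨flipBasis (he.basisAt hmW) 3, ?_, ?_, (orientation_flipBasis _ 3).trans ho.symm⟩
      · rw [flipBasis_of_ne _ (by decide), hb]
      · rw [flipBasis_of_ne _ (by decide), hb]
  rw [← hb]
  have := fun J => h'.isAdapted_iff hm0 b (hb0.trans (he01 m hmW).1) (hb1.trans (he01 m hmW).2)
    (J := J)
  exact ⟨_, (this _).2 rfl, fun J hJ => (this J).1 hJ⟩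

theorem IsPullbackCoordinateAt.eventually_regular
    (h : ∀ᶠ y in 𝓝 m, IsPullbackCoordinateAt oN F a c y)
    (hm : IsRegularPoint (𝓡 4) (𝓡 2) F m) : ∀ᶠ y in 𝓝 m, IsRegularPoint (𝓡 4) (𝓡 2) F y := by
  obtain ⟨W, e, hmW, he, he01⟩ :=
    IsPullbackCoordinateAt.exists_frame h (h.self_of_nhds.regular_iff.1 hm)
  filter_upwards [h, he.isOpen.mem_nhds hmW] with y hy hyW
  refine hy.regular_iff.2 fun h0 => ?_
  have := (he.orthonormal y hyW).norm_eq_one 0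
  rw [(he01 y hyW).1, h0, smul_zero, norm_zero] at this
  exact zero_ne_one this

/-- Near a regular point an adapted structure is `frameJ` of a differentiable frame. -/
theorem endMDiffAt_of_isAdapted (h : ∀ᶠ y in 𝓝 m, IsPullbackCoordinateAt oN F a c y)
    {o : ∀ x : M, Orientation ℝ (TangentSpace (𝓡 4) x) (Fin 4)} {U : Set M}
    (ho : IsOrientationOn (𝓡 4) o U) (hmU : m ∈ U) (hm : IsRegularPoint (𝓡 4) (𝓡 2) F m)
    {J : ∀ x : M, TangentSpace (𝓡 4) x →L[ℝ] TangentSpace (𝓡 4) x}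
    (hJ : ∀ᶠ y in 𝓝 m, IsAdapted oN F y (o y) (J y)) : EndMDiffAt (𝓡 4) J m := by
  obtain ⟨W, e₀, hmW, he₀, he01⟩ :=
    IsPullbackCoordinateAt.exists_frame h (h.self_of_nhds.regular_iff.1 hm)
  obtain ⟨e, he, hee, hor⟩ := exists_oriented_frame (𝓡 4) he₀ ho hmW hmU 3
  refine endMDiffAt_congr (𝓡 4) (endMDiffAt_frameJ (𝓡 4) (e := e) fun i =>
    (he.contMDiffAt i m hmW).mdifferentiableAt (by simp)) ?_
  filter_upwards [h, IsPullbackCoordinateAt.eventually_regular h hm, hor,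
    he.isOpen.mem_nhds hmW, hJ] with y hy hr hoy hyW hJy
  rw [← hoy hyW, hy.isAdapted_iff (hy.regular_iff.1 hr)] at hJy
  · rw [hJy]
    congr 1
    ext1 i
    exact he.basisAt_apply hyW i
  · rw [he.basisAt_apply, hee 0 (by decide), (he01 y hyW).1]
  · rw [he.basisAt_apply, hee 1 (by decide), (he01 y hyW).2]

end AdaptedStructures

/-! ### The estimate -/

section Estimate

variable {M : Type*} [TopologicalSpace M] [ChartedSpace (EuclideanSpace ℝ (Fin 4)) M]
  [IsManifold (𝓡 4) ∞ M] [RiemannianBundle (fun x : M => TangentSpace (𝓡 4) x)]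
  [IsContMDiffRiemannianBundle (𝓡 4) ∞ (EuclideanSpace ℝ (Fin 4))
    (fun x : M => TangentSpace (𝓡 4) x)]
  {N : Type*} [TopologicalSpace N] [ChartedSpace (EuclideanSpace ℝ (Fin 2)) N]
  [IsManifold (𝓡 2) ∞ N] [RiemannianBundle (fun y : N => TangentSpace (𝓡 2) y)]
  [IsContMDiffRiemannianBundle (𝓡 2) ∞ (EuclideanSpace ℝ (Fin 2))
    (fun y : N => TangentSpace (𝓡 2) y)]
  {oN : ∀ y : N, Orientation ℝ (TangentSpace (𝓡 2) y) (Fin 2)} {F : M → N} {a c : M → ℝ} {m : M}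

/-- Since `∇_T J` is determined by its value `∇_T (grad c) - J (∇_T (grad a))` on `grad a`, its norm
is given by the Hessians of `a` and `c` on the vertical plane, if `T` is vertical. -/
theorem norm_sq_mul_hsNorm_covDerivEnd_sq (h : ∀ᶠ y in 𝓝 m, IsPullbackCoordinateAt oN F a c y)
    {o : ∀ x : M, Orientation ℝ (TangentSpace (𝓡 4) x) (Fin 4)}
    {J : ∀ x : M, TangentSpace (𝓡 4) x →L[ℝ] TangentSpace (𝓡 4) x}
    (hJ : ∀ᶠ y in 𝓝 m, IsAdapted oN F y (o y) (J y)) (hJd : EndMDiffAt (𝓡 4) J m)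
    (b : OrthonormalBasis (Fin 4) ℝ (TangentSpace (𝓡 4) m))
    (hb : grad (𝓡 4) a m = ‖grad (𝓡 4) a m‖ • b 0) (h0 : J m (b 0) = b 1) (h2 : J m (b 2) = b 3) :
    ‖grad (𝓡 4) a m‖ ^ 2 * hsNorm (covDerivEnd (𝓡 4) J m (b 2)) ^ 2 =
      4 * ((⟪b 2, leviCivita (𝓡 4) (grad (𝓡 4) c) m (b 2)⟫ +
          ⟪b 3, leviCivita (𝓡 4) (grad (𝓡 4) a) m (b 2)⟫) ^ 2 +
        (⟪b 3, leviCivita (𝓡 4) (grad (𝓡 4) c) m (b 2)⟫ -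
          ⟪b 2, leviCivita (𝓡 4) (grad (𝓡 4) a) m (b 2)⟫) ^ 2) := by
  have hskew : ∀ᶠ y in 𝓝 m, ∀ v w, ⟪J y v, w⟫ = -⟪v, J y w⟫ :=
    hJ.mono fun y hy => inner_complexStructure_left hy.sq hy.isometry
  have hJm := hJ.self_of_nhds
  have h3 : J m (b 3) = -b 2 := by rw [← h2, hJm.sq]
  have hP := covDerivEnd_apply_of_eq (𝓡 4) hJd (Y := grad (𝓡 4) a) (Z := grad (𝓡 4) c)
    (mdifferentiableAt_grad (𝓡 4) (h.self_of_nhds.contMDiffAt_left.of_le (by norm_num)))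
    (by filter_upwards [h, hJ] with y hy hJy using hy.apply_grad hJy) (b 2)
  rw [hsNorm_sq_of_anticommute b (covDerivEnd_skew (𝓡 4) hJd hskew (b 2)) hskew.self_of_nhds
    hJm.sq (covDerivEnd_anticommute (𝓡 4) hJd (hJ.mono fun y hy => hy.sq) (b 2)) h0 h2]
  have e : ∀ w, ‖grad (𝓡 4) a m‖ * ⟪w, covDerivEnd (𝓡 4) J m (b 2) (b 0)⟫ =
      ⟪w, leviCivita (𝓡 4) (grad (𝓡 4) c) m (b 2)⟫ +
        ⟪J m w, leviCivita (𝓡 4) (grad (𝓡 4) a) m (b 2)⟫ := fun w => by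
    rw [← real_inner_smul_right, ← map_smul, ← hb, hP, inner_sub_right, hskew.self_of_nhds]
    ring
  have e2 := e (b 2)
  have e3 := e (b 3)
  rw [h2] at e2
  rw [h3, inner_neg_left, ← sub_eq_add_neg] at e3
  rw [← e2, ← e3]
  ring

/-- The constant is `6 > √32`: the square of `l ^ 2 * (P * Q)` is at most
`16 * (C ^ 2 + C ^ 2) * l ^ 4`. -/
theorem mul_le_of_sq_mul_eq {l C P Q x y s t : ℝ} (hl : 0 < l) (hC : 0 ≤ C)
    (hP : l ^ 2 * P ^ 2 = 4 * x) (hQ : l ^ 2 * Q ^ 2 = 4 * y) (hxy : x * y = (s / 2) ^ 2 + t ^ 2)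
    (hs : |s| ≤ 2 * C * l ^ 2) (ht : |t| ≤ C * l ^ 2) : P * Q ≤ 6 * C := by
  have hs2 := sq_le_sq' (neg_le_of_abs_le hs) (le_of_abs_le hs)
  have ht2 := sq_le_sq' (neg_le_of_abs_le ht) (le_of_abs_le ht)
  have h : (l ^ 2 * (P * Q)) ^ 2 ≤ (l ^ 2 * (6 * C)) ^ 2 := by
    calc (l ^ 2 * (P * Q)) ^ 2 = (l ^ 2 * P ^ 2) * (l ^ 2 * Q ^ 2) := by ring
      _ = 16 * ((s / 2) ^ 2 + t ^ 2) := by rw [hP, hQ, ← hxy]; ring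
      _ ≤ (l ^ 2 * (6 * C)) ^ 2 := by nlinarith [sq_nonneg (C * l ^ 2)]
  exact le_of_mul_le_mul_left (le_of_abs_le (abs_le_of_sq_le_sq h (by positivity))) (by positivity)

/-- The product of the two norms is, up to the factor `4 / ‖grad a‖ ^ 2`, the modulus of the complex
number `(|∇² a| ^ 2 - |∇² c| ^ 2) / 2 + i ⟨∇² a, ∇² c⟩`. -/
theorem hsNorm_mul_hsNorm_le (h : ∀ᶠ y in 𝓝 m, IsPullbackCoordinateAt oN F a c y)
    (hm : IsRegularPoint (𝓡 4) (𝓡 2) F m)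
    {o : ∀ x : M, Orientation ℝ (TangentSpace (𝓡 4) x) (Fin 4)}
    {Jp Jm : ∀ x : M, TangentSpace (𝓡 4) x →L[ℝ] TangentSpace (𝓡 4) x}
    (hJp : ∀ᶠ y in 𝓝 m, IsAdapted oN F y (o y) (Jp y))
    (hJm : ∀ᶠ y in 𝓝 m, IsAdapted oN F y (-(o y)) (Jm y))
    (hJpd : EndMDiffAt (𝓡 4) Jp m) (hJmd : EndMDiffAt (𝓡 4) Jm m) {C : ℝ} (hC : 0 ≤ C)
    (hB : ∀ b : OrthonormalBasis (Fin 4) ℝ (TangentSpace (𝓡 4) m),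
      |∑ i, ⟪leviCivita (𝓡 4) (grad (𝓡 4) a) m (b i), leviCivita (𝓡 4) (grad (𝓡 4) a) m (b i)⟫ -
        ∑ i, ⟪leviCivita (𝓡 4) (grad (𝓡 4) c) m (b i), leviCivita (𝓡 4) (grad (𝓡 4) c) m (b i)⟫| ≤
          2 * C * ‖grad (𝓡 4) a m‖ ^ 2 ∧
      |∑ i, ⟪leviCivita (𝓡 4) (grad (𝓡 4) a) m (b i), leviCivita (𝓡 4) (grad (𝓡 4) c) m (b i)⟫| ≤
          C * ‖grad (𝓡 4) a m‖ ^ 2)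
    {T : TangentSpace (𝓡 4) m} (hT : mfderiv (𝓡 4) (𝓡 2) F m T = 0) (hT1 : ‖T‖ = 1) :
    hsNorm (covDerivEnd (𝓡 4) Jp m T) * hsNorm (covDerivEnd (𝓡 4) Jm m T) ≤ 6 * C := by
  have hx := h.self_of_nhds
  have hp0 := hx.regular_iff.1 hm
  set l := ‖grad (𝓡 4) a m‖ with hl
  have hl0 : 0 < l := norm_pos_iff.2 hp0
  have Jx := hJp.self_of_nhds
  have hq : Jp m (l⁻¹ • grad (𝓡 4) a m) = l⁻¹ • grad (𝓡 4) c m := by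
    rw [map_smul, hx.apply_grad Jx]
  have hdim : Module.finrank ℝ (TangentSpace (𝓡 4) m) = 4 := finrank_euclideanSpace_fin
  obtain ⟨b, b0, b1, b2, b3⟩ := exists_adaptedBasis (p := l⁻¹ • grad (𝓡 4) a m) (T := T)
    hdim Jx.sq Jx.isometry
    (norm_smul_inv_norm hp0) hT1
    (by rw [real_inner_smul_left, (hx.vertical T hT).1, mul_zero])
    (by rw [hq, real_inner_smul_left, (hx.vertical T hT).2, mul_zero])
  have hor : b.toBasis.orientation = o m := Jx.orientation b.toBasis (by simp [b0, b1])
    (by simp [b2, b3])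
  rw [hq] at b1
  have ha : grad (𝓡 4) a m = l • b 0 := by rw [b0, smul_inv_smul₀ hl0.ne']
  have hc : grad (𝓡 4) c m = l • b 1 := by rw [b1, smul_inv_smul₀ hl0.ne']
  -- the structure for the opposite orientation reverses the rotation of the vertical plane
  set b' := flipBasis b 3
  have b'0 : b' 0 = b 0 := flipBasis_of_ne b (by decide)
  have b'1 : b' 1 = b 1 := flipBasis_of_ne b (by decide)
  have b'2 : b' 2 = b 2 := flipBasis_of_ne b (by decide)
  have b'3 : b' 3 = -b 3 := flipBasis_self b 3
  have hJm' : Jm m = frameJ b' := by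
    rw [← hx.isAdapted_iff hp0 b' (b'0.trans b0) (by rw [b'1, b1, hx.norm_eq]),
      orientation_flipBasis, hor]
    exact hJm.self_of_nhds
  have e1 := norm_sq_mul_hsNorm_covDerivEnd_sq h hJp hJpd b ha (by rw [b0, hq, b1]) (by rw [b2, b3])
  have e2 := norm_sq_mul_hsNorm_covDerivEnd_sq h (o := fun x => -(o x)) hJm hJmd b'
    (by rw [b'0]; exact ha) (by rw [hJm', frameJ_zero]) (by rw [hJm', frameJ_two])
  rw [b'2, b'3, inner_neg_left, inner_neg_left] at e2
  set A := leviCivita (𝓡 4) (grad (𝓡 4) a) m with hA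
  set B := leviCivita (𝓡 4) (grad (𝓡 4) c) m with hBdef
  have a2 := hx.contMDiffAt_left.of_le (show (2 : ℕ∞ω) ≤ 3 by norm_num)
  have c2 := hx.contMDiffAt_right.of_le (show (2 : ℕ∞ω) ≤ 3 by norm_num)
  have hpair : IsConformalPairAt (𝓡 4) a c m := h.mono fun y hy => ⟨hy.inner_self, hy.inner_eq_zero⟩
  have left : ∀ w, ⟪A w, b 0⟫ = ⟪B w, b 1⟫ := fun w => by
    have := hpair.hessian_left a2 c2 w
    rw [← hA, ← hBdef, ha, hc, real_inner_smul_right, real_inner_smul_right] at this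
    exact mul_left_cancel₀ hl0.ne' this
  have right : ∀ w, ⟪A w, b 1⟫ = -⟪B w, b 0⟫ := fun w => by
    have := hpair.hessian_right a2 c2 w
    rw [← hA, ← hBdef, ha, hc, real_inner_smul_right, real_inner_smul_right, ← mul_neg] at this
    exact mul_left_cancel₀ hl0.ne' this
  have trA := hx.laplacian_left
  have trB := hx.laplacian_right
  rw [laplacian_eq_sum (𝓡 4) b] at trA trB
  have key := mul_eq_of_isotropic b (inner_leviCivita_grad_comm (𝓡 4) a2)
    (inner_leviCivita_grad_comm (𝓡 4) c2) left right trA trB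
  obtain ⟨k1, k2⟩ := hB b
  rw [← b2]
  refine mul_le_of_sq_mul_eq hl0 hC e1 (e2.trans ?_) key k1 k2
  ring

end Estimate

end HarmonicMorphism

end

theorem proposition1 {M : Type*} [TopologicalSpace M] [T2Space M]
    [ChartedSpace (EuclideanSpace ℝ (Fin 4)) M] [IsManifold (𝓡 4) ∞ M]
    [RiemannianBundle (fun x : M => TangentSpace (𝓡 4) x)]
    [IsContMDiffRiemannianBundle (𝓡 4) ∞ (EuclideanSpace ℝ (Fin 4))
      (fun x : M => TangentSpace (𝓡 4) x)]
    {N : Type*} [TopologicalSpace N] [T2Space N]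
    [ChartedSpace (EuclideanSpace ℝ (Fin 2)) N] [IsManifold (𝓡 2) ∞ N]
    [RiemannianBundle (fun y : N => TangentSpace (𝓡 2) y)]
    [IsContMDiffRiemannianBundle (𝓡 2) ∞ (EuclideanSpace ℝ (Fin 2))
      (fun y : N => TangentSpace (𝓡 2) y)]
    (oN : ∀ y : N, Orientation ℝ (TangentSpace (𝓡 2) y) (Fin 2))
    (hoN : IsOrientationOn (𝓡 2) oN univ)
    (F : M → N) (hF : IsHarmonicMorphism (𝓡 4) (𝓡 2) F) :
    (∀ m : M, IsRegularPoint (𝓡 4) (𝓡 2) F m →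
      ∀ o : Orientation ℝ (TangentSpace (𝓡 4) m) (Fin 4), ∃! J, IsAdapted oN F m o J) ∧
    ∀ K : Set M, IsCompact K → ∃ A : ℝ,
      ∀ (U : Set M) (o : ∀ x : M, Orientation ℝ (TangentSpace (𝓡 4) x) (Fin 4)),
        IsOpen U → IsOrientationOn (𝓡 4) o U →
      ∀ Jp Jm : ∀ x : M, TangentSpace (𝓡 4) x →L[ℝ] TangentSpace (𝓡 4) x,
        (∀ x ∈ U, IsRegularPoint (𝓡 4) (𝓡 2) F x →
          IsAdapted oN F x (o x) (Jp x) ∧ IsAdapted oN F x (-(o x)) (Jm x)) →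
      ∀ m ∈ K ∩ U, IsRegularPoint (𝓡 4) (𝓡 2) F m →
        EndMDiffAt (𝓡 4) Jp m ∧ EndMDiffAt (𝓡 4) Jm m ∧
        ∀ T : TangentSpace (𝓡 4) m, mfderiv (𝓡 4) (𝓡 2) F m T = 0 → ‖T‖ = 1 →
          hsNorm (covDerivEnd (𝓡 4) Jp m T) * hsNorm (covDerivEnd (𝓡 4) Jm m T) ≤ A := by
  refine ⟨fun m hm o => existsUnique_isAdapted hoN hF hm o, fun K hK => ?_⟩
  choose W hW C hC hB using exists_hessian_bound (𝓡 4) (M := M)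
  obtain ⟨s, hs⟩ := hK.elim_nhds_subcover W fun x _ => hW x
  -- the sum of the constants of a finite subcover bounds each of them
  refine ⟨6 * ∑ p ∈ s, C p, fun U o hU ho Jp Jm hJ m hm hr => ?_⟩
  obtain ⟨a, c, h⟩ := exists_pullbackCoordinate hoN hF m
  have hreg := IsPullbackCoordinateAt.eventually_regular h hr
  have hJp : ∀ᶠ y in 𝓝 m, IsAdapted oN F y (o y) (Jp y) := by
    filter_upwards [hreg, hU.mem_nhds hm.2] with y hy hyU using (hJ y hyU hy).1
  have hJm : ∀ᶠ y in 𝓝 m, IsAdapted oN F y (-(o y)) (Jm y) := by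
    filter_upwards [hreg, hU.mem_nhds hm.2] with y hy hyU using (hJ y hyU hy).2
  have hJpd := endMDiffAt_of_isAdapted h ho hm.2 hr hJp
  have hJmd := endMDiffAt_of_isAdapted h (ho.neg (𝓡 4) 3) hm.2 hr hJm
  refine ⟨hJpd, hJmd, fun T hT hT1 => ?_⟩
  obtain ⟨p, hp, hmp⟩ := mem_iUnion₂.1 (hs.2 hm.1)
  have hx := h.self_of_nhds
  refine (hsNorm_mul_hsNorm_le h hr hJp hJm hJpd hJmd (hC p) (fun b => hB p m hmp a c
    hx.contMDiffAt_left hx.contMDiffAt_right (h.mono fun y hy => hy.laplacian_left)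
    (h.mono fun y hy => hy.laplacian_right)
    (h.mono fun y hy => ⟨hy.inner_self, hy.inner_eq_zero⟩) b) hT hT1).trans ?_
  gcongr
  exact Finset.single_le_sum (fun i _ => hC i) hp
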